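/- Let $\Lambda>0$, $M,a,e\in\mathbb{R}$ with $a\neq0$, and put $$\Delta_r=(r^2+a^2)\Bigl(1-\frac{\Lambda}{3}r^2\Bigr)-2Mr+e^2,\quad \Delta_\theta=1+\frac{\Lambda}{3}a^2\cos^2\theta,\quad \rho^2=r^2+a^2\cos^2\theta,\quad \Xi=1+\frac{\Lambda}{3}a^2,$$ $$\Upsilon=(r^2+a^2)^2\Delta_\theta-a^2\sin^2\theta\,\Delta_r .$$ Assume the black hole is subextremal: $\Delta_r$ has four real roots $r_n<0<r_-<r_+<r_c$. Let $g$ be the Kerr--Newman--de Sitter metric $$g=\frac{\rho^2}{\Delta_r}dr^2+\frac{\rho^2}{\Delta_\theta}d\theta^2+\frac{a^2\sin^2\theta\,\Delta_\theta-\Delta_r}{\rho^2}dt^2+\frac{\sin^2\theta}{\Xi^2\rho^2}\Upsilon\,d\phi^2-\frac{2a\sin^2\theta}{\Xi\rho^2}\bigl((r^2+a^2)\Delta_\theta-\Delta_r\bigr)d\phi\,dt$$ in the black hole region $t\in\mathbb{R}$, $r_-<r<r_+$, $0<\theta<\pi$, $\phi\in\mathbb{S}^1$. Let $\hat P(\theta,\lambda)=|a|\sqrt{\lambda\Delta_\theta-\sin^2\theta}$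 and $\hat Q(r,\lambda)=\sqrt{(r^2+a^2)^2-a^2\lambda\Delta_r}$. For $r\in[r_-,r_+]$ and $\theta\in(0,\frac{\pi}{2})$, let $\theta_\star=\theta_\star(r,\theta)\in[\theta,\frac{\pi}{2})$ be the solution of $$F(r,\theta,\theta_\star):=\int_{\theta_\star}^{\theta}\frac{d\theta'}{\hat P(\theta',\sin^2\theta_\star)}+\int_r^{r_+}\frac{dr'}{\hat Q(r',\sin^2\theta_\star)}=0,$$ and let $\theta_\star(r,0)=0$, $\theta_\star(r,\frac{\pi}{2})=\frac{\pi}{2}$, $\theta_\star(r,\theta)=\pi-\theta_\star(r,\pi-\theta)$ for $\theta\in(\frac{\pi}{2},\pi]$. Fix $r_0\in(r_-,r_+)$, let $f:[0,1]\to\mathbb{R}$ satisfy $f(0)=0$ and $f'(\lambda)=-\int_0^{\arcsin\sqrt\lambda}\frac{d\theta'}{\hat P(\theta',\lambda)}$ for $0<\lambda<1$, put $$\varrho(r,\theta,\lambda)=\int_{r_0}^r\frac{r'^2+a^2}{\Delta_{r'}}dr'+\int_r^{r_+}\frac{r'^2+a^2-\hat Q(r',\lambda)}{\Delta_{r'}}dr'+\int_0^\theta\frac{\hat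 P(\theta',\lambda)}{\Delta_{\theta'}}d\theta'+\frac{a^2}{2}f(\lambda),$$ and let $r_\star(r,\theta)=\varrho(r,\theta,\sin^2\theta_\star(r,\theta))$ for $\theta\in[0,\frac{\pi}{2}]$, $r_\star(r,\theta)=r_\star(r,\pi-\theta)$ for $\theta\in(\frac{\pi}{2},\pi]$. Let $h(r_\star,\theta_\star)$ be the function with $$\partial_{r_\star}h=-\frac{\Xi a((r^2+a^2)\Delta_\theta-\Delta_r)}{\Upsilon},\qquad h(0,\theta_\star)=0,$$ and put $u=\frac{r_\star-t}{2}$, $v=\frac{r_\star+t}{2}$, $\phi_\star=\phi-h(r_\star,\theta_\star)$. Then $\theta_\star$ is well defined (the solution above exists and is unique); $(r,\theta)\mapsto(r_\star,\theta_\star)$ is a bijection from $(r_-,r_+)\times(0,\pi)$ onto $\mathbb{R}\times(0,\pi)$; and $(t,r,\theta,\phi)$ are differentiable functions of $(u,v,\theta_\star,\phi_\star)$ (with $\phi$ and $\phi_\star$ lifted to $\mathbb{R}$), in which $g$ has differentiable components and nonvanishing determinant. The Christoffel symbols $\Gamma^k_{ij}$ of $g$ in the coordinates $(u,v,\theta_\star,\phi_\star)$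 satisfy the following. 1. Each of them other than $\Gamma^{\phi_\star}_{v\theta_\star}=\Gamma^{\phi_\star}_{\theta_\star v}$ and $\Gamma^{\phi_\star}_{\theta_\star\phi_\star}=\Gamma^{\phi_\star}_{\phi_\star\theta_\star}$ is bounded on the whole coordinate range $u,v\in\mathbb{R}$, $\theta_\star\in(0,\pi)$, $\phi_\star\in\mathbb{S}^1$. 2. These two blow up exactly like $\frac{1}{\sin\theta_\star}$ at the poles: for each of them there are constants $c,C,\delta>0$ such that $|\Gamma|\leq\frac{C}{\sin\theta_\star}$ on the whole coordinate range and $|\Gamma|\geq\frac{c}{\sin\theta_\star}$ wherever $\sin\theta_\star<\delta$. -/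

import Mathlib

open Set

noncomputable section

namespace KNdS

/-- The constants of a Kerr-Newman-de Sitter black hole: cosmological constant `Λ`, mass parameter
`M`, angular momentum parameter `a`, charge parameter `e`; the radii `rm` (Cauchy horizon) and `rp`
(event horizon); and the base point `r0` of the tortoise integral. Pure data, no assumptions. -/
structure Params where
  Λ : ℝ
  M : ℝ
  a : ℝ
  e : ℝ
  rm : ℝ
  rp : ℝ
  r0 : ℝ

variable (p : Params)

/-! ### The metric in Boyer-Lindquist coordinates -/

def Δr (r : ℝ) : ℝ := (r ^ 2 + p.a ^ 2) * (1 - p.Λ / 3 * r ^ 2) - 2 * p.M * r + p.e ^ 2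

def Δθ (θ : ℝ) : ℝ := 1 + p.Λ / 3 * p.a ^ 2 * Real.cos θ ^ 2

/-- `ρ²`. -/
def rhoSq (r θ : ℝ) : ℝ := r ^ 2 + p.a ^ 2 * Real.cos θ ^ 2

def Ξ : ℝ := 1 + p.Λ / 3 * p.a ^ 2

def Υ (r θ : ℝ) : ℝ := (r ^ 2 + p.a ^ 2) ^ 2 * Δθ p θ - p.a ^ 2 * Real.sin θ ^ 2 * Δr p r

/-- Half of the coefficient of `dφ dt` in the metric. -/
def gtφ (r θ : ℝ) : ℝ :=
  -(p.a * Real.sin θ ^ 2 / (Ξ p * rhoSq p r θ) * ((r ^ 2 + p.a ^ 2) * Δθ p θ - Δr p r))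

/-- Components of the KNdS metric at the point `x = (t, r, θ, φ)`. -/
def metricBL (x : Fin 4 → ℝ) : Matrix (Fin 4) (Fin 4) ℝ :=
  let r := x 1
  let θ := x 2
  !![(p.a ^ 2 * Real.sin θ ^ 2 * Δθ p θ - Δr p r) / rhoSq p r θ, 0, 0, gtφ p r θ;
     0, rhoSq p r θ / Δr p r, 0, 0;
     0, 0, rhoSq p r θ / Δθ p θ, 0;
     gtφ p r θ, 0, 0, Real.sin θ ^ 2 / (Ξ p ^ 2 * rhoSq p r θ) * Υ p r θ]

/-! ### The coordinate `θ⋆` -/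

/-- `P̂(θ, lam)`, with `lam = sin² θ⋆`. -/
def P (θ lam : ℝ) : ℝ := |p.a| * Real.sqrt (lam * Δθ p θ - Real.sin θ ^ 2)

/-- `Q̂(r, lam)`, with `lam = sin² θ⋆`. -/
def Q (r lam : ℝ) : ℝ := Real.sqrt ((r ^ 2 + p.a ^ 2) ^ 2 - p.a ^ 2 * lam * Δr p r)

/-- The function `F(r, θ, θ⋆)` whose zero defines `θ⋆`. -/
def F (r θ τ : ℝ) : ℝ :=
  (∫ s in τ..θ, 1 / P p s (Real.sin τ ^ 2)) + ∫ s in r..p.rp, 1 / Q p s (Real.sin τ ^ 2)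

/-- `θ⋆(r, θ)` on the northern hemisphere `0 ≤ θ ≤ π / 2`. -/
def thetaStarNorth (r θ : ℝ) : ℝ :=
  if θ = 0 then 0
  else if θ = Real.pi / 2 then Real.pi / 2
  else Classical.epsilon fun τ : ℝ => τ ∈ Ico θ (Real.pi / 2) ∧ F p r θ τ = 0

/-- `θ⋆(r, θ)` for `0 ≤ θ ≤ π`, extended by reflection in the equator. -/
def thetaStar (r θ : ℝ) : ℝ :=
  if θ ≤ Real.pi / 2 then thetaStarNorth p r θ
  else Real.pi - thetaStarNorth p r (Real.pi - θ)

/-! ### The coordinate `r⋆` -/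

/-- The function `f` with `f 0 = 0` and
`f'(lam) = - ∫_0^{arcsin √lam} dθ' / P̂(θ', lam)`. -/
def f (lam : ℝ) : ℝ :=
  ∫ l in (0 : ℝ)..lam, -∫ s in (0 : ℝ)..Real.arcsin (Real.sqrt l), 1 / P p s l

/-- The function `ϱ(r, θ, lam)`. -/
def varrho (r θ lam : ℝ) : ℝ :=
  (∫ s in p.r0..r, (s ^ 2 + p.a ^ 2) / Δr p s)
    + (∫ s in r..p.rp, (s ^ 2 + p.a ^ 2 - Q p s lam) / Δr p s)
    + (∫ s in (0 : ℝ)..θ, P p s lam / Δθ p s)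
    + p.a ^ 2 / 2 * f p lam

/-- `r⋆(r, θ)` for `0 ≤ θ ≤ π`, extended by reflection in the equator. -/
def rStar (r θ : ℝ) : ℝ :=
  if θ ≤ Real.pi / 2 then varrho p r θ (Real.sin (thetaStar p r θ) ^ 2)
  else varrho p r (Real.pi - θ) (Real.sin (thetaStar p r (Real.pi - θ)) ^ 2)

/-! ### The coordinates `(u, v, θ⋆, φ⋆)` -/

/-- The black hole region, in the variables `(r, θ)`, without the axis. -/
def region : Set (ℝ × ℝ) := Ioo p.rm p.rp ×ˢ Ioo 0 Real.pi

/-- The map `(r, θ) ↦ (r⋆, θ⋆)`. -/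
def starMap (q : ℝ × ℝ) : ℝ × ℝ := (rStar p q.1 q.2, thetaStar p q.1 q.2)

/-- The inverse map `(r⋆, θ⋆) ↦ (r, θ)`. -/
def starInv : ℝ × ℝ → ℝ × ℝ := Function.invFunOn (starMap p) (region p)

def B (r θ : ℝ) : ℝ := Ξ p * p.a * ((r ^ 2 + p.a ^ 2) * Δθ p θ - Δr p r) / Υ p r θ

/-- `h(r⋆, θ⋆)`, the function with `∂h/∂r⋆ = -B` and `h(0, θ⋆) = 0`; `φ⋆ = φ - h`. -/
def h (s τ : ℝ) : ℝ :=
  ∫ σ in (0 : ℝ)..s, -B p (starInv p (σ, τ)).1 (starInv p (σ, τ)).2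

/-- The Boyer-Lindquist coordinates `(t, r, θ, φ)` of the point with coordinates
`y = (u, v, θ⋆, φ⋆)`, where `u = (r⋆ - t) / 2`, `v = (r⋆ + t) / 2`, `φ⋆ = φ - h(r⋆, θ⋆)`. -/
def toBL (y : Fin 4 → ℝ) : Fin 4 → ℝ :=
  ![y 1 - y 0, (starInv p (y 0 + y 1, y 2)).1, (starInv p (y 0 + y 1, y 2)).2,
    y 3 + h p (y 0 + y 1) (y 2)]

/-- The range of the coordinates `(u, v, θ⋆, φ⋆)`: all real `u`, `v`, all `θ⋆` in `(0, π)`, and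
all real `φ⋆` (a lift of the angle to the real line). -/
def nullDomain : Set (Fin 4 → ℝ) := {y | y 2 ∈ Ioo 0 Real.pi}

end KNdS

/-! ### Metrics in coordinates and their Christoffel symbols -/

/-- The partial derivative of a real function in the direction of the `i`-th coordinate. -/
def partialDeriv (i : Fin 4) (F : (Fin 4 → ℝ) → ℝ) (y : Fin 4 → ℝ) : ℝ :=
  fderiv ℝ F y (Pi.single i 1)

/-- The components, in new coordinates `y`, of the metric with components `g` in the coordinates
`x = X y`. -/
def pullbackMetric (g : (Fin 4 → ℝ) → Matrix (Fin 4) (Fin 4) ℝ) (X : (Fin 4 → ℝ) → (Fin 4 → ℝ))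
    (y : Fin 4 → ℝ) : Matrix (Fin 4) (Fin 4) ℝ :=
  Matrix.of fun i j => ∑ k, ∑ l,
    g (X y) k l * partialDeriv i (fun z => X z k) y * partialDeriv j (fun z => X z l) y

/-- The Christoffel symbol `Γ^k_{ij}` of the metric with components `g`. -/
def christoffel (g : (Fin 4 → ℝ) → Matrix (Fin 4) (Fin 4) ℝ) (k i j : Fin 4)
    (y : Fin 4 → ℝ) : ℝ :=
  1 / 2 * ∑ l, (g y)⁻¹ k l *
    (partialDeriv i (fun z => g z j l) y + partialDeriv j (fun z => g z i l) y
      - partialDeriv l (fun z => g z i j) y)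

namespace KNdS

/-- The components of the KNdS metric in the coordinates `(u, v, θ⋆, φ⋆)`. -/
def metricNull (p : Params) : (Fin 4 → ℝ) → Matrix (Fin 4) (Fin 4) ℝ :=
  pullbackMetric (metricBL p) (toBL p)

/-- The index triples `(k, i, j)` of the symbols `Γ^{φ⋆}_{v θ⋆} = Γ^{φ⋆}_{θ⋆ v}` and
`Γ^{φ⋆}_{θ⋆ φ⋆} = Γ^{φ⋆}_{φ⋆ θ⋆}`; the coordinates `u, v, θ⋆, φ⋆` have indices `0, 1, 2, 3`. -/
def exceptional : Set (Fin 4 × Fin 4 × Fin 4) :=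
  {(3, 1, 2), (3, 2, 1), (3, 2, 3), (3, 3, 2)}

end KNdS

end

/-! Write `λ = sin² θ⋆`. At fixed `λ` the function `ϱ` has `∂ϱ/∂r = Q/Δr` and `∂ϱ/∂θ = P/Δθ`, and `Υ
= Q² Δθ + P² Δr` for every `λ` (`UU_eq`); so `ϱ` is a complete integral of the eikonal equation that
makes `r⋆ ± t` null. The choice of `f'` gives `∂ϱ/∂λ = (a²/2) F`, hence the equation `F = 0` for
`θ⋆` says that `ϱ` is stationary in `λ`, and the dependence of `θ⋆` on the point adds nothing to the
derivatives of `r⋆`. The result (`metricNull_eq`) is the double null form `-4 W du dv + E dθ⋆² + H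
(dφ⋆ + w dθ⋆ + b dv)²` with `W = Δr W₁`, `H = sin² θ⋆ H₁`, `b = -2 B`, `w = ∂h/∂θ⋆`.

The angular elliptic integral degenerates at the equator and at the poles. The substitution `ζ = tan
θ' / tan θ⋆` removes this: it becomes `ellA z τ`, an integral from `z = tan θ / tan θ⋆` to `1` of a
function smooth in `τ = θ⋆` for all real `τ`. The equation for `θ⋆` reads `ellA z τ = ellT r τ`.
Comparing both sides with differences of arctangents, and using `(Λ/3) rp² < 1`, gives a solution `z
= zz r τ` in `[zmin, 1]` with `zmin > 0` (`exists_z`). It is `C¹` on the closed radial interval,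
horizons included, so the pair `(r, θ⋆)` serves as intermediate coordinates: `θ = Th r τ` has
`∂θ/∂θ⋆ ≥ zmin`, which makes `θ⋆` well defined, and `∂r⋆/∂r` is negative and of size `1/|Δr|`, so
that `r⋆` runs through all of `ℝ` (`bijOn_starMap`).

Boundedness is then bookkeeping. A function that is `C¹` in `(r, θ⋆)` up to the horizons and poles
is `Good`: in the coordinates `(r⋆, θ⋆)` it is bounded, its `r⋆`-derivative is `O(Δr)` and its
`θ⋆`-derivative is bounded (`good_pull`). This class is closed under the algebra needed, and every
coefficient except `w` lies in it by construction. For `w` two facts are used. At a zero of `Δr` the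
quantity `B` does not depend on `θ`, so `∂B/∂θ⋆ = sin θ⋆ · Δr · bq` with `bq` good (`goodGrad_bet`);
and `∫ |Δr| dr⋆` over a line of constant `θ⋆` is at most a multiple of `rp - rm` (`bd_integral`).
Hence `w = sin θ⋆ · w0` with `w0` bounded.

In the Christoffel symbols, each `1/Δr` of the inverse metric meets a numerator divisible by `Δr`
(`L_zero`, `L_one`). The factor `1/H` costs `1/sin² θ⋆`, of which only `∂(sin² θ⋆)/∂θ⋆` leaves
something unbounded, namely `cot θ⋆`. It survives with coefficient `b` in the symbol `φ⋆; v θ⋆` and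
`1` in `φ⋆; θ⋆ φ⋆` (`L_three`); as `b` is bounded away from `0` (`bb_ge`), both blow up exactly like
`1/sin θ⋆`. -/

namespace KNdS

open Filter Topology MeasureTheory

noncomputable section

/-! ### Strict differentiability of functions on the plane -/

/-- The linear form `(x, y) ↦ a x + b y` on the plane. -/
def lin (a b : ℝ) : ℝ × ℝ →L[ℝ] ℝ :=
  a • ContinuousLinearMap.fst ℝ ℝ ℝ + b • ContinuousLinearMap.snd ℝ ℝ ℝ

@[simp] theorem lin_apply (a b : ℝ) (q : ℝ × ℝ) : lin a b q = a * q.1 + b * q.2 := by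
  simp [lin]

/-- Strict differentiability of a function of two variables, with its two partial derivatives. -/
def HasGrad (f : ℝ × ℝ → ℝ) (a b : ℝ) (q : ℝ × ℝ) : Prop := HasStrictFDerivAt f (lin a b) q

namespace HasGrad

variable {f g : ℝ × ℝ → ℝ} {a b a' b' : ℝ} {q : ℝ × ℝ}

theorem congr (h : HasGrad f a b q) (ha : a = a') (hb : b = b') : HasGrad f a' b' q := by
  subst ha hb; exact h

theorem congr_of_eventuallyEq (h : HasGrad f a b q) (hfg : f =ᶠ[𝓝 q] g) : HasGrad g a b q :=
  HasStrictFDerivAt.congr_of_eventuallyEq h hfg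

theorem fst : HasGrad (fun q => q.1) 1 0 q := by
  have h : HasStrictFDerivAt (fun q : ℝ × ℝ => q.1) (ContinuousLinearMap.fst ℝ ℝ ℝ) q :=
    hasStrictFDerivAt_fst
  exact h.congr_fderiv (by ext <;> simp)

theorem snd : HasGrad (fun q => q.2) 0 1 q := by
  have h : HasStrictFDerivAt (fun q : ℝ × ℝ => q.2) (ContinuousLinearMap.snd ℝ ℝ ℝ) q :=
    hasStrictFDerivAt_snd
  exact h.congr_fderiv (by ext <;> simp)

theorem const (c : ℝ) : HasGrad (fun _ => c) 0 0 q := by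
  have h : HasStrictFDerivAt (fun _ : ℝ × ℝ => c) (0 : ℝ × ℝ →L[ℝ] ℝ) q :=
    hasStrictFDerivAt_const c q
  exact h.congr_fderiv (by ext <;> simp)

theorem add (hf : HasGrad f a b q) (hg : HasGrad g a' b' q) :
    HasGrad (fun q => f q + g q) (a + a') (b + b') q :=
  (HasStrictFDerivAt.add hf hg).congr_fderiv (by ext <;> simp)

theorem sub (hf : HasGrad f a b q) (hg : HasGrad g a' b' q) :
    HasGrad (fun q => f q - g q) (a - a') (b - b') q :=
  (HasStrictFDerivAt.sub hf hg).congr_fderiv (by ext <;> simp)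

theorem mul (hf : HasGrad f a b q) (hg : HasGrad g a' b' q) :
    HasGrad (fun q => f q * g q) (a * g q + f q * a') (b * g q + f q * b') q :=
  (HasStrictFDerivAt.mul hf hg).congr_fderiv (by ext <;> simp <;> ring)

theorem comp_deriv {φ : ℝ → ℝ} {φ' : ℝ} (hφ : HasStrictDerivAt φ φ' (f q))
    (hf : HasGrad f a b q) : HasGrad (fun q => φ (f q)) (φ' * a) (φ' * b) q :=
  (hφ.comp_hasStrictFDerivAt q hf).congr_fderiv (by ext <;> simp)

theorem comp₂ {u v : ℝ × ℝ → ℝ} {ux uy vx vy : ℝ} (hf : HasGrad f a b (u q, v q))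
    (hu : HasGrad u ux uy q) (hv : HasGrad v vx vy q) :
    HasGrad (fun q => f (u q, v q)) (a * ux + b * vx) (a * uy + b * vy) q := by
  have h : HasStrictFDerivAt f (lin a b) ((fun q => (u q, v q)) q) := hf
  exact (HasStrictFDerivAt.comp q h (HasStrictFDerivAt.prodMk hu hv)).congr_fderiv
    (by ext <;> simp)

theorem continuousAt (h : HasGrad f a b q) : ContinuousAt f q := HasStrictFDerivAt.continuousAt h

theorem hasFDerivAt (h : HasGrad f a b q) : HasFDerivAt f (lin a b) q :=
  HasStrictFDerivAt.hasFDerivAt h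

theorem hasDerivAt_fst {x y : ℝ} (h : HasGrad f a b (x, y)) :
    HasDerivAt (fun x => f (x, y)) a x := by
  have h1 : HasDerivAt (fun x : ℝ => (x, y)) ((1 : ℝ), (0 : ℝ)) x :=
    (hasDerivAt_id x).prodMk (hasDerivAt_const x y)
  have := HasFDerivAt.comp_hasDerivAt x (f := fun x : ℝ => (x, y)) h.hasFDerivAt h1
  exact this.congr_deriv (by simp)

theorem hasDerivAt_snd {x y : ℝ} (h : HasGrad f a b (x, y)) :
    HasDerivAt (fun y => f (x, y)) b y := by
  have h1 : HasDerivAt (fun y : ℝ => (x, y)) ((0 : ℝ), (1 : ℝ)) y :=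
    (hasDerivAt_const y x).prodMk (hasDerivAt_id y)
  have := HasFDerivAt.comp_hasDerivAt y (f := fun y : ℝ => (x, y)) h.hasFDerivAt h1
  exact this.congr_deriv (by simp)

/-- Continuous partial derivatives give strict differentiability. -/
theorem of_partial {f : ℝ → ℝ → ℝ} {f₁ f₂ : ℝ × ℝ → ℝ} {q : ℝ × ℝ}
    (h₁ : ∀ᶠ v in 𝓝 q, HasDerivAt (fun x => f x v.2) (f₁ v) v.1)
    (h₂ : ∀ᶠ v in 𝓝 q, HasDerivAt (fun y => f v.1 y) (f₂ v) v.2)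
    (c₁ : ContinuousAt f₁ q) (c₂ : ContinuousAt f₂ q) :
    HasGrad (fun v => f v.1 v.2) (f₁ q) (f₂ q) q := by
  have key := hasStrictFDerivAt_uncurry_coprod (𝕜 := ℝ) (u := q) (f := f)
    (f₁ := fun x y => ContinuousLinearMap.toSpanSingleton ℝ (f₁ (x, y)))
    (f₂ := fun x y => ContinuousLinearMap.toSpanSingleton ℝ (f₂ (x, y)))
    (h₁.mono fun v hv => hv.hasFDerivAt) (h₂.mono fun v hv => hv.hasFDerivAt)
    ((ContinuousLinearMap.toSpanSingletonCLE (𝕜 := ℝ) (E := ℝ)).continuous.continuousAt.comp c₁)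
    ((ContinuousLinearMap.toSpanSingletonCLE (𝕜 := ℝ) (E := ℝ)).continuous.continuousAt.comp c₂)
  exact key.congr_fderiv (by ext <;> simp [Function.HasUncurry.uncurry])

/-- A local left inverse of a skew product `(x, y) ↦ (f (x, y), y)` is strictly differentiable. -/
theorem local_left_inverse {f g : ℝ × ℝ → ℝ} {a b : ℝ} {q : ℝ × ℝ} (h : HasGrad f a b q)
    (ha : a ≠ 0) (hg : ∀ᶠ v in 𝓝 q, g (f v, v.2) = v.1) :
    HasGrad g a⁻¹ (-(b / a)) (f q, q.2) := by
  let e : (ℝ × ℝ) ≃L[ℝ] (ℝ × ℝ) := ContinuousLinearEquiv.equivOfInverse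
    ((lin a b).prod (ContinuousLinearMap.snd ℝ ℝ ℝ))
    ((lin a⁻¹ (-(b / a))).prod (ContinuousLinearMap.snd ℝ ℝ ℝ))
    (by intro v; ext <;> simp; field_simp; ring) (by intro v; ext <;> simp; field_simp; ring)
  have h1 : HasStrictFDerivAt (fun v => (f v, v.2)) (e : (ℝ × ℝ) →L[ℝ] (ℝ × ℝ)) q :=
    HasStrictFDerivAt.prodMk h hasStrictFDerivAt_snd
  have h2 := h1.to_local_left_inverse (g := fun v => (g v, v.2))
    (hg.mono fun v hv => by simp [hv])
  have h3 := hasStrictFDerivAt_fst.comp (f q, q.2) h2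
  exact h3

end HasGrad

/-! ### Parametric primitives -/

/-- Tube lemma: a compact horizontal segment inside an open set has a closed rectangular
neighbourhood inside it. -/
theorem exists_box {U : Set (ℝ × ℝ)} (hU : IsOpen U) {x₀ x₁ y₀ : ℝ}
    (hseg : ∀ s ∈ uIcc x₀ x₁, (s, y₀) ∈ U) :
    ∃ ε > 0, ∀ s t, min x₀ x₁ - ε ≤ s → s ≤ max x₀ x₁ + ε → |t - y₀| ≤ ε → (s, t) ∈ U := by
  obtain ⟨u, v, hu, hv, hxu, hyv, huv⟩ := generalized_tube_lemma (s := uIcc x₀ x₁) isCompact_uIcc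
    (t := {y₀}) isCompact_singleton hU (by rintro ⟨s, t⟩ ⟨hs, ht⟩; cases ht; exact hseg s hs)
  obtain ⟨δ, hδ, hδu⟩ := isCompact_uIcc.exists_cthickening_subset_open hu hxu
  obtain ⟨η, hη, hηv⟩ := Metric.isOpen_iff.1 hv y₀ (hyv rfl)
  refine ⟨min δ (η / 2), by positivity, fun s t h1 h2 h3 => huv ⟨hδu ?_, hηv ?_⟩⟩
  · have hm : min δ (η / 2) ≤ δ := min_le_left _ _
    rcases lt_or_ge s (min x₀ x₁) with hs | hs
    · refine Metric.mem_cthickening_of_dist_le s (min x₀ x₁) δ _ ⟨le_rfl, min_le_max⟩ ?_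
      rw [Real.dist_eq, abs_le]; constructor <;> linarith
    · rcases lt_or_ge (max x₀ x₁) s with hs' | hs'
      · refine Metric.mem_cthickening_of_dist_le s (max x₀ x₁) δ _ ⟨min_le_max, le_rfl⟩ ?_
        rw [Real.dist_eq, abs_le]; constructor <;> linarith
      · exact Metric.self_subset_cthickening _ ⟨hs, hs'⟩
  · rw [Metric.mem_ball, Real.dist_eq]
    have : min δ (η / 2) ≤ η / 2 := min_le_right _ _
    linarith

theorem uIcc_subset_box {x₀ x₁ x ε : ℝ} (hx : |x - x₁| ≤ ε) {s : ℝ} (hs : s ∈ uIcc x₀ x) :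
    min x₀ x₁ - ε ≤ s ∧ s ≤ max x₀ x₁ + ε := by
  rw [abs_le] at hx
  have hε : 0 ≤ ε := by linarith
  rcases hs with ⟨h1, h2⟩
  constructor
  · refine le_trans ?_ h1
    rw [le_min_iff]
    exact ⟨by linarith [min_le_left x₀ x₁], by linarith [min_le_right x₀ x₁]⟩
  · refine le_trans h2 ?_
    rw [max_le_iff]
    exact ⟨by linarith [le_max_left x₀ x₁], by linarith [le_max_right x₀ x₁]⟩

theorem continuousAt_integral_param {g : ℝ → ℝ → ℝ} {U : Set (ℝ × ℝ)} (hU : IsOpen U)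
    (hg : ContinuousOn (fun q : ℝ × ℝ => g q.1 q.2) U) {x₀ x₁ y₀ : ℝ}
    (hseg : ∀ s ∈ uIcc x₀ x₁, (s, y₀) ∈ U) :
    ContinuousAt (fun q : ℝ × ℝ => ∫ s in x₀..q.1, g s q.2) (x₁, y₀) := by
  obtain ⟨ε, hε, hbox⟩ := exists_box hU hseg
  -- Clamping both variables to the box makes the integrand continuous on the whole plane without
  -- changing it near the segment.
  let cs : ℝ → ℝ := fun s => max (min x₀ x₁ - ε) (min s (max x₀ x₁ + ε))
  let ct : ℝ → ℝ := fun t => max (y₀ - ε) (min t (y₀ + ε))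
  have hmm : min x₀ x₁ ≤ max x₀ x₁ := min_le_max
  have hG : Continuous fun q : ℝ × ℝ => g (cs q.1) (ct q.2) := by
    refine hg.comp_continuous (f := fun q : ℝ × ℝ => (cs q.1, ct q.2)) (by fun_prop) ?_
    intro q
    refine hbox _ _ (le_max_left _ _) (max_le (by linarith) (min_le_right _ _)) ?_
    rw [abs_le]
    constructor
    · linarith [le_max_left (y₀ - ε) (min q.2 (y₀ + ε))]
    · linarith [max_le (by linarith : y₀ - ε ≤ y₀ + ε) (min_le_right q.2 (y₀ + ε))]
  have hcont : Continuous fun q : ℝ × ℝ => ∫ s in x₀..q.1, g (cs s) (ct q.2) := by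
    refine intervalIntegral.continuous_parametric_intervalIntegral_of_continuous
      (f := fun (q : ℝ × ℝ) s => g (cs s) (ct q.2)) ?_ continuous_fst
    exact hG.comp (f := fun z : (ℝ × ℝ) × ℝ => (z.2, z.1.2)) (by fun_prop)
  refine hcont.continuousAt.congr ?_
  have hnear : ∀ᶠ q : ℝ × ℝ in 𝓝 (x₁, y₀), |q.1 - x₁| < ε ∧ |q.2 - y₀| < ε := by
    refine (IsOpen.mem_nhds (s := {q : ℝ × ℝ | |q.1 - x₁| < ε ∧ |q.2 - y₀| < ε}) ?_ ?_)
    · exact (isOpen_lt (f := fun q : ℝ × ℝ => |q.1 - x₁|) (by fun_prop) continuous_const).inter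
        (isOpen_lt (f := fun q : ℝ × ℝ => |q.2 - y₀|) (by fun_prop) continuous_const)
    · simp [hε]
  filter_upwards [hnear] with q hq
  refine intervalIntegral.integral_congr fun s hs => ?_
  have h1 := uIcc_subset_box hq.1.le hs
  have h2 := abs_lt.1 hq.2
  have e1 : cs s = s := by simp only [cs]; rw [min_eq_left h1.2, max_eq_right h1.1]
  have e2 : ct q.2 = q.2 := by
    simp only [ct]; rw [min_eq_left (by linarith), max_eq_right (by linarith)]
  simp only [e1, e2]

/-- The fundamental theorem in the endpoint and differentiation under the integral in the parameter
give continuous partial derivatives, hence strict differentiability. Every elliptic integral below,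
and `h` itself, is differentiated through this statement. -/
theorem hasGrad_integral_param {g g' : ℝ → ℝ → ℝ} {U : Set (ℝ × ℝ)} (hU : IsOpen U)
    (hg : ContinuousOn (fun q : ℝ × ℝ => g q.1 q.2) U)
    (hg' : ContinuousOn (fun q : ℝ × ℝ => g' q.1 q.2) U)
    (hd : ∀ s t, (s, t) ∈ U → HasDerivAt (fun t => g s t) (g' s t) t) {x₀ x₁ y₀ : ℝ}
    (hseg : ∀ s ∈ uIcc x₀ x₁, (s, y₀) ∈ U) :
    HasGrad (fun q : ℝ × ℝ => ∫ s in x₀..q.1, g s q.2) (g x₁ y₀) (∫ s in x₀..x₁, g' s y₀)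
      (x₁, y₀) := by
  obtain ⟨ε, hε, hbox⟩ := exists_box hU hseg
  have hslice : ∀ {h : ℝ → ℝ → ℝ}, ContinuousOn (fun q : ℝ × ℝ => h q.1 q.2) U → ∀ {x t : ℝ},
      |x - x₁| ≤ ε → |t - y₀| ≤ ε → ContinuousOn (fun s => h s t) (uIcc x₀ x) := by
    intro h hh x t hx ht
    refine hh.comp (f := fun s => (s, t)) (by fun_prop) fun s hs => ?_
    have := uIcc_subset_box hx hs
    exact hbox _ _ this.1 this.2 ht
  -- The radius `ε / 2` in the parameter leaves room for a ball of radius `ε / 2` about `v.2` inside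
  -- the box, where the bound `C` on `g'` dominates.
  have hnear : ∀ᶠ q : ℝ × ℝ in 𝓝 (x₁, y₀), |q.1 - x₁| < ε ∧ |q.2 - y₀| < ε / 2 := by
    refine (IsOpen.mem_nhds (s := {q : ℝ × ℝ | |q.1 - x₁| < ε ∧ |q.2 - y₀| < ε / 2}) ?_ ?_)
    · exact (isOpen_lt (f := fun q : ℝ × ℝ => |q.1 - x₁|) (by fun_prop) continuous_const).inter
        (isOpen_lt (f := fun q : ℝ × ℝ => |q.2 - y₀|) (by fun_prop) continuous_const)
    · simp [hε]
  have hK : IsCompact (Icc (min x₀ x₁ - ε) (max x₀ x₁ + ε) ×ˢ Icc (y₀ - ε) (y₀ + ε)) :=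
    isCompact_Icc.prod isCompact_Icc
  obtain ⟨C, hC⟩ := hK.exists_bound_of_continuousOn (hg'.mono (by
    rintro ⟨s, t⟩ ⟨hs, ht⟩
    exact hbox _ _ hs.1 hs.2 (abs_le.2 ⟨by linarith [ht.1], by linarith [ht.2]⟩)))
  refine HasGrad.of_partial (q := (x₁, y₀)) (f := fun x y => ∫ s in x₀..x, g s y)
    (f₁ := fun q => g q.1 q.2) (f₂ := fun q => ∫ s in x₀..q.1, g' s q.2) ?_ ?_ ?_ ?_
  · filter_upwards [hnear] with v hv
    have hv2 : |v.2 - y₀| ≤ ε := by linarith [hv.2]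
    have hx := uIcc_subset_box hv.1.le (right_mem_uIcc (a := x₀) (b := v.1))
    have hmem : (v.1, v.2) ∈ U := hbox _ _ hx.1 hx.2 hv2
    have hVo : IsOpen {s : ℝ | (s, v.2) ∈ U} := hU.preimage (by fun_prop)
    have hc : ContinuousOn (fun s => g s v.2) {s : ℝ | (s, v.2) ∈ U} :=
      hg.comp (f := fun s => (s, v.2)) (by fun_prop) fun s hs => hs
    exact intervalIntegral.integral_hasDerivAt_right
      (hslice hg hv.1.le hv2).intervalIntegrable
      (hc.stronglyMeasurableAtFilter hVo v.1 hmem) (hc.continuousAt (hVo.mem_nhds hmem))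
  · filter_upwards [hnear] with v hv
    have hnb : Metric.ball v.2 (ε / 2) ∈ 𝓝 v.2 := Metric.ball_mem_nhds _ (by positivity)
    have hb : ∀ t ∈ Metric.ball v.2 (ε / 2), |t - y₀| ≤ ε := by
      intro t ht
      rw [Metric.mem_ball, Real.dist_eq] at ht
      have h1 := abs_lt.1 ht
      have h2 := abs_lt.1 hv.2
      rw [abs_le]; constructor <;> linarith
    have hself : |v.2 - y₀| ≤ ε := by linarith [hv.2]
    refine (intervalIntegral.hasDerivAt_integral_of_dominated_loc_of_deriv_le (𝕜 := ℝ)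
      (F := fun t s => g s t) (F' := fun t s => g' s t) (bound := fun _ => C) hnb ?_
      (hslice hg hv.1.le hself).intervalIntegrable ?_ ?_ (by simp) ?_).2
    · filter_upwards [hnb] with t ht
      exact ((hslice hg hv.1.le (hb t ht)).mono uIoc_subset_uIcc).aestronglyMeasurable
        measurableSet_uIoc
    · exact ((hslice hg' hv.1.le hself).mono uIoc_subset_uIcc).aestronglyMeasurable
        measurableSet_uIoc
    · refine Eventually.of_forall fun s hs t ht => ?_
      have h1 := uIcc_subset_box hv.1.le (uIoc_subset_uIcc hs)
      have h2 := abs_le.1 (hb t ht)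
      exact hC (s, t) ⟨h1, by linarith, by linarith⟩
    · refine Eventually.of_forall fun s hs t ht => ?_
      have h1 := uIcc_subset_box hv.1.le (uIoc_subset_uIcc hs)
      exact hd s t (hbox _ _ h1.1 h1.2 (hb t ht))
  · exact hg.continuousAt (hU.mem_nhds (hseg x₁ right_mem_uIcc))
  · exact continuousAt_integral_param hU hg' hseg

end

end KNdS

namespace KNdS

open Filter Topology MeasureTheory

noncomputable section

/-! ### Consequences of subextremality -/

/-- The consequences of subextremality that the construction of the coordinates uses. -/
structure Subextremal (p : Params) : Prop where
  Λ_pos : 0 < p.Λ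
  a_ne : p.a ≠ 0
  rm_pos : 0 < p.rm
  rm_lt : p.rm < p.rp
  r0_mem : p.r0 ∈ Ioo p.rm p.rp
  neg : ∀ r ∈ Ioo p.rm p.rp, Δr p r < 0
  zero_m : Δr p p.rm = 0
  zero_p : Δr p p.rp = 0
  rp_lt : p.Λ / 3 * p.rp ^ 2 < 1
  vanish : ∃ C > 0, ∀ r ∈ Ioo p.rm p.rp, -Δr p r ≤ C * (p.rp - r) ∧ -Δr p r ≤ C * (r - p.rm)

/-- `Δr` is a quartic without cubic term, so its roots sum to zero and it factors as `-(Λ/3)` times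
the four linear factors. Both facts are extracted by first and second divided differences (`e1`,
`e2`) at pairs of distinct roots; the sign of `Δr` and its linear vanishing at both horizons are
read off the factorisation. -/
theorem Subextremal.of_roots (p : Params) (rn rc : ℝ)
    (hΛ : 0 < p.Λ) (ha : p.a ≠ 0)
    (hrn : Δr p rn = 0) (hrm : Δr p p.rm = 0) (hrp : Δr p p.rp = 0) (hrc : Δr p rc = 0)
    (h_n : rn < 0) (h_m : 0 < p.rm) (h_mp : p.rm < p.rp) (h_pc : p.rp < rc)
    (hr0 : p.r0 ∈ Ioo p.rm p.rp) : Subextremal p := by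
  have e1 : ∀ x y, x ≠ y → Δr p x = 0 → Δr p y = 0 →
      -(p.Λ / 3) * (x ^ 3 + x ^ 2 * y + x * y ^ 2 + y ^ 3) + (1 - p.Λ / 3 * p.a ^ 2) * (x + y)
        - 2 * p.M = 0 := by
    intro x y hxy hx hy
    refine mul_left_cancel₀ (sub_ne_zero.2 hxy) ?_
    unfold Δr at hx hy
    linear_combination hx - hy
  have a1 := e1 _ _ h_mp.ne hrm hrp
  have a2 := e1 _ _ (h_mp.trans h_pc).ne hrm hrc
  have a3 := e1 _ _ (h_n.trans h_m).ne' hrm hrn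
  have e2 : ∀ y w, y ≠ w →
      -(p.Λ / 3) * (p.rm ^ 3 + p.rm ^ 2 * y + p.rm * y ^ 2 + y ^ 3)
        + (1 - p.Λ / 3 * p.a ^ 2) * (p.rm + y) - 2 * p.M = 0 →
      -(p.Λ / 3) * (p.rm ^ 3 + p.rm ^ 2 * w + p.rm * w ^ 2 + w ^ 3)
        + (1 - p.Λ / 3 * p.a ^ 2) * (p.rm + w) - 2 * p.M = 0 →
      -(p.Λ / 3) * (p.rm ^ 2 + y ^ 2 + w ^ 2 + p.rm * y + p.rm * w + y * w)
        + (1 - p.Λ / 3 * p.a ^ 2) = 0 := by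
    intro y w hyw hy hw
    refine mul_left_cancel₀ (sub_ne_zero.2 hyw) ?_
    linear_combination hy - hw
  have b1 := e2 _ _ h_pc.ne a1 a2
  have b2 := e2 _ _ (h_n.trans (h_m.trans h_mp)).ne' a1 a3
  have c1 : rn = -(p.rm + p.rp + rc) := by
    have h : (p.Λ / 3 * (rc - rn)) * (rn + (p.rm + p.rp + rc)) = 0 := by
      linear_combination b2 - b1
    have h' : p.Λ / 3 * (rc - rn) ≠ 0 := by
      have : 0 < rc - rn := by linarith
      positivity
    have := (mul_eq_zero.1 h).resolve_left h'
    linarith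
  have hfac : ∀ r, Δr p r = -(p.Λ / 3) * (r - rn) * (r - p.rm) * (r - p.rp) * (r - rc) := by
    intro r
    have h1 : p.a ^ 2 + p.e ^ 2 = Δr p p.rm - ((1 - p.Λ / 3 * p.a ^ 2) * p.rm ^ 2
      - p.Λ / 3 * p.rm ^ 4 - 2 * p.M * p.rm) := by unfold Δr; ring
    have h2 : Δr p r = (1 - p.Λ / 3 * p.a ^ 2) * r ^ 2
      - p.Λ / 3 * r ^ 4 - 2 * p.M * r + (p.a ^ 2 + p.e ^ 2) := by unfold Δr; ring
    rw [h2, h1, hrm, c1]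
    have h3 : 2 * p.M = -(p.Λ / 3) * (p.rm ^ 3 + p.rm ^ 2 * p.rp + p.rm * p.rp ^ 2 + p.rp ^ 3)
      + (1 - p.Λ / 3 * p.a ^ 2) * (p.rm + p.rp) := by linarith
    have h4 : 1 - p.Λ / 3 * p.a ^ 2 = (p.Λ / 3) * (p.rm ^ 2 + p.rp ^ 2 + rc ^ 2 + p.rm * p.rp
      + p.rm * rc + p.rp * rc) := by linarith
    rw [h3, h4]; ring
  have hpos : ∀ r ∈ Ioo p.rm p.rp, 0 < p.Λ / 3 * (r - rn) * (rc - r) ∧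
      p.Λ / 3 * (r - rn) * (rc - r) ≤ p.Λ / 3 * (p.rp - rn) * rc := by
    intro r hr
    have h1 : 0 < r - rn := by linarith [hr.1]
    have h2 : 0 < rc - r := by linarith [hr.2]
    refine ⟨by positivity, ?_⟩
    have h3 : r - rn ≤ p.rp - rn := by linarith [hr.2]
    have h4 : rc - r ≤ rc := by linarith [hr.1]
    gcongr
    exact mul_nonneg (by positivity) (by linarith)
  refine ⟨hΛ, ha, h_m, h_mp, hr0, ?_, hrm, hrp, ?_, ?_⟩
  · intro r hr
    have := (hpos r hr).1
    have h1 : 0 < (r - p.rm) * (p.rp - r) := mul_pos (sub_pos.2 hr.1) (sub_pos.2 hr.2)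
    have := mul_pos this h1
    rw [hfac]; linarith
  -- By `b1`, `Λ/3` times the sum of `a²` and all monomials of degree two in `rm`, `rp`, `rc` equals
  -- `1`; one of these summands is `rp²` and the others are positive or nonnegative.
  · have hrc' : 0 < rc := by linarith
    have h1 : 0 < p.rp := by linarith
    have h2 : 0 < p.rm ^ 2 + rc ^ 2 + p.rm * p.rp + p.rm * rc + p.rp * rc + p.a ^ 2 := by
      positivity
    have := mul_pos (by positivity : 0 < p.Λ / 3) h2
    linarith
  · have hC : 0 < p.Λ / 3 * (p.rp - rn) * rc := by
      have h1 : 0 < p.rp - rn := by linarith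
      have h2 : 0 < rc := by linarith
      positivity
    have hl : 0 < p.rp - p.rm := by linarith
    refine ⟨p.Λ / 3 * (p.rp - rn) * rc * (p.rp - p.rm), by positivity, fun r hr => ?_⟩
    obtain ⟨h1, h2⟩ := hpos r hr
    have h3 : 0 < r - p.rm := sub_pos.2 hr.1
    have h4 : 0 < p.rp - r := sub_pos.2 hr.2
    have h5 : -Δr p r = (p.Λ / 3 * (r - rn) * (rc - r)) * ((r - p.rm) * (p.rp - r)) := by
      rw [hfac]; ring
    rw [h5]
    constructor
    · calc _ ≤ p.Λ / 3 * (p.rp - rn) * rc * ((p.rp - p.rm) * (p.rp - r)) := by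
            gcongr; linarith
        _ = _ := by ring
    · calc _ ≤ p.Λ / 3 * (p.rp - rn) * rc * ((r - p.rm) * (p.rp - p.rm)) := by
            gcongr; linarith
        _ = _ := by ring

/-! ### Auxiliary functions of the radius, of `τ = θ⋆` and of `ζ = tan θ / tan τ` -/

variable (p : Params)

/-- The coefficient `Λ a² / 3`. -/
def ell : ℝ := p.Λ / 3 * p.a ^ 2

/-- `r² + a²`. -/
def nn (r : ℝ) : ℝ := r ^ 2 + p.a ^ 2

/-- The square of `Q(r, sin² τ)`. -/
def qq (r τ : ℝ) : ℝ := nn p r ^ 2 - p.a ^ 2 * Real.sin τ ^ 2 * Δr p r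

/-- `cos² τ + ζ² sin² τ`. -/
def dd (ζ τ : ℝ) : ℝ := Real.cos τ ^ 2 + ζ ^ 2 * Real.sin τ ^ 2

/-- `√(Ξ - ζ²)`. -/
def sk (ζ : ℝ) : ℝ := Real.sqrt (Ξ p - ζ ^ 2)

theorem Xi_eq : Ξ p = 1 + ell p := rfl

theorem Q_eq (r τ : ℝ) : Q p r (Real.sin τ ^ 2) = Real.sqrt (qq p r τ) := rfl

variable {p}

theorem Subextremal.ell_pos (hp : Subextremal p) : 0 < ell p := by
  have := hp.Λ_pos
  have := hp.a_ne
  unfold ell; positivity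

theorem Subextremal.abs_a_pos (hp : Subextremal p) : 0 < |p.a| := abs_pos.2 hp.a_ne

theorem Subextremal.Xi_gt (hp : Subextremal p) : 1 < Ξ p := by
  rw [Xi_eq]; linarith [hp.ell_pos]

theorem Subextremal.nn_pos (hp : Subextremal p) (r : ℝ) : 0 < nn p r := by
  have := hp.a_ne
  unfold nn; positivity

theorem Subextremal.nonpos (hp : Subextremal p) {r : ℝ} (hr : r ∈ Icc p.rm p.rp) :
    Δr p r ≤ 0 := by
  rcases eq_or_lt_of_le hr.1 with h | h
  · rw [← h, hp.zero_m]
  · rcases eq_or_lt_of_le hr.2 with h' | h'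
    · rw [h', hp.zero_p]
    · exact (hp.neg r ⟨h, h'⟩).le

theorem Subextremal.nn_sq_le_qq (hp : Subextremal p) {r : ℝ} (hr : r ∈ Icc p.rm p.rp) (τ : ℝ) :
    nn p r ^ 2 ≤ qq p r τ := by
  have h := hp.nonpos hr
  have : 0 ≤ p.a ^ 2 * Real.sin τ ^ 2 * (-Δr p r) := by
    have : 0 ≤ -Δr p r := by linarith
    positivity
  unfold qq; linarith

theorem Subextremal.qq_pos (hp : Subextremal p) {r : ℝ} (hr : r ∈ Icc p.rm p.rp) (τ : ℝ) :
    0 < qq p r τ :=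
  lt_of_lt_of_le (pow_pos (hp.nn_pos r) 2) (hp.nn_sq_le_qq hr τ)

theorem dd_pos {ζ : ℝ} (hζ : 0 < ζ) (τ : ℝ) : 0 < dd ζ τ := by
  unfold dd
  rcases eq_or_ne (Real.sin τ) 0 with h | h
  · have : Real.cos τ ^ 2 = 1 := by have := Real.sin_sq_add_cos_sq τ; rw [h] at this; linarith
    rw [this]; positivity
  · positivity

theorem dd_eq (ζ τ : ℝ) : dd ζ τ = 1 - (1 - ζ ^ 2) * Real.sin τ ^ 2 := by
  unfold dd; rw [Real.cos_sq']; ring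

theorem dd_le_one {ζ : ℝ} (h0 : 0 ≤ ζ) (h1 : ζ ≤ 1) (τ : ℝ) : dd ζ τ ≤ 1 := by
  rw [dd_eq]
  have : ζ ^ 2 ≤ 1 := pow_le_one₀ h0 h1
  nlinarith [sq_nonneg (Real.sin τ)]

theorem sq_le_dd {ζ : ℝ} (h0 : 0 ≤ ζ) (h1 : ζ ≤ 1) (τ : ℝ) : ζ ^ 2 ≤ dd ζ τ := by
  unfold dd
  have : ζ ^ 2 ≤ 1 := pow_le_one₀ h0 h1
  nlinarith [sq_nonneg (Real.cos τ), Real.sin_sq_add_cos_sq τ]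

theorem continuous_Δr (p : Params) : Continuous (Δr p) := by unfold Δr; fun_prop

theorem continuous_nn (p : Params) : Continuous (nn p) := by unfold nn; fun_prop

theorem continuous_qq (p : Params) : Continuous fun q : ℝ × ℝ => qq p q.1 q.2 := by
  have h1 : Continuous fun q : ℝ × ℝ => Δr p q.1 := (continuous_Δr p).comp continuous_fst
  have h2 : Continuous fun q : ℝ × ℝ => nn p q.1 := (continuous_nn p).comp continuous_fst
  unfold qq; fun_prop

theorem continuous_dd : Continuous fun q : ℝ × ℝ => dd q.1 q.2 := by unfold dd; fun_prop

theorem continuous_sk (p : Params) : Continuous (sk p) := by unfold sk; fun_prop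

theorem hasDerivAt_dd (ζ τ : ℝ) :
    HasDerivAt (fun τ => dd ζ τ) (-2 * Real.sin τ * Real.cos τ * (1 - ζ ^ 2)) τ := by
  unfold dd
  refine (((Real.hasDerivAt_cos τ).pow 2).add
    (((Real.hasDerivAt_sin τ).pow 2).const_mul (ζ ^ 2))).congr_deriv ?_
  simp only [Nat.cast_ofNat, Nat.add_one_sub_one, pow_one]; ring

theorem hasDerivAt_qq (p : Params) (r τ : ℝ) :
    HasDerivAt (fun τ => qq p r τ) (-2 * Real.sin τ * Real.cos τ * (p.a ^ 2 * Δr p r)) τ := by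
  unfold qq
  refine (((((Real.hasDerivAt_sin τ).pow 2).const_mul (p.a ^ 2)).mul_const (Δr p r)).const_sub
    (nn p r ^ 2)).congr_deriv ?_
  simp only [Nat.cast_ofNat, Nat.add_one_sub_one, pow_one]; ring

/-- Derivative of `x ^ (-1/2)` along a function, with the power written with square roots. -/
theorem hasDerivAt_inv_sqrt {φ : ℝ → ℝ} {φ' x : ℝ} (h : HasDerivAt φ φ' x) (hx : 0 < φ x) :
    HasDerivAt (fun x => 1 / Real.sqrt (φ x)) (-(φ' / 2) / (φ x * Real.sqrt (φ x))) x := by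
  have hs : Real.sqrt (φ x) ≠ 0 := (Real.sqrt_pos.2 hx).ne'
  have h2 : Real.sqrt (φ x) ^ 2 = φ x := Real.sq_sqrt hx.le
  refine ((hasDerivAt_const x (1 : ℝ)).div (h.sqrt hx.ne') hs).congr_deriv ?_
  rw [h2]; field_simp; ring

/-- Derivative of `x ^ (-3/2)` along a function, with the power written with square roots. -/
theorem hasDerivAt_inv_mul_sqrt {φ : ℝ → ℝ} {φ' x : ℝ} (h : HasDerivAt φ φ' x) (hx : 0 < φ x) :
    HasDerivAt (fun x => 1 / (φ x * Real.sqrt (φ x)))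
      (-(3 * φ' / 2) / (φ x ^ 2 * Real.sqrt (φ x))) x := by
  have hs : Real.sqrt (φ x) ≠ 0 := (Real.sqrt_pos.2 hx).ne'
  have h2 : Real.sqrt (φ x) ^ 2 = φ x := Real.sq_sqrt hx.le
  refine ((hasDerivAt_const x (1 : ℝ)).div (h.mul (h.sqrt hx.ne'))
    (mul_ne_zero hx.ne' hs)).congr_deriv ?_
  simp only [Pi.mul_apply]
  rw [mul_pow, h2]; field_simp; rw [h2]; field_simp; ring

end

end KNdS

namespace KNdS

open Filter Topology MeasureTheory

noncomputable section

variable (p : Params)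

/-! ### The elliptic integrals -/

/-- Differentiating in `τ` brings out a factor `sin τ cos τ`, which is split off together with the
numerical constants; the subscript counts the derivatives. Two derivatives are needed: `θ` depends
on `ellA`, its derivative `kk` on `ellA₁`, and the metric contains `kk`, whose own derivative
involves `ellA₂`. The same holds for `gT` and `ellT`. -/
def gA (ζ τ : ℝ) : ℝ := -(1 / (|p.a| * sk p ζ)) * (1 / Real.sqrt (dd ζ τ))

def gA₁ (ζ τ : ℝ) : ℝ := -((1 - ζ ^ 2) / (|p.a| * sk p ζ)) * (1 / (dd ζ τ * Real.sqrt (dd ζ τ)))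

def gA₂ (ζ τ : ℝ) : ℝ :=
  -((1 - ζ ^ 2) ^ 2 / (|p.a| * sk p ζ)) * (1 / (dd ζ τ ^ 2 * Real.sqrt (dd ζ τ)))

def gT (r τ : ℝ) : ℝ := -(1 / Real.sqrt (qq p r τ))

def gT₁ (r τ : ℝ) : ℝ := p.a ^ 2 * Δr p r * (1 / (qq p r τ * Real.sqrt (qq p r τ)))

def gT₂ (r τ : ℝ) : ℝ := (p.a ^ 2 * Δr p r) ^ 2 * (1 / (qq p r τ ^ 2 * Real.sqrt (qq p r τ)))

/-- The angular elliptic integral `∫_θ^τ dθ' / P(θ', sin² τ)`, as a function of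
`z = tan θ / tan τ`. -/
def ellA (z τ : ℝ) : ℝ := ∫ ζ in (1 : ℝ)..z, gA p ζ τ

def ellA₁ (z τ : ℝ) : ℝ := ∫ ζ in (1 : ℝ)..z, gA₁ p ζ τ

def ellA₂ (z τ : ℝ) : ℝ := ∫ ζ in (1 : ℝ)..z, gA₂ p ζ τ

/-- The radial elliptic integral `∫_r^{rp} dr' / Q(r', sin² τ)`. -/
def ellT (r τ : ℝ) : ℝ := ∫ s in p.rp..r, gT p s τ

def ellT₁ (r τ : ℝ) : ℝ := ∫ s in p.rp..r, gT₁ p s τ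

def ellT₂ (r τ : ℝ) : ℝ := ∫ s in p.rp..r, gT₂ p s τ

/-- The domain of the variable `z = tan θ / tan τ`. -/
def ZI : Set ℝ := Ioo 0 (Real.sqrt (Ξ p))

variable {p}

theorem Subextremal.one_mem_ZI (hp : Subextremal p) : (1 : ℝ) ∈ ZI p :=
  ⟨one_pos, by rw [Real.lt_sqrt zero_le_one]; simpa using hp.Xi_gt⟩

theorem sk_sq_pos {ζ : ℝ} (hζ : ζ ∈ ZI p) : 0 < Ξ p - ζ ^ 2 := by
  have := (Real.lt_sqrt hζ.1.le).1 hζ.2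
  linarith

theorem sk_pos {ζ : ℝ} (hζ : ζ ∈ ZI p) : 0 < sk p ζ := Real.sqrt_pos.2 (sk_sq_pos hζ)

theorem Subextremal.uIcc_subset_ZI (hp : Subextremal p) {z : ℝ} (hz : z ∈ ZI p) :
    uIcc 1 z ⊆ ZI p := (ordConnected_Ioo).uIcc_subset hp.one_mem_ZI hz

theorem Subextremal.uIcc_subset_Icc (hp : Subextremal p) {r : ℝ} (hr : r ∈ Icc p.rm p.rp) :
    uIcc p.rp r ⊆ Icc p.rm p.rp :=
  (ordConnected_Icc).uIcc_subset (right_mem_Icc.2 hp.rm_lt.le) hr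

/-- The domain of the integrands of `ellA`. -/
def UA (p : Params) : Set (ℝ × ℝ) := ZI p ×ˢ univ

/-- The domain of the integrands of `ellT`. -/
def UT (p : Params) : Set (ℝ × ℝ) := {q | 0 < qq p q.1 q.2}

theorem isOpen_UA (p : Params) : IsOpen (UA p) := isOpen_Ioo.prod isOpen_univ

theorem isOpen_UT (p : Params) : IsOpen (UT p) := isOpen_lt continuous_const (continuous_qq p)

theorem Subextremal.continuousOn_skinv (hp : Subextremal p) {n : ℝ → ℝ} (hn : Continuous n) :
    ContinuousOn (fun q : ℝ × ℝ => -(n q.1 / (|p.a| * sk p q.1))) (UA p) := by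
  have h1 : Continuous fun q : ℝ × ℝ => sk p q.1 := (continuous_sk p).comp continuous_fst
  refine ContinuousOn.neg (ContinuousOn.div (by fun_prop) (h1.const_mul _).continuousOn
    fun q hq => ?_)
  exact mul_ne_zero hp.abs_a_pos.ne' (sk_pos hq.1).ne'

theorem continuousOn_ddinv (p : Params) (k : ℕ) :
    ContinuousOn (fun q : ℝ × ℝ => 1 / (dd q.1 q.2 ^ k * Real.sqrt (dd q.1 q.2))) (UA p) := by
  have h1 := continuous_dd
  refine ContinuousOn.div (by fun_prop) (by fun_prop) fun q hq => ?_
  have := dd_pos hq.1.1 q.2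
  positivity

theorem continuousOn_qqinv (p : Params) (k : ℕ) :
    ContinuousOn (fun q : ℝ × ℝ => 1 / (qq p q.1 q.2 ^ k * Real.sqrt (qq p q.1 q.2))) (UT p) := by
  have h1 := continuous_qq p
  refine ContinuousOn.div (by fun_prop) (by fun_prop) fun q (hq : 0 < qq p q.1 q.2) => ?_
  positivity

theorem Subextremal.continuousOn_gA (hp : Subextremal p) :
    ContinuousOn (fun q : ℝ × ℝ => gA p q.1 q.2) (UA p) := by
  refine ContinuousOn.congr ((hp.continuousOn_skinv (n := fun _ => 1) (by fun_prop)).mul (continuousOn_ddinv p 0))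
    fun q _ => ?_
  simp [gA]

theorem Subextremal.continuousOn_gA₁ (hp : Subextremal p) :
    ContinuousOn (fun q : ℝ × ℝ => gA₁ p q.1 q.2) (UA p) := by
  refine ContinuousOn.congr ((hp.continuousOn_skinv (n := fun ζ => 1 - ζ ^ 2) (by fun_prop)).mul
    (continuousOn_ddinv p 1)) fun q _ => ?_
  simp [gA₁]

theorem Subextremal.continuousOn_gA₂ (hp : Subextremal p) :
    ContinuousOn (fun q : ℝ × ℝ => gA₂ p q.1 q.2) (UA p) := by
  refine ContinuousOn.congr ((hp.continuousOn_skinv (n := fun ζ => (1 - ζ ^ 2) ^ 2) (by fun_prop)).mul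
    (continuousOn_ddinv p 2)) fun q _ => ?_
  simp [gA₂]

theorem continuousOn_gT (p : Params) : ContinuousOn (fun q : ℝ × ℝ => gT p q.1 q.2) (UT p) := by
  refine ContinuousOn.congr ((continuousOn_qqinv p 0).neg) fun q _ => ?_
  simp [gT]

theorem continuousOn_gT₁ (p : Params) : ContinuousOn (fun q : ℝ × ℝ => gT₁ p q.1 q.2) (UT p) := by
  have h1 : Continuous fun q : ℝ × ℝ => Δr p q.1 := (continuous_Δr p).comp continuous_fst
  refine ContinuousOn.congr (((h1.const_mul (p.a ^ 2)).continuousOn).mul (continuousOn_qqinv p 1))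
    fun q _ => ?_
  simp [gT₁]

theorem continuousOn_gT₂ (p : Params) : ContinuousOn (fun q : ℝ × ℝ => gT₂ p q.1 q.2) (UT p) := by
  have h1 : Continuous fun q : ℝ × ℝ => Δr p q.1 := (continuous_Δr p).comp continuous_fst
  refine ContinuousOn.congr ((((h1.const_mul (p.a ^ 2)).pow 2).continuousOn).mul (continuousOn_qqinv p 2))
    fun q _ => ?_
  simp [gT₂]

theorem hasDerivAt_gA {ζ : ℝ} (hζ : ζ ∈ ZI p) (τ : ℝ) :
    HasDerivAt (fun τ => gA p ζ τ) (Real.sin τ * Real.cos τ * gA₁ p ζ τ) τ := by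
  refine ((hasDerivAt_inv_sqrt (hasDerivAt_dd ζ τ) (dd_pos hζ.1 τ)).const_mul
    (-(1 / (|p.a| * sk p ζ)))).congr_deriv ?_
  unfold gA₁; ring

theorem hasDerivAt_gA₁ {ζ : ℝ} (hζ : ζ ∈ ZI p) (τ : ℝ) :
    HasDerivAt (fun τ => gA₁ p ζ τ) (3 * Real.sin τ * Real.cos τ * gA₂ p ζ τ) τ := by
  refine ((hasDerivAt_inv_mul_sqrt (hasDerivAt_dd ζ τ) (dd_pos hζ.1 τ)).const_mul
    (-((1 - ζ ^ 2) / (|p.a| * sk p ζ)))).congr_deriv ?_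
  unfold gA₂; ring

theorem hasDerivAt_gT {r τ : ℝ} (h : 0 < qq p r τ) :
    HasDerivAt (fun τ => gT p r τ) (-(Real.sin τ * Real.cos τ) * gT₁ p r τ) τ := by
  refine (hasDerivAt_inv_sqrt (hasDerivAt_qq p r τ) h).neg.congr_deriv ?_
  unfold gT₁; ring

theorem hasDerivAt_gT₁ {r τ : ℝ} (h : 0 < qq p r τ) :
    HasDerivAt (fun τ => gT₁ p r τ) (3 * Real.sin τ * Real.cos τ * gT₂ p r τ) τ := by
  refine ((hasDerivAt_inv_mul_sqrt (hasDerivAt_qq p r τ) h).const_mul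
    (p.a ^ 2 * Δr p r)).congr_deriv ?_
  unfold gT₂; ring

theorem Subextremal.grad_ellA (hp : Subextremal p) {z : ℝ} (hz : z ∈ ZI p) (τ : ℝ) :
    HasGrad (fun q => ellA p q.1 q.2) (gA p z τ) (Real.sin τ * Real.cos τ * ellA₁ p z τ)
      (z, τ) := by
  refine (hasGrad_integral_param (g' := fun ζ τ => Real.sin τ * Real.cos τ * gA₁ p ζ τ)
    (isOpen_UA p) hp.continuousOn_gA (ContinuousOn.mul (by fun_prop) hp.continuousOn_gA₁)
    (fun s t h => hasDerivAt_gA h.1 t)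
    (fun s hs => ⟨hp.uIcc_subset_ZI hz hs, mem_univ _⟩)).congr rfl ?_
  rw [intervalIntegral.integral_const_mul]; rfl

theorem Subextremal.grad_ellA₁ (hp : Subextremal p) {z : ℝ} (hz : z ∈ ZI p) (τ : ℝ) :
    HasGrad (fun q => ellA₁ p q.1 q.2) (gA₁ p z τ) (3 * Real.sin τ * Real.cos τ * ellA₂ p z τ)
      (z, τ) := by
  refine (hasGrad_integral_param (g' := fun ζ τ => 3 * Real.sin τ * Real.cos τ * gA₂ p ζ τ)
    (isOpen_UA p) hp.continuousOn_gA₁ (ContinuousOn.mul (by fun_prop) hp.continuousOn_gA₂)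
    (fun s t h => hasDerivAt_gA₁ h.1 t)
    (fun s hs => ⟨hp.uIcc_subset_ZI hz hs, mem_univ _⟩)).congr rfl ?_
  rw [intervalIntegral.integral_const_mul]; rfl

theorem Subextremal.grad_ellT (hp : Subextremal p) {r : ℝ} (hr : r ∈ Icc p.rm p.rp) (τ : ℝ) :
    HasGrad (fun q => ellT p q.1 q.2) (gT p r τ) (-(Real.sin τ * Real.cos τ) * ellT₁ p r τ)
      (r, τ) := by
  refine (hasGrad_integral_param (g' := fun s τ => -(Real.sin τ * Real.cos τ) * gT₁ p s τ)
    (isOpen_UT p) (continuousOn_gT p) (ContinuousOn.mul (by fun_prop) (continuousOn_gT₁ p))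
    (fun s t h => hasDerivAt_gT h)
    (fun s hs => hp.qq_pos (hp.uIcc_subset_Icc hr hs) τ)).congr rfl ?_
  rw [intervalIntegral.integral_const_mul]; rfl

theorem Subextremal.grad_ellT₁ (hp : Subextremal p) {r : ℝ} (hr : r ∈ Icc p.rm p.rp) (τ : ℝ) :
    HasGrad (fun q => ellT₁ p q.1 q.2) (gT₁ p r τ) (3 * Real.sin τ * Real.cos τ * ellT₂ p r τ)
      (r, τ) := by
  refine (hasGrad_integral_param (g' := fun s τ => 3 * Real.sin τ * Real.cos τ * gT₂ p s τ)
    (isOpen_UT p) (continuousOn_gT₁ p) (ContinuousOn.mul (by fun_prop) (continuousOn_gT₂ p))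
    (fun s t h => hasDerivAt_gT₁ h)
    (fun s hs => hp.qq_pos (hp.uIcc_subset_Icc hr hs) τ)).congr rfl ?_
  rw [intervalIntegral.integral_const_mul]; rfl

theorem Subextremal.continuousAt_ellA₂ (hp : Subextremal p) {z : ℝ} (hz : z ∈ ZI p) (τ : ℝ) :
    ContinuousAt (fun q : ℝ × ℝ => ellA₂ p q.1 q.2) (z, τ) :=
  continuousAt_integral_param (isOpen_UA p) hp.continuousOn_gA₂
    (fun _ hs => ⟨hp.uIcc_subset_ZI hz hs, mem_univ _⟩)

theorem Subextremal.continuousAt_ellT₂ (hp : Subextremal p) {r : ℝ} (hr : r ∈ Icc p.rm p.rp)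
    (τ : ℝ) : ContinuousAt (fun q : ℝ × ℝ => ellT₂ p q.1 q.2) (r, τ) :=
  continuousAt_integral_param (isOpen_UT p) (continuousOn_gT₂ p)
    (fun _ hs => hp.qq_pos (hp.uIcc_subset_Icc hr hs) τ)

theorem Subextremal.gA_neg (hp : Subextremal p) {ζ : ℝ} (hζ : ζ ∈ ZI p) (τ : ℝ) :
    gA p ζ τ < 0 := by
  have h1 := hp.abs_a_pos
  have h2 := sk_pos hζ
  have h3 := dd_pos hζ.1 τ
  unfold gA
  have : 0 < 1 / (|p.a| * sk p ζ) * (1 / Real.sqrt (dd ζ τ)) := by positivity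
  linarith

theorem Subextremal.strictAntiOn_ellA (hp : Subextremal p) (τ : ℝ) :
    StrictAntiOn (fun z => ellA p z τ) (ZI p) := by
  have hd : ∀ z ∈ ZI p, HasDerivAt (fun z => ellA p z τ) (gA p z τ) z :=
    fun z hz => (hp.grad_ellA hz τ).hasDerivAt_fst
  refine strictAntiOn_of_deriv_neg (convex_Ioo _ _)
    (fun z hz => (hd z hz).continuousAt.continuousWithinAt) fun z hz => ?_
  have hz' : z ∈ ZI p := interior_subset hz
  rw [(hd z hz').deriv]
  exact hp.gA_neg hz' τ

/-! ### Solving `ellA z τ = ellT r τ` for `z` -/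

/-- A positive lower bound of `z`. -/
def zmin (p : Params) : ℝ := Real.sqrt (Ξ p) * p.rm / Real.sqrt (nn p p.rm)

theorem Subextremal.zmin_pos (hp : Subextremal p) : 0 < zmin p := by
  have := hp.Xi_gt
  have := hp.rm_pos
  have := hp.nn_pos p.rm
  have : 0 < Ξ p := by linarith
  unfold zmin; positivity

theorem Subextremal.zmin_sq (hp : Subextremal p) : zmin p ^ 2 = Ξ p * p.rm ^ 2 / nn p p.rm := by
  unfold zmin
  rw [div_pow, mul_pow, Real.sq_sqrt (by linarith [hp.Xi_gt]), Real.sq_sqrt (hp.nn_pos _).le]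

/-- The inequality `Ξ rm² < rm² + a²` amounts to `(Λ/3) rm² < 1`, which follows from `rm < rp` and
`(Λ/3) rp² < 1`. -/
theorem Subextremal.zmin_lt_one (hp : Subextremal p) : zmin p < 1 := by
  have h1 := hp.nn_pos p.rm
  have h : zmin p ^ 2 < 1 := by
    rw [hp.zmin_sq, div_lt_one h1, Xi_eq]
    unfold ell nn
    have ha : 0 < p.a ^ 2 := by have := hp.a_ne; positivity
    have h2 : p.rm ^ 2 ≤ p.rp ^ 2 := by
      have := hp.rm_pos; have := hp.rm_lt; gcongr
    have h3 : p.Λ / 3 * p.rm ^ 2 ≤ p.Λ / 3 * p.rp ^ 2 := by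
      have := hp.Λ_pos; gcongr
    nlinarith [hp.rp_lt]
  nlinarith [hp.zmin_pos]

theorem Subextremal.mem_ZI (hp : Subextremal p) {z : ℝ} (h0 : 0 < z) (h1 : z ≤ 1) : z ∈ ZI p :=
  ⟨h0, lt_of_le_of_lt h1 hp.one_mem_ZI.2⟩

theorem Subextremal.Icc_subset_ZI (hp : Subextremal p) : Icc (zmin p) 1 ⊆ ZI p :=
  fun _ hz => hp.mem_ZI (lt_of_lt_of_le hp.zmin_pos hz.1) hz.2

theorem hasDerivAt_arctan_sk {ζ : ℝ} (hζ : ζ ∈ ZI p) :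
    HasDerivAt (fun ζ => Real.arctan (ζ / sk p ζ)) (1 / sk p ζ) ζ := by
  have h1 := sk_pos hζ
  have h2 : sk p ζ ^ 2 = Ξ p - ζ ^ 2 := Real.sq_sqrt (sk_sq_pos hζ).le
  have h3 : HasDerivAt (sk p) (-ζ / sk p ζ) ζ := by
    refine ((((hasDerivAt_id ζ).pow 2).const_sub (Ξ p)).sqrt (sk_sq_pos hζ).ne').congr_deriv ?_
    simp only [id, Nat.cast_ofNat, Nat.add_one_sub_one, pow_one, mul_one]
    change -(2 * ζ) / (2 * sk p ζ) = _
    field_simp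
  refine (((hasDerivAt_id ζ).div h3 h1.ne').arctan).congr_deriv ?_
  have h4 : 0 < Ξ p := by have := sk_sq_pos hζ; nlinarith [sq_nonneg ζ]
  have h5 : 1 + (ζ / sk p ζ) ^ 2 = Ξ p / sk p ζ ^ 2 := by
    field_simp; rw [h2]; ring
  simp only [id, Pi.div_apply]
  rw [h5]
  field_simp
  rw [h2]; ring

theorem ellT_nonneg {r : ℝ} (hr : r ∈ Icc p.rm p.rp) (τ : ℝ) :
    0 ≤ ellT p r τ := by
  unfold ellT
  rw [intervalIntegral.integral_symm, ← intervalIntegral.integral_neg]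
  refine intervalIntegral.integral_nonneg hr.2 fun s hs => ?_
  unfold gT
  have := Real.sqrt_nonneg (qq p s τ)
  have : 0 ≤ 1 / Real.sqrt (qq p s τ) := by positivity
  linarith

/-- Between the horizons `Δr ≤ 0`, hence `Q ≥ r² + a²`, and the integral of `1 / (r² + a²)` is an
arctangent. -/
theorem Subextremal.ellT_le (hp : Subextremal p) {r : ℝ} (hr : r ∈ Icc p.rm p.rp) (τ : ℝ) :
    ellT p r τ ≤ 1 / |p.a| * (Real.arctan (p.rp / |p.a|) - Real.arctan (p.rm / |p.a|)) := by
  have ha := hp.abs_a_pos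
  have hd : ∀ s : ℝ, HasDerivAt (fun s => 1 / |p.a| * Real.arctan (s / |p.a|)) (1 / nn p s) s := by
    intro s
    refine ((((hasDerivAt_id s).div_const |p.a|).arctan).const_mul (1 / |p.a|)).congr_deriv ?_
    have h2 : |p.a| ^ 2 = p.a ^ 2 := sq_abs _
    have h3 := hp.nn_pos s
    have h4 : 1 + (s / |p.a|) ^ 2 = nn p s / |p.a| ^ 2 := by
      unfold nn; field_simp; rw [h2]; ring
    simp only [id]
    rw [h4]
    field_simp
  have hint : ∀ x y : ℝ, ∫ s in x..y, 1 / nn p s =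
      1 / |p.a| * Real.arctan (y / |p.a|) - 1 / |p.a| * Real.arctan (x / |p.a|) := by
    intro x y
    refine intervalIntegral.integral_eq_sub_of_hasDerivAt (fun s _ => hd s) ?_
    refine Continuous.intervalIntegrable ?_ _ _
    exact continuous_const.div (continuous_nn p) fun s => (hp.nn_pos s).ne'
  have h1 : ellT p r τ ≤ ∫ s in r..p.rp, 1 / nn p s := by
    unfold ellT
    rw [intervalIntegral.integral_symm, ← intervalIntegral.integral_neg]
    have hsub : uIcc r p.rp ⊆ Icc p.rm p.rp := by
      rw [uIcc_comm]; exact hp.uIcc_subset_Icc hr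
    refine intervalIntegral.integral_mono_on hr.2 ?_ ?_ fun s hs => ?_
    · refine ContinuousOn.intervalIntegrable (ContinuousOn.neg ?_)
      exact (continuousOn_gT p).comp (f := fun s => (s, τ)) (by fun_prop)
        fun s hs => hp.qq_pos (hsub hs) τ
    · refine Continuous.intervalIntegrable ?_ _ _
      exact continuous_const.div (continuous_nn p) fun s => (hp.nn_pos s).ne'
    · unfold gT
      rw [neg_neg]
      refine one_div_le_one_div_of_le (hp.nn_pos s) (Real.le_sqrt_of_sq_le ?_)
      exact hp.nn_sq_le_qq ⟨hr.1.trans hs.1, hs.2⟩ τ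
  rw [hint] at h1
  have h2 : Real.arctan (p.rm / |p.a|) ≤ Real.arctan (r / |p.a|) :=
    Real.arctan_strictMono.monotone (by have := hr.1; gcongr)
  have h3 := mul_le_mul_of_nonneg_left h2 (by positivity : 0 ≤ 1 / |p.a|)
  linarith

/-- For `ζ ≤ 1` one has `dd ≤ 1`, so the integrand is at least `1 / (|a| √(Ξ - ζ²))`, again with an
arctangent as primitive. The constant on the left is the bound of `ellT_le`. -/
theorem Subextremal.le_ellA_zmin (hp : Subextremal p) (τ : ℝ) :
    1 / |p.a| * (Real.arctan (p.rp / |p.a|) - Real.arctan (p.rm / |p.a|)) ≤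
      ellA p (zmin p) τ := by
  have ha := hp.abs_a_pos
  have hsub := hp.Icc_subset_ZI
  have hl : zmin p ≤ 1 := hp.zmin_lt_one.le
  have hci : ContinuousOn (fun ζ => 1 / sk p ζ) (uIcc (zmin p) 1) := by
    rw [uIcc_of_le hl]
    exact continuousOn_const.div (continuous_sk p).continuousOn fun ζ hζ => (sk_pos (hsub hζ)).ne'
  have hint : ∫ ζ in zmin p..1, 1 / sk p ζ =
      Real.arctan (1 / sk p 1) - Real.arctan (zmin p / sk p (zmin p)) := by
    refine intervalIntegral.integral_eq_sub_of_hasDerivAt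
      (f := fun ζ => Real.arctan (ζ / sk p ζ)) (fun s hs => ?_) hci.intervalIntegrable
    rw [uIcc_of_le hl] at hs
    exact hasDerivAt_arctan_sk (hsub hs)
  have h1 : 1 / |p.a| * (∫ ζ in zmin p..1, 1 / sk p ζ) ≤ ellA p (zmin p) τ := by
    unfold ellA
    rw [intervalIntegral.integral_symm (zmin p) 1, ← intervalIntegral.integral_neg,
      ← intervalIntegral.integral_const_mul]
    refine intervalIntegral.integral_mono_on hl ?_ ?_ fun s hs => ?_
    · exact (hci.intervalIntegrable).const_mul _
    · refine ContinuousOn.intervalIntegrable (ContinuousOn.neg ?_)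
      rw [uIcc_of_le hl]
      exact hp.continuousOn_gA.comp (f := fun s => (s, τ)) (by fun_prop)
        fun s hs => ⟨hsub hs, mem_univ _⟩
    · have h0 := (hsub hs).1
      have h2 := dd_pos h0 τ
      have h3 : Real.sqrt (dd s τ) ≤ 1 := Real.sqrt_le_one.2 (dd_le_one h0.le hs.2 τ)
      have h4 : 1 ≤ 1 / Real.sqrt (dd s τ) := by
        rw [le_div_iff₀ (Real.sqrt_pos.2 h2)]; linarith
      have h5 : 0 < 1 / |p.a| * (1 / sk p s) := by
        have := sk_pos (hsub hs); positivity
      have h6 : -gA p s τ = 1 / |p.a| * (1 / sk p s) * (1 / Real.sqrt (dd s τ)) := by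
        unfold gA; rw [one_div_mul_one_div]; ring
      rw [h6]
      nlinarith
  rw [hint] at h1
  refine le_trans (mul_le_mul_of_nonneg_left (sub_le_sub ?_ ?_) (by positivity)) h1
  -- Upper ends: `sk 1 = √(Λ/3) |a|`, so the comparison is `√(Λ/3) rp ≤ 1`.
  · refine Real.arctan_strictMono.monotone ?_
    have h2 : sk p 1 = Real.sqrt (p.Λ / 3) * |p.a| := by
      unfold sk Ξ
      rw [← Real.sqrt_sq_eq_abs, ← Real.sqrt_mul (by have := hp.Λ_pos; positivity)]
      congr 1; ring
    have h3 : 0 < Real.sqrt (p.Λ / 3) := Real.sqrt_pos.2 (by have := hp.Λ_pos; positivity)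
    have h4 : Real.sqrt (p.Λ / 3) * p.rp ≤ 1 := by
      have h5 : (Real.sqrt (p.Λ / 3) * p.rp) ^ 2 ≤ 1 := by
        rw [mul_pow, Real.sq_sqrt (by have := hp.Λ_pos; positivity)]; exact hp.rp_lt.le
      exact (abs_le.1 ((sq_le_one_iff_abs_le_one _).1 h5)).2
    rw [h2, div_le_div_iff₀ ha (by positivity)]
    nlinarith
  -- Lower ends: `zmin` is the solution of `z / sk z = rm / |a|`, so the two arctangents coincide.
  · apply le_of_eq
    congr 1
    have h3 : 0 < Real.sqrt (nn p p.rm) := Real.sqrt_pos.2 (hp.nn_pos _)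
    have h4 : 0 < Real.sqrt (Ξ p) := Real.sqrt_pos.2 (by linarith [hp.Xi_gt])
    have h2 : sk p (zmin p) = Real.sqrt (Ξ p) * |p.a| / Real.sqrt (nn p p.rm) := by
      unfold sk
      rw [hp.zmin_sq, ← Real.sqrt_sq_eq_abs, ← Real.sqrt_mul (by linarith [hp.Xi_gt]),
        ← Real.sqrt_div (by have := hp.Xi_gt; positivity)]
      congr 1
      have := hp.nn_pos p.rm
      field_simp
      unfold nn; ring
    rw [h2]; unfold zmin
    field_simp

/-- `ellA · τ` vanishes at `1` and at `zmin` dominates the largest possible value of `ellT`; the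
intermediate value theorem applies uniformly in `τ`. -/
theorem Subextremal.exists_z (hp : Subextremal p) {r : ℝ} (hr : r ∈ Icc p.rm p.rp) (τ : ℝ) :
    ∃ z ∈ Icc (zmin p) 1, ellA p z τ = ellT p r τ := by
  have hc : ContinuousOn (fun z => ellA p z τ) (Icc (zmin p) 1) := fun z hz =>
    ((hp.grad_ellA (hp.Icc_subset_ZI hz) τ).hasDerivAt_fst).continuousAt.continuousWithinAt
  have h1 : ellA p 1 τ = 0 := by unfold ellA; simp
  have := intermediate_value_Icc' hp.zmin_lt_one.le hc
  obtain ⟨z, hz, hz'⟩ := this (show ellT p r τ ∈ Icc (ellA p 1 τ) (ellA p (zmin p) τ) from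
    ⟨by rw [h1]; exact ellT_nonneg hr τ, (hp.ellT_le hr τ).trans (hp.le_ellA_zmin τ)⟩)
  exact ⟨z, hz, hz'⟩

/-- The inverse function of `ellA · τ`. -/
def ellAinv (p : Params) (y τ : ℝ) : ℝ := Function.invFunOn (fun z => ellA p z τ) (ZI p) y

/-- The solution `z` of `ellA z τ = ellT r τ`. -/
def zz (p : Params) (r τ : ℝ) : ℝ := ellAinv p (ellT p r τ) τ

theorem Subextremal.ellAinv_ellA (hp : Subextremal p) {z : ℝ} (hz : z ∈ ZI p) (τ : ℝ) :
    ellAinv p (ellA p z τ) τ = z :=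
  (hp.strictAntiOn_ellA τ).injOn.leftInvOn_invFunOn hz

theorem Subextremal.zz_eq (hp : Subextremal p) {r z τ : ℝ} (hz : z ∈ ZI p)
    (h : ellA p z τ = ellT p r τ) : zz p r τ = z := by
  unfold zz; rw [← h, hp.ellAinv_ellA hz]

theorem Subextremal.zz_spec (hp : Subextremal p) {r : ℝ} (hr : r ∈ Icc p.rm p.rp) (τ : ℝ) :
    zz p r τ ∈ Icc (zmin p) 1 ∧ ellA p (zz p r τ) τ = ellT p r τ := by
  obtain ⟨z, hz, h⟩ := hp.exists_z hr τ
  rw [hp.zz_eq (hp.Icc_subset_ZI hz) h]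
  exact ⟨hz, h⟩

theorem Subextremal.zz_mem (hp : Subextremal p) {r : ℝ} (hr : r ∈ Icc p.rm p.rp) (τ : ℝ) :
    zz p r τ ∈ ZI p := hp.Icc_subset_ZI (hp.zz_spec hr τ).1

theorem dd_pi_sub (ζ τ : ℝ) : dd ζ (Real.pi - τ) = dd ζ τ := by
  unfold dd; rw [Real.cos_pi_sub, Real.sin_pi_sub]; ring

theorem zz_pi_sub (p : Params) (r τ : ℝ) : zz p r (Real.pi - τ) = zz p r τ := by
  have h1 : ∀ z, ellA p z (Real.pi - τ) = ellA p z τ := by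
    intro z; unfold ellA gA; simp only [dd_pi_sub]
  have h2 : ellT p r (Real.pi - τ) = ellT p r τ := by
    unfold ellT gT qq; simp only [Real.sin_pi_sub]
  unfold zz ellAinv; simp only [h1, h2]

/-- `√(dd z τ)` at `z = zz r τ`. -/
def rd (p : Params) (r τ : ℝ) : ℝ := Real.sqrt (dd (zz p r τ) τ)

/-- The sum of the `λ`-derivatives of the two elliptic integrals. -/
def jj (p : Params) (r τ : ℝ) : ℝ := ellA₁ p (zz p r τ) τ + ellT₁ p r τ

/-- `Q` as a function of `τ`. -/
def Qt (p : Params) (r τ : ℝ) : ℝ := Real.sqrt (qq p r τ)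

theorem Subextremal.dd_zz_pos (hp : Subextremal p) {r : ℝ} (hr : r ∈ Icc p.rm p.rp) (τ : ℝ) :
    0 < dd (zz p r τ) τ := dd_pos (hp.zz_mem hr τ).1 τ

theorem Subextremal.rd_pos (hp : Subextremal p) {r : ℝ} (hr : r ∈ Icc p.rm p.rp) (τ : ℝ) :
    0 < rd p r τ := Real.sqrt_pos.2 (hp.dd_zz_pos hr τ)

theorem Subextremal.rd_sq (hp : Subextremal p) {r : ℝ} (hr : r ∈ Icc p.rm p.rp) (τ : ℝ) :
    rd p r τ ^ 2 = Real.cos τ ^ 2 + zz p r τ ^ 2 * Real.sin τ ^ 2 :=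
  Real.sq_sqrt (hp.dd_zz_pos hr τ).le

theorem Subextremal.Qt_pos (hp : Subextremal p) {r : ℝ} (hr : r ∈ Icc p.rm p.rp) (τ : ℝ) :
    0 < Qt p r τ := Real.sqrt_pos.2 (hp.qq_pos hr τ)

/-- Implicit differentiation of `ellA z τ = ellT r τ`: `ellAinv` is a local left inverse of the skew
product `(z, τ) ↦ (ellA z τ, τ)`, and `zz` is its composition with `ellT`. No restriction on `τ` is
needed, and `r` may lie on a horizon. -/
theorem Subextremal.grad_zz (hp : Subextremal p) {r : ℝ} (hr : r ∈ Icc p.rm p.rp) (τ : ℝ) :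
    HasGrad (fun q => zz p q.1 q.2) (|p.a| * sk p (zz p r τ) * rd p r τ / Qt p r τ)
      (Real.sin τ * Real.cos τ * (|p.a| * sk p (zz p r τ) * rd p r τ * jj p r τ)) (r, τ) := by
  obtain ⟨h1, h2⟩ := hp.zz_spec hr τ
  have hz := hp.zz_mem hr τ
  have hinv : HasGrad (fun q => ellAinv p q.1 q.2) _ _ (ellA p (zz p r τ) τ, τ) :=
    HasGrad.local_left_inverse (hp.grad_ellA hz τ) (hp.gA_neg hz τ).ne (by
      filter_upwards [(isOpen_UA p).mem_nhds (show (zz p r τ, τ) ∈ UA p from ⟨hz, mem_univ _⟩)]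
        with v hv
      exact hp.ellAinv_ellA hv.1 v.2)
  rw [h2] at hinv
  have ha := hp.abs_a_pos
  have hs := sk_pos hz
  have hr' := hp.rd_pos hr τ
  have hQ := hp.Qt_pos hr τ
  have hg : gA p (zz p r τ) τ = -(1 / (|p.a| * sk p (zz p r τ))) * (1 / rd p r τ) := rfl
  have hg' : gT p r τ = -(1 / Qt p r τ) := rfl
  refine (HasGrad.comp₂ (f := fun q => ellAinv p q.1 q.2) (u := fun q => ellT p q.1 q.2)
    (v := fun q => q.2) (q := (r, τ)) hinv (hp.grad_ellT hr τ) HasGrad.snd).congr ?_ ?_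
  · rw [hg, hg']; field_simp; ring
  · rw [hg]; unfold jj; field_simp; ring

/-- Both integrands have the right sign: `ζ ≤ 1` in the angular one and `Δr ≤ 0` in the radial one.
-/
theorem Subextremal.jj_nonneg (hp : Subextremal p) {r : ℝ} (hr : r ∈ Icc p.rm p.rp) (τ : ℝ) :
    0 ≤ jj p r τ := by
  obtain ⟨h1, h2⟩ := hp.zz_spec hr τ
  refine add_nonneg ?_ ?_
  · unfold ellA₁
    rw [intervalIntegral.integral_symm, ← intervalIntegral.integral_neg]
    refine intervalIntegral.integral_nonneg h1.2 fun s hs => ?_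
    have h0 : 0 < s := lt_of_lt_of_le hp.zmin_pos (h1.1.trans hs.1)
    have h3 : 0 ≤ 1 - s ^ 2 := by have := pow_le_one₀ (n := 2) h0.le hs.2; linarith
    have h4 := dd_pos h0 τ
    have h5 := sk_pos (hp.mem_ZI h0 hs.2)
    unfold gA₁
    rw [neg_mul, neg_neg]
    positivity
  · unfold ellT₁
    rw [intervalIntegral.integral_symm, ← intervalIntegral.integral_neg]
    refine intervalIntegral.integral_nonneg hr.2 fun s hs => ?_
    have h3 : 0 ≤ -Δr p s := by have := hp.nonpos ⟨hr.1.trans hs.1, hs.2⟩; linarith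
    have h4 := hp.qq_pos ⟨hr.1.trans hs.1, hs.2⟩ τ
    have h5 : -gT₁ p s τ = p.a ^ 2 * (-Δr p s) * (1 / (qq p s τ * Real.sqrt (qq p s τ))) := by
      unfold gT₁; ring
    rw [h5]; positivity

end

end KNdS

namespace KNdS

open Filter Topology MeasureTheory

noncomputable section

variable (p : Params)

/-! ### The angle `θ` as a function of `r` and `τ = θ⋆` -/

/-- The value of `θ` at the point with coordinates `r` and `θ⋆ = τ`. -/
def Th (r τ : ℝ) : ℝ := Real.arccos (Real.cos τ / rd p r τ)

/-- `P(θ, sin² τ)` at `θ = Th r τ`, continued as an odd function across the equator. -/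
def Pt (r τ : ℝ) : ℝ := |p.a| * Real.sin τ * Real.cos τ * sk p (zz p r τ) / rd p r τ

/-- The partial derivative of `Th` with respect to `τ`. -/
def kk (r τ : ℝ) : ℝ :=
  (zz p r τ + (Real.sin τ * Real.cos τ) ^ 2 * (|p.a| * sk p (zz p r τ) * rd p r τ * jj p r τ))
    / rd p r τ ^ 2

variable {p}

theorem sin_pos_of_mem {τ : ℝ} (hτ : τ ∈ Ioo 0 Real.pi) : 0 < Real.sin τ :=
  Real.sin_pos_of_pos_of_lt_pi hτ.1 hτ.2

theorem Subextremal.sq_cos_div (hp : Subextremal p) {r : ℝ} (hr : r ∈ Icc p.rm p.rp) (τ : ℝ) :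
    1 - (Real.cos τ / rd p r τ) ^ 2 = (zz p r τ * Real.sin τ / rd p r τ) ^ 2 := by
  have h := (hp.rd_pos hr τ).ne'
  have h2 := hp.rd_sq hr τ
  field_simp
  linarith

theorem Subextremal.abs_cos_div_le (hp : Subextremal p) {r : ℝ} (hr : r ∈ Icc p.rm p.rp) (τ : ℝ) :
    |Real.cos τ / rd p r τ| ≤ 1 := by
  rw [← sq_le_one_iff_abs_le_one]
  have := hp.sq_cos_div hr τ
  nlinarith [sq_nonneg (zz p r τ * Real.sin τ / rd p r τ)]

theorem Subextremal.cos_Th (hp : Subextremal p) {r : ℝ} (hr : r ∈ Icc p.rm p.rp) (τ : ℝ) :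
    Real.cos (Th p r τ) = Real.cos τ / rd p r τ := by
  have := abs_le.1 (hp.abs_cos_div_le hr τ)
  exact Real.cos_arccos this.1 this.2

theorem Subextremal.sin_Th (hp : Subextremal p) {r : ℝ} (hr : r ∈ Icc p.rm p.rp) {τ : ℝ}
    (hτ : τ ∈ Icc 0 Real.pi) :
    Real.sin (Th p r τ) = zz p r τ * Real.sin τ / rd p r τ := by
  unfold Th
  rw [Real.sin_arccos, hp.sq_cos_div hr τ, Real.sqrt_sq]
  have h1 := (hp.zz_mem hr τ).1
  have h2 := hp.rd_pos hr τ
  have h3 := Real.sin_nonneg_of_mem_Icc hτ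
  positivity

theorem grad_dd (ζ τ : ℝ) : HasGrad (fun q : ℝ × ℝ => dd q.1 q.2) (2 * ζ * Real.sin τ ^ 2)
    (-2 * Real.sin τ * Real.cos τ * (1 - ζ ^ 2)) (ζ, τ) := by
  have hcos : HasGrad (fun q : ℝ × ℝ => Real.cos q.2) _ _ (ζ, τ) :=
    HasGrad.comp_deriv (Real.hasStrictDerivAt_cos τ) HasGrad.snd
  have hsin : HasGrad (fun q : ℝ × ℝ => Real.sin q.2) _ _ (ζ, τ) :=
    HasGrad.comp_deriv (Real.hasStrictDerivAt_sin τ) HasGrad.snd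
  have hz : HasGrad (fun q : ℝ × ℝ => q.1) 1 0 (ζ, τ) := HasGrad.fst
  refine (((hcos.mul hcos).add ((hz.mul hz).mul (hsin.mul hsin))).congr_of_eventuallyEq
    (Eventually.of_forall fun q => by unfold dd; ring)).congr ?_ ?_ <;> ring

theorem hasStrictDerivAt_inv_sqrt {x : ℝ} (hx : 0 < x) :
    HasStrictDerivAt (fun x => (Real.sqrt x)⁻¹) (-(1 / (2 * (x * Real.sqrt x)))) x := by
  have h := Real.sqrt_pos.2 hx
  refine ((hasStrictDerivAt_inv h.ne').comp x
    (Real.hasStrictDerivAt_sqrt hx.ne')).congr_deriv ?_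
  rw [Real.sq_sqrt hx.le]; field_simp

/-- Since `1 - cos² τ / dd = ζ² sin² τ / dd > 0`, the argument of `arccos` stays away from `±1`, its
points of non-differentiability. -/
theorem grad_arccos_dd {ζ τ : ℝ} (hζ : 0 < ζ) (hτ : 0 < Real.sin τ) :
    HasGrad (fun q : ℝ × ℝ => Real.arccos (Real.cos q.2 * (Real.sqrt (dd q.1 q.2))⁻¹))
      (Real.sin τ * Real.cos τ / dd ζ τ) (ζ / dd ζ τ) (ζ, τ) := by
  have hd := dd_pos hζ τ
  have hs := Real.sqrt_pos.2 hd
  have hsq : Real.sqrt (dd ζ τ) ^ 2 = dd ζ τ := Real.sq_sqrt hd.le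
  have hpos : 0 < ζ * Real.sin τ * (Real.sqrt (dd ζ τ))⁻¹ := by positivity
  have hc : 1 - (Real.cos τ * (Real.sqrt (dd ζ τ))⁻¹) ^ 2 =
      (ζ * Real.sin τ * (Real.sqrt (dd ζ τ))⁻¹) ^ 2 := by
    field_simp
    rw [hsq]; unfold dd; ring
  have hne1 : Real.cos τ * (Real.sqrt (dd ζ τ))⁻¹ ≠ -1 := by
    intro h; rw [h] at hc; nlinarith
  have hne2 : Real.cos τ * (Real.sqrt (dd ζ τ))⁻¹ ≠ 1 := by
    intro h; rw [h] at hc; nlinarith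
  have hcos : HasGrad (fun q : ℝ × ℝ => Real.cos q.2) 0 (-Real.sin τ) (ζ, τ) :=
    (HasGrad.comp_deriv (q := (ζ, τ)) (Real.hasStrictDerivAt_cos τ) HasGrad.snd).congr
      (by ring) (by ring)
  have hinv : HasGrad (fun q : ℝ × ℝ => (Real.sqrt (dd q.1 q.2))⁻¹)
      (-(ζ * Real.sin τ ^ 2) / (dd ζ τ * Real.sqrt (dd ζ τ)))
      (Real.sin τ * Real.cos τ * (1 - ζ ^ 2) / (dd ζ τ * Real.sqrt (dd ζ τ))) (ζ, τ) :=
    (HasGrad.comp_deriv (q := (ζ, τ)) (f := fun q : ℝ × ℝ => dd q.1 q.2)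
      (φ := fun x => (Real.sqrt x)⁻¹) (hasStrictDerivAt_inv_sqrt hd) (grad_dd ζ τ)).congr
      (by field_simp) (by field_simp)
  have harc := Real.hasStrictDerivAt_arccos hne1 hne2
  rw [hc, Real.sqrt_sq hpos.le] at harc
  refine (HasGrad.comp_deriv (f := fun q : ℝ × ℝ => Real.cos q.2 * (Real.sqrt (dd q.1 q.2))⁻¹)
    (φ := Real.arccos) (q := (ζ, τ)) harc (hcos.mul hinv)).congr ?_ ?_
  · simp only
    field_simp
    ring
  · have e : dd ζ τ = Real.cos τ ^ 2 + ζ ^ 2 * Real.sin τ ^ 2 := rfl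
    simp only
    field_simp
    rw [e]; linear_combination ζ ^ 2 * Real.sin_sq_add_cos_sq τ

theorem Subextremal.grad_Th (hp : Subextremal p) {r τ : ℝ} (hr : r ∈ Icc p.rm p.rp)
    (hτ : τ ∈ Ioo 0 Real.pi) :
    HasGrad (fun q => Th p q.1 q.2) (Pt p r τ / Qt p r τ) (kk p r τ) (r, τ) := by
  have hz := (hp.zz_mem hr τ).1
  have hd := hp.rd_pos hr τ
  have hQ := hp.Qt_pos hr τ
  have hsq : rd p r τ ^ 2 = dd (zz p r τ) τ := Real.sq_sqrt (hp.dd_zz_pos hr τ).le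
  have h := (HasGrad.comp₂ (u := fun q => zz p q.1 q.2) (v := fun q => q.2) (q := (r, τ))
    (grad_arccos_dd hz (sin_pos_of_mem hτ)) (hp.grad_zz hr τ) HasGrad.snd)
  refine HasGrad.congr (f := fun q => Th p q.1 q.2) h ?_ ?_
  · rw [← hsq]; unfold Pt; field_simp; ring
  · rw [← hsq]; unfold kk; field_simp; ring

/-- The term with `jj` is nonnegative and `rd² ≤ 1`, so `kk ≥ zz`. This lower bound, uniform up to
the horizons and poles, gives both the monotonicity of `Th` and the nondegeneracy of the coefficient
`EE`. -/
theorem Subextremal.kk_pos (hp : Subextremal p) {r : ℝ} (hr : r ∈ Icc p.rm p.rp) (τ : ℝ) :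
    zmin p ≤ kk p r τ := by
  obtain ⟨h1, h2⟩ := hp.zz_spec hr τ
  have hz := hp.zz_mem hr τ
  have hd := hp.rd_pos hr τ
  have hd1 : rd p r τ ^ 2 ≤ 1 := by
    have : rd p r τ ^ 2 = dd (zz p r τ) τ := Real.sq_sqrt (hp.dd_zz_pos hr τ).le
    rw [this]; exact dd_le_one hz.1.le h1.2 τ
  have hj := hp.jj_nonneg hr τ
  have hs := sk_pos hz
  have hx : 0 ≤ (Real.sin τ * Real.cos τ) ^ 2 *
      (|p.a| * sk p (zz p r τ) * rd p r τ * jj p r τ) := by positivity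
  unfold kk
  rw [le_div_iff₀ (by positivity)]
  nlinarith [hp.zmin_pos, h1.1]

/-- `zz` and `dd` depend on `τ` only through `sin² τ` and `cos² τ`, so `Th` inherits the reflection
by which `thetaStar` is extended to the southern hemisphere. -/
theorem Th_pi_sub (p : Params) (r τ : ℝ) : Th p r (Real.pi - τ) = Real.pi - Th p r τ := by
  unfold Th rd
  rw [zz_pi_sub, dd_pi_sub, Real.cos_pi_sub, neg_div, Real.arccos_neg]

theorem Th_half_pi (p : Params) (r : ℝ) : Th p r (Real.pi / 2) = Real.pi / 2 := by
  unfold Th; simp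

theorem Th_zero (p : Params) (r : ℝ) : Th p r 0 = 0 := by
  unfold Th rd dd; simp

theorem Subextremal.Th_mem (hp : Subextremal p) {r τ : ℝ} (hr : r ∈ Icc p.rm p.rp)
    (hτ : τ ∈ Ioo 0 Real.pi) : Th p r τ ∈ Ioo 0 Real.pi := by
  have hs : 0 < Real.sin (Th p r τ) := by
    rw [hp.sin_Th hr (Ioo_subset_Icc_self hτ)]
    have h1 := (hp.zz_mem hr τ).1
    have h2 := hp.rd_pos hr τ
    have h3 := sin_pos_of_mem hτ
    positivity
  constructor
  · refine lt_of_le_of_ne (Real.arccos_nonneg _) fun h => ?_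
    change 0 = Th p r τ at h
    rw [← h, Real.sin_zero] at hs; exact lt_irrefl _ hs
  · refine lt_of_le_of_ne (Real.arccos_le_pi _) fun h => ?_
    change Th p r τ = Real.pi at h
    rw [h, Real.sin_pi] at hs; exact lt_irrefl _ hs

theorem Subextremal.continuous_Th (hp : Subextremal p) {r : ℝ} (hr : r ∈ Icc p.rm p.rp) :
    Continuous fun τ => Th p r τ := by
  have h1 : Continuous fun τ => zz p r τ :=
    continuous_iff_continuousAt.2 fun τ => (hp.grad_zz hr τ).hasDerivAt_snd.continuousAt
  have h2 : Continuous fun τ => rd p r τ := by unfold rd dd; fun_prop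
  unfold Th
  exact Real.continuous_arccos.comp
    (Real.continuous_cos.div h2 fun τ => (hp.rd_pos hr τ).ne')

theorem Subextremal.strictMonoOn_Th (hp : Subextremal p) {r : ℝ} (hr : r ∈ Icc p.rm p.rp) :
    StrictMonoOn (fun τ => Th p r τ) (Icc 0 Real.pi) := by
  refine strictMonoOn_of_deriv_pos (convex_Icc _ _) (hp.continuous_Th hr).continuousOn ?_
  intro τ hτ
  rw [interior_Icc] at hτ
  rw [(hp.grad_Th hr hτ).hasDerivAt_snd.deriv]
  exact lt_of_lt_of_le hp.zmin_pos (hp.kk_pos hr τ)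

theorem Subextremal.exists_Th_eq (hp : Subextremal p) {r θ : ℝ} (hr : r ∈ Icc p.rm p.rp)
    (hθ : θ ∈ Ioo 0 (Real.pi / 2)) : ∃ τ ∈ Ioo 0 (Real.pi / 2), Th p r τ = θ := by
  have h0 : (0 : ℝ) ≤ Real.pi / 2 := by positivity
  have := intermediate_value_Ioo h0 (hp.continuous_Th hr).continuousOn
  rw [Th_zero, Th_half_pi] at this
  obtain ⟨τ, hτ, h⟩ := this hθ
  exact ⟨τ, hτ, h⟩

/-- `zz ≤ 1` gives `rd ≤ 1`, hence `cos θ ≥ cos τ` on the northern hemisphere. This places the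
solution in the interval `[θ, π/2)` required of `θ⋆`. -/
theorem Subextremal.Th_le (hp : Subextremal p) {r τ : ℝ} (hr : r ∈ Icc p.rm p.rp)
    (hτ : τ ∈ Ioo 0 (Real.pi / 2)) : Th p r τ ≤ τ := by
  obtain ⟨h1, h2⟩ := hp.zz_spec hr τ
  have hz := hp.zz_mem hr τ
  have hd := hp.rd_pos hr τ
  have hd1 : rd p r τ ≤ 1 := Real.sqrt_le_one.2 (dd_le_one hz.1.le h1.2 τ)
  have hc : 0 < Real.cos τ := Real.cos_pos_of_mem_Ioo ⟨by linarith [hτ.1, Real.pi_pos], hτ.2⟩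
  have h3 : Real.cos τ ≤ Real.cos τ / rd p r τ := by
    rw [le_div_iff₀ hd]; nlinarith
  have h4 := Real.arccos_le_arccos h3
  rwa [Real.arccos_cos hτ.1.le (by linarith [hτ.2, Real.pi_pos])] at h4

/-! ### The function `F` in terms of the elliptic integrals -/

/-- Substitution `ζ = tan s / tan τ`. It works because the radicand of `P` factors as `(Ξ - ζ²) · dd
ζ τ · (cos² s tan τ)²` (step `hP`), and `dζ = ds / (cos² s tan τ)` cancels the last factor. -/
theorem Subextremal.integral_P (hp : Subextremal p) {θ τ : ℝ} (hθ : 0 < θ) (hθτ : θ ≤ τ)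
    (hτ : τ < Real.pi / 2) :
    ∫ s in τ..θ, 1 / P p s (Real.sin τ ^ 2) = -ellA p (Real.tan θ / Real.tan τ) τ := by
  have hτ0 : 0 < τ := lt_of_lt_of_le hθ hθτ
  have htτ : 0 < Real.tan τ := Real.tan_pos_of_pos_of_lt_pi_div_two hτ0 hτ
  have hcτ : 0 < Real.cos τ := Real.cos_pos_of_mem_Ioo ⟨by linarith, hτ⟩
  have hsτ : 0 < Real.sin τ := Real.sin_pos_of_pos_of_lt_pi hτ0 (by linarith)
  have hu : uIcc τ θ = Icc θ τ := uIcc_of_ge hθτ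
  have hcos : ∀ s ∈ Icc θ τ, 0 < Real.cos s := fun s hs =>
    Real.cos_pos_of_mem_Ioo ⟨by linarith [hs.1], by linarith [hs.2]⟩
  have hmem : ∀ s ∈ Icc θ τ, Real.tan s / Real.tan τ ∈ ZI p := fun s hs => by
    have h1 : 0 < Real.tan s :=
      Real.tan_pos_of_pos_of_lt_pi_div_two (by linarith [hs.1]) (by linarith [hs.2])
    refine hp.mem_ZI (by positivity) ((div_le_one htτ).2 ?_)
    exact Real.strictMonoOn_tan.monotoneOn ⟨by linarith [hs.1], by linarith [hs.2]⟩
      ⟨by linarith, hτ⟩ hs.2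
  have hP : ∀ s ∈ Icc θ τ, P p s (Real.sin τ ^ 2) = |p.a| * (sk p (Real.tan s / Real.tan τ) *
      Real.sqrt (dd (Real.tan s / Real.tan τ) τ) * Real.cos s ^ 2 * Real.tan τ) := by
    intro s hs
    have h1 := sk_sq_pos (hmem s hs)
    have h2 := dd_pos (hmem s hs).1 τ
    have hc := hcos s hs
    unfold P
    congr 1
    rw [Real.sqrt_eq_iff_mul_self_eq_of_pos]
    · unfold sk
      have e : ∀ x y c t : ℝ, x * y * c * t * (x * y * c * t) = x ^ 2 * y ^ 2 * (c * t) ^ 2 := by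
        intros; ring
      rw [e, Real.sq_sqrt h1.le, Real.sq_sqrt h2.le]
      unfold dd Δθ Ξ
      have hs1 : Real.sin s ^ 2 = 1 - Real.cos s ^ 2 := Real.sin_sq s
      have hs2 : Real.sin τ ^ 2 = 1 - Real.cos τ ^ 2 := Real.sin_sq τ
      rw [Real.tan_eq_sin_div_cos, Real.tan_eq_sin_div_cos]
      field_simp
      rw [hs1, hs2]
      ring
    · have := sk_pos (hmem s hs)
      positivity
  have hsub := intervalIntegral.integral_comp_mul_deriv''' (a := τ) (b := θ)
    (f := fun s => Real.tan s / Real.tan τ) (f' := fun s => 1 / Real.cos s ^ 2 / Real.tan τ)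
    (g := fun ζ => gA p ζ τ) ?_ ?_ ?_ ?_ ?_
  · unfold ellA
    rw [div_self htτ.ne'] at hsub
    rw [← hsub, ← intervalIntegral.integral_neg]
    refine intervalIntegral.integral_congr fun s hs => ?_
    rw [hu] at hs
    have h1 := sk_pos (hmem s hs)
    have h2 := Real.sqrt_pos.2 (dd_pos (hmem s hs).1 τ)
    have hc := hcos s hs
    have ha := hp.abs_a_pos
    simp only [Function.comp, gA]
    rw [hP s hs]
    field_simp
  · rw [hu]
    exact ContinuousOn.div_const (Real.continuousOn_tan.mono fun s hs => (hcos s hs).ne') _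
  · intro s hs
    rw [min_eq_right hθτ, max_eq_left hθτ] at hs
    exact ((Real.hasDerivAt_tan (hcos s (Ioo_subset_Icc_self hs)).ne').div_const
      _).hasDerivWithinAt
  · refine hp.continuousOn_gA.comp (f := fun s => (s, τ)) (by fun_prop) ?_
    rintro _ ⟨s, hs, rfl⟩
    rw [min_eq_right hθτ, max_eq_left hθτ] at hs
    exact ⟨hmem s (Ioo_subset_Icc_self hs), mem_univ _⟩
  · refine (ContinuousOn.integrableOn_compact
      ((isCompact_uIcc (a := τ) (b := θ)).image_of_continuousOn
      (ContinuousOn.div_const (Real.continuousOn_tan.mono fun s hs => ?_) _)) ?_)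
    · rw [hu] at hs; exact (hcos s hs).ne'
    · refine hp.continuousOn_gA.comp (f := fun s => (s, τ)) (by fun_prop) ?_
      rintro _ ⟨s, hs, rfl⟩
      rw [hu] at hs
      exact ⟨hmem s hs, mem_univ _⟩
  · refine ContinuousOn.integrableOn_compact isCompact_uIcc ?_
    rw [hu]
    refine ContinuousOn.mul ?_ ?_
    · refine (hp.continuousOn_gA.comp (f := fun s => (s, τ)) (by fun_prop) (s := ZI p)
        fun s hs => ⟨hs, mem_univ _⟩).comp
        (ContinuousOn.div_const (Real.continuousOn_tan.mono fun s hs => (hcos s hs).ne') _) hmem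
    · refine ContinuousOn.div_const (ContinuousOn.div continuousOn_const (by fun_prop)
        fun s hs => ?_) _
      have := hcos s hs
      positivity

theorem Subextremal.F_eq (hp : Subextremal p) {r θ τ : ℝ} (hθ : 0 < θ) (hθτ : θ ≤ τ)
    (hτ : τ < Real.pi / 2) :
    F p r θ τ = ellT p r τ - ellA p (Real.tan θ / Real.tan τ) τ := by
  unfold F ellT
  rw [hp.integral_P hθ hθτ hτ, intervalIntegral.integral_symm p.rp r,
    ← intervalIntegral.integral_neg]
  simp only [Q_eq, gT]
  ring

/-- By `F_eq` the equation is `ellA (tan θ / tan τ) τ = ellT r τ`, whose only solution in `ZI` is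
`zz r τ`; and `tan (Th r τ) = zz r τ · tan τ`. -/
theorem Subextremal.F_eq_zero_iff (hp : Subextremal p) {r θ τ : ℝ} (hr : r ∈ Icc p.rm p.rp)
    (hθ : 0 < θ) (hθτ : θ ≤ τ) (hτ : τ < Real.pi / 2) : F p r θ τ = 0 ↔ Th p r τ = θ := by
  have hτ0 : 0 < τ := lt_of_lt_of_le hθ hθτ
  have hτI : τ ∈ Ioo 0 Real.pi := ⟨hτ0, by linarith [Real.pi_pos]⟩
  have htτ : 0 < Real.tan τ := Real.tan_pos_of_pos_of_lt_pi_div_two hτ0 hτ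
  have htθ : 0 < Real.tan θ := Real.tan_pos_of_pos_of_lt_pi_div_two hθ (by linarith)
  have hcτ : 0 < Real.cos τ := Real.cos_pos_of_mem_Ioo ⟨by linarith, hτ⟩
  have hz : Real.tan θ / Real.tan τ ∈ ZI p := by
    refine hp.mem_ZI (by positivity) ((div_le_one htτ).2 ?_)
    exact Real.strictMonoOn_tan.monotoneOn ⟨by linarith, by linarith⟩ ⟨by linarith, hτ⟩ hθτ
  have htan : Real.tan (Th p r τ) = zz p r τ * Real.tan τ := by
    have := hp.rd_pos hr τ
    rw [Real.tan_eq_sin_div_cos, hp.cos_Th hr, hp.sin_Th hr (Ioo_subset_Icc_self hτI),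
      Real.tan_eq_sin_div_cos]
    field_simp
  rw [hp.F_eq hθ hθτ hτ, sub_eq_zero]
  constructor
  · intro h
    have h1 := hp.zz_eq hz h.symm
    have hTm := hp.Th_mem hr hτI
    have hTle := hp.Th_le hr ⟨hτ0, hτ⟩
    refine Real.injOn_tan ⟨by linarith [hTm.1, Real.pi_pos], by linarith⟩
      ⟨by linarith, by linarith⟩ ?_
    rw [htan, h1]; field_simp
  · intro h
    have h1 : Real.tan θ / Real.tan τ = zz p r τ := by
      rw [← h, htan]; field_simp
    rw [h1, (hp.zz_spec hr τ).2]

theorem Subextremal.Th_inj (hp : Subextremal p) {r τ τ' : ℝ} (hr : r ∈ Icc p.rm p.rp)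
    (hτ : τ ∈ Icc 0 Real.pi) (hτ' : τ' ∈ Icc 0 Real.pi) (h : Th p r τ = Th p r τ') : τ = τ' :=
  (hp.strictMonoOn_Th hr).injOn hτ hτ' h

theorem Subextremal.existsUnique_tau (hp : Subextremal p) {r θ : ℝ} (hr : r ∈ Icc p.rm p.rp)
    (hθ : θ ∈ Ioo 0 (Real.pi / 2)) :
    ∃! τ : ℝ, τ ∈ Ico θ (Real.pi / 2) ∧ F p r θ τ = 0 := by
  obtain ⟨τ, hτ, h⟩ := hp.exists_Th_eq hr hθ
  have hle : θ ≤ τ := h ▸ hp.Th_le hr hτ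
  have hpi := Real.pi_pos
  refine ⟨τ, ⟨⟨hle, hτ.2⟩, (hp.F_eq_zero_iff hr hθ.1 hle hτ.2).2 h⟩, ?_⟩
  rintro τ' ⟨hτ', h'⟩
  have h1 := (hp.F_eq_zero_iff hr hθ.1 hτ'.1 hτ'.2).1 h'
  exact hp.Th_inj hr ⟨by linarith [hθ.1, hτ'.1], by linarith [hτ'.2]⟩
    ⟨by linarith [hθ.1], by linarith [hτ.2]⟩ (h1.trans h.symm)

/-- Uniqueness of the zero of `F` forces the choice operator in the definition to return `τ`. -/
theorem Subextremal.thetaStarNorth_Th (hp : Subextremal p) {r τ : ℝ} (hr : r ∈ Icc p.rm p.rp)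
    (hτ : τ ∈ Ioc 0 (Real.pi / 2)) : thetaStarNorth p r (Th p r τ) = τ := by
  have hpi := Real.pi_pos
  have hτI : τ ∈ Ioo 0 Real.pi := ⟨hτ.1, by linarith [hτ.2]⟩
  have hTm := hp.Th_mem hr hτI
  unfold thetaStarNorth
  rw [if_neg hTm.1.ne']
  rcases eq_or_lt_of_le hτ.2 with h | h
  · rw [h, Th_half_pi, if_pos rfl]
  · have hlt := hp.strictMonoOn_Th hr (Ioo_subset_Icc_self hτI)
      (show Real.pi / 2 ∈ Icc 0 Real.pi from ⟨by linarith, by linarith⟩) h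
    simp only [Th_half_pi] at hlt
    rw [if_neg hlt.ne]
    have hθ : Th p r τ ∈ Ioo 0 (Real.pi / 2) := ⟨hTm.1, hlt⟩
    have hle := hp.Th_le hr ⟨hτ.1, h⟩
    have hsol : τ ∈ Ico (Th p r τ) (Real.pi / 2) ∧ F p r (Th p r τ) τ = 0 :=
      ⟨⟨hle, h⟩, (hp.F_eq_zero_iff hr hθ.1 hle h).2 rfl⟩
    exact (hp.existsUnique_tau hr hθ).unique
      (Classical.epsilon_spec (p := fun τ' : ℝ => τ' ∈ Ico (Th p r τ) (Real.pi / 2) ∧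
        F p r (Th p r τ) τ' = 0) ⟨τ, hsol⟩) hsol

theorem Subextremal.Th_le_half_iff (hp : Subextremal p) {r τ : ℝ} (hr : r ∈ Icc p.rm p.rp)
    (hτ : τ ∈ Ioo 0 Real.pi) : Th p r τ ≤ Real.pi / 2 ↔ τ ≤ Real.pi / 2 := by
  have hpi := Real.pi_pos
  have := (hp.strictMonoOn_Th hr).le_iff_le (Ioo_subset_Icc_self hτ)
    (show Real.pi / 2 ∈ Icc 0 Real.pi from ⟨by linarith, by linarith⟩)
  simpa only [Th_half_pi] using this

theorem Subextremal.thetaStar_Th (hp : Subextremal p) {r τ : ℝ} (hr : r ∈ Icc p.rm p.rp)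
    (hτ : τ ∈ Ioo 0 Real.pi) : thetaStar p r (Th p r τ) = τ := by
  unfold thetaStar
  by_cases h : τ ≤ Real.pi / 2
  · rw [if_pos ((hp.Th_le_half_iff hr hτ).2 h), hp.thetaStarNorth_Th hr ⟨hτ.1, h⟩]
  · rw [if_neg (fun h' => h ((hp.Th_le_half_iff hr hτ).1 h')), ← Th_pi_sub,
      hp.thetaStarNorth_Th hr ⟨by linarith [hτ.2], by linarith⟩]
    ring

theorem Subextremal.exists_Th (hp : Subextremal p) {r θ : ℝ} (hr : r ∈ Icc p.rm p.rp)
    (hθ : θ ∈ Ioo 0 Real.pi) : ∃ τ ∈ Ioo 0 Real.pi, Th p r τ = θ := by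
  have hpi := Real.pi_pos
  rcases lt_trichotomy θ (Real.pi / 2) with h | h | h
  · obtain ⟨τ, hτ, e⟩ := hp.exists_Th_eq hr ⟨hθ.1, h⟩
    exact ⟨τ, ⟨hτ.1, by linarith [hτ.2]⟩, e⟩
  · exact ⟨Real.pi / 2, ⟨by linarith, by linarith⟩, by rw [Th_half_pi, h]⟩
  · obtain ⟨τ, hτ, e⟩ := hp.exists_Th_eq hr
      (show Real.pi - θ ∈ Ioo 0 (Real.pi / 2) from ⟨by linarith [hθ.2], by linarith⟩)
    exact ⟨Real.pi - τ, ⟨by linarith [hτ.2], by linarith [hτ.1]⟩, by rw [Th_pi_sub, e]; ring⟩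

end

end KNdS

namespace KNdS

open Filter Topology MeasureTheory

noncomputable section

variable {p : Params}

/-! ### The function `f` -/

theorem Δθ_eq (p : Params) (θ : ℝ) : Δθ p θ = 1 + ell p * Real.cos θ ^ 2 := rfl

theorem Subextremal.one_le_Δθ (hp : Subextremal p) (θ : ℝ) : 1 ≤ Δθ p θ := by
  have := hp.ell_pos
  rw [Δθ_eq]
  have : 0 ≤ ell p * Real.cos θ ^ 2 := by positivity
  linarith

theorem continuous_Δθ (p : Params) : Continuous (Δθ p) := by unfold Δθ; fun_prop

theorem continuous_P (p : Params) : Continuous fun q : ℝ × ℝ => P p q.1 q.2 := by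
  unfold P Δθ; fun_prop

/-- On `sin² s ≤ l` one has `cos² s ≥ 1 - l`. The factor `1 - l` is the source of the singularity of
`f'` at the equator. -/
theorem Subextremal.radicand_lower (hp : Subextremal p) {s l : ℝ} (hl0 : 0 ≤ l)
    (hs : Real.sin s ^ 2 ≤ l) :
    l * ell p * (1 - l) ≤ l * Δθ p s - Real.sin s ^ 2 := by
  have h1 : 1 - l ≤ Real.cos s ^ 2 := by rw [Real.cos_sq']; linarith
  have h2 : 0 ≤ l * ell p := mul_nonneg hl0 hp.ell_pos.le
  rw [Δθ_eq]
  nlinarith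

theorem Subextremal.radicand_pos (hp : Subextremal p) {s l : ℝ} (hl : l ∈ Ioo 0 1)
    (hs : Real.sin s ^ 2 ≤ l) : 0 < l * Δθ p s - Real.sin s ^ 2 :=
  lt_of_lt_of_le (mul_pos (mul_pos hl.1 hp.ell_pos) (sub_pos.2 hl.2))
    (hp.radicand_lower hl.1.le hs)

/-- The region where `1 / P` is continuous. -/
def UP (p : Params) : Set (ℝ × ℝ) := {q | 0 < q.2 * Δθ p q.1 - Real.sin q.1 ^ 2}

theorem isOpen_UP (p : Params) : IsOpen (UP p) :=
  isOpen_lt continuous_const (by unfold Δθ; fun_prop)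

theorem Subextremal.P_pos (hp : Subextremal p) {q : ℝ × ℝ} (hq : q ∈ UP p) :
    0 < P p q.1 q.2 := mul_pos hp.abs_a_pos (Real.sqrt_pos.2 hq)

theorem Subextremal.continuousOn_inv_P (hp : Subextremal p) :
    ContinuousOn (fun q : ℝ × ℝ => 1 / P p q.1 q.2) (UP p) :=
  continuousOn_const.div (continuous_P p).continuousOn fun _ hq => (hp.P_pos hq).ne'

theorem sin_sq_le_of_mem_uIcc {s t : ℝ} (ht0 : 0 ≤ t) (ht : t ≤ Real.pi / 2)
    (hs : s ∈ uIcc 0 t) : Real.sin s ^ 2 ≤ Real.sin t ^ 2 := by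
  rw [uIcc_of_le ht0] at hs
  have h1 : Real.sin s ≤ Real.sin t := Real.sin_le_sin_of_le_of_le_pi_div_two
    (by linarith [hs.1, Real.pi_pos]) ht hs.2
  have h0 : 0 ≤ Real.sin s := Real.sin_nonneg_of_nonneg_of_le_pi hs.1
    (by linarith [hs.2, Real.pi_pos])
  gcongr

theorem sin_arcsin_sqrt {l : ℝ} (hl : l ∈ Icc 0 1) :
    Real.sin (Real.arcsin (Real.sqrt l)) ^ 2 = l := by
  rw [Real.sin_arcsin (by linarith [Real.sqrt_nonneg l]) (Real.sqrt_le_one.2 hl.2),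
    Real.sq_sqrt hl.1]

/-- The derivative of `f`. -/
def gf (p : Params) (l : ℝ) : ℝ := -∫ s in (0 : ℝ)..Real.arcsin (Real.sqrt l), 1 / P p s l

theorem sin_sq_le_of_mem_arcsin {s l : ℝ} (hl : l ∈ Icc 0 1)
    (hs : s ∈ uIcc 0 (Real.arcsin (Real.sqrt l))) : Real.sin s ^ 2 ≤ l := by
  have := sin_sq_le_of_mem_uIcc (Real.arcsin_nonneg.2 (Real.sqrt_nonneg l))
    (Real.arcsin_le_pi_div_two _) hs
  rwa [sin_arcsin_sqrt hl] at this

theorem Subextremal.continuousAt_gf (hp : Subextremal p) {l : ℝ} (hl : l ∈ Ioo 0 1) :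
    ContinuousAt (gf p) l := by
  have h := continuousAt_integral_param (g := fun s l => 1 / P p s l) (isOpen_UP p)
    hp.continuousOn_inv_P (x₀ := 0) (x₁ := Real.arcsin (Real.sqrt l)) (y₀ := l)
    (fun s hs => hp.radicand_pos hl (sin_sq_le_of_mem_arcsin (Ioo_subset_Icc_self hl) hs))
  have h2 : ContinuousAt (fun l : ℝ => (Real.arcsin (Real.sqrt l), l)) l :=
    ((Real.continuous_arcsin.comp Real.continuous_sqrt).prodMk continuous_id).continuousAt
  exact (ContinuousAt.comp (f := fun l : ℝ => (Real.arcsin (Real.sqrt l), l)) h h2).neg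

/-- The integrand is at most `1 / (|a| √(l · ell · (1 - l)))` and the interval has length at most
`(π/2) √l`. The powers of `l` cancel, which leaves an integrable singularity at `l = 1`. -/
theorem Subextremal.norm_gf_le (hp : Subextremal p) {l : ℝ} (hl : l ∈ Ioo 0 1) :
    ‖gf p l‖ ≤ Real.pi / 2 / (|p.a| * Real.sqrt (ell p)) * (1 - l) ^ (-(1 / 2) : ℝ) := by
  have hl' : 0 < 1 - l := sub_pos.2 hl.2
  have h1 : 0 < Real.sqrt l := Real.sqrt_pos.2 hl.1
  have h2 : 0 < Real.sqrt (ell p) := Real.sqrt_pos.2 hp.ell_pos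
  have h3 : 0 < Real.sqrt (1 - l) := Real.sqrt_pos.2 hl'
  have ha := hp.abs_a_pos
  -- Jordan's inequality `(2/π) x ≤ sin x` at `x = arcsin √l`.
  have harc : Real.arcsin (Real.sqrt l) ≤ Real.pi / 2 * Real.sqrt l := by
    have h4 := Real.mul_le_sin (Real.arcsin_nonneg.2 h1.le) (Real.arcsin_le_pi_div_two _)
    rw [Real.sin_arcsin (by linarith) (Real.sqrt_le_one.2 hl.2.le)] at h4
    have hpi := Real.pi_pos
    rw [div_mul_eq_mul_div, div_le_iff₀ hpi] at h4
    linarith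
  have hb : ‖∫ s in (0 : ℝ)..Real.arcsin (Real.sqrt l), 1 / P p s l‖ ≤
      1 / (|p.a| * (Real.sqrt l * Real.sqrt (ell p) * Real.sqrt (1 - l))) *
        |Real.arcsin (Real.sqrt l) - 0| := by
    refine intervalIntegral.norm_integral_le_of_norm_le_const fun s hs => ?_
    have h5 := hp.radicand_lower hl.1.le
      (sin_sq_le_of_mem_arcsin (Ioo_subset_Icc_self hl) (uIoc_subset_uIcc hs))
    have h6 := hp.radicand_pos hl
      (sin_sq_le_of_mem_arcsin (Ioo_subset_Icc_self hl) (uIoc_subset_uIcc hs))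
    rw [Real.norm_of_nonneg (by unfold P; positivity)]
    refine one_div_le_one_div_of_le (by positivity) ?_
    unfold P
    rw [← Real.sqrt_mul hl.1.le, ← Real.sqrt_mul (mul_nonneg hl.1.le hp.ell_pos.le)]
    gcongr
  unfold gf
  rw [norm_neg]
  refine hb.trans ?_
  rw [sub_zero, abs_of_nonneg (Real.arcsin_nonneg.2 h1.le), Real.rpow_neg hl'.le,
    ← Real.sqrt_eq_rpow]
  calc _ ≤ 1 / (|p.a| * (Real.sqrt l * Real.sqrt (ell p) * Real.sqrt (1 - l))) *
        (Real.pi / 2 * Real.sqrt l) := by gcongr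
    _ = _ := by field_simp

theorem Subextremal.intervalIntegrable_gf (hp : Subextremal p) :
    IntervalIntegrable (gf p) volume 0 1 := by
  have hb : IntervalIntegrable (fun l : ℝ => Real.pi / 2 / (|p.a| * Real.sqrt (ell p)) *
      (1 - l) ^ (-(1 / 2) : ℝ)) volume 0 1 := by
    refine IntervalIntegrable.const_mul ?_ _
    have := ((intervalIntegral.intervalIntegrable_rpow' (a := 0) (b := 1)
      (r := -(1 / 2)) (by norm_num)).comp_sub_left 1).symm
    simpa using this
  refine IntervalIntegrable.mono_fun' hb ?_ ?_
  · rw [uIoc_of_le zero_le_one, ← restrict_Ioo_eq_restrict_Ioc]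
    exact ContinuousOn.aestronglyMeasurable
      (fun l hl => (hp.continuousAt_gf hl).continuousWithinAt) measurableSet_Ioo
  · rw [uIoc_of_le zero_le_one, ← restrict_Ioo_eq_restrict_Ioc]
    exact (ae_restrict_iff' measurableSet_Ioo).2 (Eventually.of_forall fun l hl => hp.norm_gf_le hl)

/-- Continuity up to `l = 1`, where the bound on `f'` degenerates, is what makes `r⋆` continuous
across the equator. -/
theorem Subextremal.continuousOn_f (hp : Subextremal p) : ContinuousOn (f p) (Icc 0 1) := by
  have h : IntegrableOn (gf p) (uIcc 0 1) := by
    rw [uIcc_of_le zero_le_one, integrableOn_Icc_iff_integrableOn_Ioc,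
      ← intervalIntegrable_iff_integrableOn_Ioc_of_le zero_le_one]
    exact hp.intervalIntegrable_gf
  have := intervalIntegral.continuousOn_primitive_interval h
  rwa [uIcc_of_le zero_le_one] at this

theorem Subextremal.hasDerivAt_f (hp : Subextremal p) {l : ℝ} (hl : l ∈ Ioo 0 1) :
    HasDerivAt (f p) (gf p l) l := by
  refine intervalIntegral.integral_hasDerivAt_right (f := gf p) (a := 0) ?_ ?_
    (hp.continuousAt_gf hl)
  · refine hp.intervalIntegrable_gf.mono_set ?_
    rw [uIcc_of_le zero_le_one, uIcc_of_le hl.1.le]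
    exact Icc_subset_Icc_right hl.2.le
  · exact ContinuousOn.stronglyMeasurableAtFilter isOpen_Ioo
      (fun l hl => (hp.continuousAt_gf hl).continuousWithinAt) l hl

/-! ### The radial part of `ϱ` -/

/-- The integrand `(r² + a² - Q) / Δr` of `ϱ`, with the removable singularities removed. -/
def mq (p : Params) (r τ : ℝ) : ℝ :=
  p.a ^ 2 * Real.sin τ ^ 2 * (1 / (nn p r + Real.sqrt (qq p r τ)))

theorem Subextremal.mq_eq (hp : Subextremal p) {r : ℝ} (hr : r ∈ Ioo p.rm p.rp) (τ : ℝ) :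
    (r ^ 2 + p.a ^ 2 - Q p r (Real.sin τ ^ 2)) / Δr p r = mq p r τ := by
  have h1 := hp.nn_pos r
  have h2 := Real.sqrt_nonneg (qq p r τ)
  have h3 : Real.sqrt (qq p r τ) ^ 2 = qq p r τ :=
    Real.sq_sqrt (hp.qq_pos (Ioo_subset_Icc_self hr) τ).le
  have h4 : nn p r + Real.sqrt (qq p r τ) ≠ 0 := by positivity
  have h5 := (hp.neg r hr).ne
  rw [Q_eq]
  unfold mq
  rw [mul_one_div, div_eq_div_iff h5 h4]
  change (nn p r - Real.sqrt (qq p r τ)) * _ = _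
  have h6 : qq p r τ = nn p r ^ 2 - p.a ^ 2 * Real.sin τ ^ 2 * Δr p r := rfl
  linear_combination -h3 - h6

theorem continuousOn_mq (hp : Subextremal p) :
    ContinuousOn (fun q : ℝ × ℝ => mq p q.1 q.2) (UT p) := by
  have h1 := continuous_qq p
  have h2 : Continuous fun q : ℝ × ℝ => nn p q.1 := (continuous_nn p).comp continuous_fst
  refine ContinuousOn.mul (by fun_prop) (ContinuousOn.div (by fun_prop) (by fun_prop) ?_)
  intro q _
  have := hp.nn_pos q.1
  have := Real.sqrt_nonneg (qq p q.1 q.2)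
  positivity

theorem Subextremal.hasDerivAt_mq (hp : Subextremal p) {r τ : ℝ} (h : 0 < qq p r τ) :
    HasDerivAt (fun τ => mq p r τ) (-(p.a ^ 2 * (Real.sin τ * Real.cos τ)) * gT p r τ) τ := by
  have h1 := hp.nn_pos r
  have h2 := Real.sqrt_pos.2 h
  have h3 : Real.sqrt (qq p r τ) ^ 2 = qq p r τ := Real.sq_sqrt h.le
  have hd := (((Real.hasDerivAt_sin τ).pow 2).const_mul (p.a ^ 2)).mul
    ((hasDerivAt_const τ (1 : ℝ)).div (((hasDerivAt_qq p r τ).sqrt h.ne').const_add (nn p r))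
      (by positivity))
  refine hd.congr_deriv ?_
  have h6 : p.a ^ 2 * Δr p r * Real.sin τ ^ 2 = nn p r ^ 2 - Real.sqrt (qq p r τ) ^ 2 := by
    rw [h3]; unfold qq; ring
  unfold gT
  simp only [Nat.cast_ofNat, Nat.add_one_sub_one, pow_one, Pi.pow_apply, Pi.div_apply]
  set w := Real.sqrt (qq p r τ)
  field_simp
  linear_combination (p.a ^ 2 * Real.cos τ * Real.sin τ) * h6

/-- The radial part of `ϱ`, up to sign. -/
def radial (p : Params) (r τ : ℝ) : ℝ := ∫ s in p.rp..r, mq p s τ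

theorem Subextremal.grad_radial (hp : Subextremal p) {r : ℝ} (hr : r ∈ Icc p.rm p.rp) (τ : ℝ) :
    HasGrad (fun q => radial p q.1 q.2) (mq p r τ)
      (-(p.a ^ 2 * (Real.sin τ * Real.cos τ)) * ellT p r τ) (r, τ) := by
  refine (hasGrad_integral_param (g' := fun s τ => -(p.a ^ 2 * (Real.sin τ * Real.cos τ)) *
    gT p s τ) (isOpen_UT p) (continuousOn_mq hp) (ContinuousOn.mul (by fun_prop) (continuousOn_gT p))
    (fun s t h => hp.hasDerivAt_mq h)
    (fun s hs => hp.qq_pos (hp.uIcc_subset_Icc hr hs) τ)).congr rfl ?_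
  rw [intervalIntegral.integral_const_mul]; rfl

theorem Subextremal.radial_eq (hp : Subextremal p) {r : ℝ} (hr : r ∈ Ioo p.rm p.rp) (τ : ℝ) :
    ∫ s in r..p.rp, (s ^ 2 + p.a ^ 2 - Q p s (Real.sin τ ^ 2)) / Δr p s = -radial p r τ := by
  unfold radial
  rw [← intervalIntegral.integral_symm]
  refine intervalIntegral.integral_congr_ae ?_
  -- At `s = rp` the quotient is a division by zero, so the integrands are compared only off this
  -- point.
  have hne : ∀ᵐ s : ℝ ∂volume, s ≠ p.rp := by
    simp [ae_iff, measure_singleton]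
  filter_upwards [hne] with s hs hs'
  rw [uIoc_of_le hr.2.le] at hs'
  exact hp.mq_eq ⟨hr.1.trans hs'.1, lt_of_le_of_ne hs'.2 hs⟩ τ

/-! ### The angular part of `ϱ` -/

/-- The angular part of `ϱ`. -/
def angular (p : Params) (θ τ : ℝ) : ℝ := ∫ s in (0 : ℝ)..θ, P p s (Real.sin τ ^ 2) / Δθ p s

theorem Subextremal.continuous_angular_integrand (hp : Subextremal p) :
    Continuous fun q : ℝ × ℝ => P p q.1 (Real.sin q.2 ^ 2) / Δθ p q.1 := by
  refine Continuous.div ?_ ((continuous_Δθ p).comp continuous_fst) fun q => ?_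
  · exact (continuous_P p).comp (f := fun q : ℝ × ℝ => (q.1, Real.sin q.2 ^ 2)) (by fun_prop)
  · linarith [hp.one_le_Δθ q.1]

theorem Subextremal.continuous_angular (hp : Subextremal p) :
    Continuous fun q : ℝ × ℝ => angular p q.1 q.2 := by
  refine intervalIntegral.continuous_parametric_intervalIntegral_of_continuous
    (f := fun (q : ℝ × ℝ) s => P p s (Real.sin q.2 ^ 2) / Δθ p s) ?_ continuous_fst
  exact hp.continuous_angular_integrand.comp (f := fun z : (ℝ × ℝ) × ℝ => (z.2, z.1.2))
    (by fun_prop)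

theorem Subextremal.hasDerivAt_angular (hp : Subextremal p) (θ τ : ℝ) :
    HasDerivAt (fun θ => angular p θ τ) (P p θ (Real.sin τ ^ 2) / Δθ p θ) θ := by
  have h : Continuous fun s => P p s (Real.sin τ ^ 2) / Δθ p s :=
    hp.continuous_angular_integrand.comp (f := fun s => (s, τ)) (by fun_prop)
  exact intervalIntegral.integral_hasDerivAt_right (h.intervalIntegrable _ _)
    (h.stronglyMeasurableAtFilter _ _) h.continuousAt

/-- The bound `θ ≤ τ < π/2` keeps the radicand of `P` positive on all of `[0, θ]`. This fails at the
equator, which is why `hasDerivAt_RR_snd` treats `τ = π/2` separately. -/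
theorem Subextremal.grad_angular (hp : Subextremal p) {θ τ : ℝ} (hθ0 : 0 ≤ θ) (hθ : θ ≤ τ)
    (hτ : τ ∈ Ioo 0 (Real.pi / 2)) :
    HasGrad (fun q => angular p q.1 q.2) (P p θ (Real.sin τ ^ 2) / Δθ p θ)
      (p.a ^ 2 * (Real.sin τ * Real.cos τ) * ∫ s in (0 : ℝ)..θ, 1 / P p s (Real.sin τ ^ 2))
      (θ, τ) := by
  have hl : Real.sin τ ^ 2 ∈ Ioo (0 : ℝ) 1 := by
    have h1 : 0 < Real.sin τ := Real.sin_pos_of_pos_of_lt_pi hτ.1 (by linarith [hτ.2, Real.pi_pos])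
    have h2 : 0 < Real.cos τ := Real.cos_pos_of_mem_Ioo ⟨by linarith [hτ.1, Real.pi_pos], hτ.2⟩
    exact ⟨by positivity, by rw [Real.sin_sq]; nlinarith⟩
  have hmap : Continuous fun q : ℝ × ℝ => (q.1, Real.sin q.2 ^ 2) := by fun_prop
  refine (hasGrad_integral_param
    (U := (fun q : ℝ × ℝ => (q.1, Real.sin q.2 ^ 2)) ⁻¹' UP p)
    (g := fun s τ => P p s (Real.sin τ ^ 2) / Δθ p s)
    (g' := fun s τ => p.a ^ 2 * (Real.sin τ * Real.cos τ) * (1 / P p s (Real.sin τ ^ 2)))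
    ((isOpen_UP p).preimage hmap)
    hp.continuous_angular_integrand.continuousOn ?_ ?_ ?_).congr rfl ?_
  · exact ContinuousOn.mul (by fun_prop)
      (hp.continuousOn_inv_P.comp (f := fun q : ℝ × ℝ => (q.1, Real.sin q.2 ^ 2))
        hmap.continuousOn fun q hq => hq)
  · intro s t (h : 0 < Real.sin t ^ 2 * Δθ p s - Real.sin s ^ 2)
    have hΔ : Δθ p s ≠ 0 := by linarith [hp.one_le_Δθ s]
    have hs := Real.sqrt_pos.2 h
    have ha := hp.abs_a_pos
    have hd := (((((((Real.hasDerivAt_sin t).pow 2).mul_const (Δθ p s)).sub_const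
      (Real.sin s ^ 2)).sqrt h.ne').const_mul |p.a|).div_const (Δθ p s))
    refine hd.congr_deriv ?_
    unfold P
    rw [← sq_abs p.a]
    simp only [Nat.cast_ofNat, Nat.add_one_sub_one, pow_one, Pi.pow_apply]
    field_simp
  · intro s hs
    refine hp.radicand_pos hl ?_
    rw [uIcc_of_le hθ0] at hs
    exact sin_sq_le_of_mem_uIcc hτ.1.le hτ.2.le
      (by rw [uIcc_of_le hτ.1.le]; exact ⟨hs.1, hs.2.trans hθ⟩)
  · rw [intervalIntegral.integral_const_mul]

end

end KNdS

namespace KNdS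

open Filter Topology MeasureTheory

noncomputable section

variable {p : Params}

/-! ### `r⋆` as a function of `r` and `τ = θ⋆` -/

/-- `Δθ` at `θ = Th r τ`. -/
def DT (p : Params) (r τ : ℝ) : ℝ := Δθ p (Th p r τ)

/-- `Υ` at `θ = Th r τ`. -/
def UU (p : Params) (r τ : ℝ) : ℝ := Υ p r (Th p r τ)

theorem Subextremal.Pt_sq (hp : Subextremal p) {r τ : ℝ} (hr : r ∈ Icc p.rm p.rp)
    (hτ : τ ∈ Icc 0 Real.pi) :
    Pt p r τ ^ 2 = p.a ^ 2 * (Real.sin τ ^ 2 * DT p r τ - Real.sin (Th p r τ) ^ 2) := by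
  have hd := hp.rd_pos hr τ
  have hsq := hp.rd_sq hr τ
  have hk : sk p (zz p r τ) ^ 2 = Ξ p - zz p r τ ^ 2 := Real.sq_sqrt (sk_sq_pos (hp.zz_mem hr τ)).le
  unfold DT
  rw [Δθ_eq, hp.cos_Th hr, hp.sin_Th hr hτ]
  unfold Pt
  rw [div_pow, div_pow, div_pow, mul_pow, mul_pow, mul_pow, mul_pow, hk, sq_abs, Xi_eq]
  field_simp
  rw [hsq]
  have hs : Real.sin τ ^ 2 = 1 - Real.cos τ ^ 2 := Real.sin_sq τ
  rw [hs]; ring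

theorem Subextremal.P_Th (hp : Subextremal p) {r τ : ℝ} (hr : r ∈ Icc p.rm p.rp)
    (hτ : τ ∈ Icc 0 (Real.pi / 2)) : P p (Th p r τ) (Real.sin τ ^ 2) = Pt p r τ := by
  have hpi := Real.pi_pos
  have hτ' : τ ∈ Icc 0 Real.pi := ⟨hτ.1, by linarith [hτ.2]⟩
  have h0 : 0 ≤ Pt p r τ := by
    have h1 := hp.rd_pos hr τ
    have h2 := sk_pos (hp.zz_mem hr τ)
    have h3 := Real.sin_nonneg_of_mem_Icc hτ'
    have h4 := Real.cos_nonneg_of_mem_Icc (show τ ∈ Icc (-(Real.pi / 2)) (Real.pi / 2) from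
      ⟨by linarith [hτ.1], hτ.2⟩)
    unfold Pt; positivity
  have h := hp.Pt_sq hr hτ'
  unfold P
  rw [← Real.sqrt_sq_eq_abs, ← Real.sqrt_mul (sq_nonneg _)]
  change Real.sqrt (p.a ^ 2 * (Real.sin τ ^ 2 * DT p r τ - Real.sin (Th p r τ) ^ 2)) = _
  rw [← h, Real.sqrt_sq h0]

theorem Subextremal.Qt_sq (hp : Subextremal p) {r : ℝ} (hr : r ∈ Icc p.rm p.rp) (τ : ℝ) :
    Qt p r τ ^ 2 = nn p r ^ 2 - p.a ^ 2 * Real.sin τ ^ 2 * Δr p r :=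
  Real.sq_sqrt (hp.qq_pos hr τ).le

/-- The eikonal identity: the terms in `λ = sin² τ` cancel between `Q² Δθ` and `P² Δr`. -/
theorem Subextremal.UU_eq (hp : Subextremal p) {r τ : ℝ} (hr : r ∈ Icc p.rm p.rp)
    (hτ : τ ∈ Icc 0 Real.pi) :
    UU p r τ = Qt p r τ ^ 2 * DT p r τ + Pt p r τ ^ 2 * Δr p r := by
  rw [hp.Pt_sq hr hτ, hp.Qt_sq hr]
  unfold UU Υ nn DT; ring

theorem Subextremal.nn_sq_le_UU (hp : Subextremal p) {r : ℝ} (hr : r ∈ Icc p.rm p.rp) (τ : ℝ) :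
    nn p r ^ 2 ≤ UU p r τ := by
  have h1 := hp.nonpos hr
  have h2 := hp.one_le_Δθ (Th p r τ)
  have h3 : 0 ≤ p.a ^ 2 * Real.sin (Th p r τ) ^ 2 * (-Δr p r) := by
    have : 0 ≤ -Δr p r := by linarith
    positivity
  have h4 : 0 ≤ nn p r ^ 2 := sq_nonneg _
  have h5 : UU p r τ = nn p r ^ 2 * Δθ p (Th p r τ) -
    p.a ^ 2 * Real.sin (Th p r τ) ^ 2 * Δr p r := rfl
  nlinarith

theorem Subextremal.UU_pos (hp : Subextremal p) {r : ℝ} (hr : r ∈ Icc p.rm p.rp) (τ : ℝ) :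
    0 < UU p r τ := lt_of_lt_of_le (pow_pos (hp.nn_pos r) 2) (hp.nn_sq_le_UU hr τ)

theorem Subextremal.DT_ge (hp : Subextremal p) (r τ : ℝ) : 1 ≤ DT p r τ := hp.one_le_Δθ _

/-- The first integral in `ϱ`. -/
def base (p : Params) (r : ℝ) : ℝ := ∫ s in p.r0..r, (s ^ 2 + p.a ^ 2) / Δr p s

/-- `ϱ` at `θ = Th r τ`, `lam = sin² τ`. -/
def Rn (p : Params) (r τ : ℝ) : ℝ := varrho p r (Th p r τ) (Real.sin τ ^ 2)

/-- The value of `r⋆` at the point with coordinates `r` and `θ⋆ = τ`. -/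
def RR (p : Params) (r τ : ℝ) : ℝ := rStar p r (Th p r τ)

/-- The partial derivative of `RR` with respect to `r`. -/
def RRr (p : Params) (r τ : ℝ) : ℝ := UU p r τ / (Qt p r τ * Δr p r * DT p r τ)

/-- The partial derivative of `RR` with respect to `τ`. -/
def RRt (p : Params) (r τ : ℝ) : ℝ := Pt p r τ * kk p r τ / DT p r τ

theorem Subextremal.Rn_eq (hp : Subextremal p) {r : ℝ} (hr : r ∈ Ioo p.rm p.rp) (τ : ℝ) :
    Rn p r τ = base p r - radial p r τ + angular p (Th p r τ) τ
      + p.a ^ 2 / 2 * f p (Real.sin τ ^ 2) := by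
  unfold Rn varrho
  rw [hp.radial_eq hr]; unfold base angular; ring

theorem Subextremal.hasDerivAt_base (hp : Subextremal p) {r : ℝ} (hr : r ∈ Ioo p.rm p.rp) :
    HasDerivAt (base p) (nn p r / Δr p r) r := by
  have hc : ContinuousOn (fun s => (s ^ 2 + p.a ^ 2) / Δr p s) (Ioo p.rm p.rp) :=
    ContinuousOn.div (by fun_prop) (continuous_Δr p).continuousOn fun s hs => (hp.neg s hs).ne
  have hsub : uIcc p.r0 r ⊆ Ioo p.rm p.rp := (ordConnected_Ioo).uIcc_subset hp.r0_mem hr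
  exact intervalIntegral.integral_hasDerivAt_right (hc.mono hsub).intervalIntegrable
    (hc.stronglyMeasurableAtFilter isOpen_Ioo r hr) (hc.continuousAt (isOpen_Ioo.mem_nhds hr))

theorem Subextremal.RR_eq (hp : Subextremal p) {r τ : ℝ} (hr : r ∈ Icc p.rm p.rp)
    (hτ : τ ∈ Ioo 0 Real.pi) (h : τ ≤ Real.pi / 2) : RR p r τ = Rn p r τ := by
  unfold RR rStar
  rw [if_pos ((hp.Th_le_half_iff hr hτ).2 h), hp.thetaStar_Th hr hτ]; rfl

theorem Subextremal.RR_eq' (hp : Subextremal p) {r τ : ℝ} (hr : r ∈ Icc p.rm p.rp)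
    (hτ : τ ∈ Ioo 0 Real.pi) (h : Real.pi / 2 ≤ τ) : RR p r τ = Rn p r (Real.pi - τ) := by
  rcases eq_or_lt_of_le h with h | h
  · rw [hp.RR_eq hr hτ h.ge, ← h]; congr 1; ring
  · unfold RR rStar
    rw [if_neg (fun h' => absurd ((hp.Th_le_half_iff hr hτ).1 h') (not_le.2 h)), ← Th_pi_sub,
      hp.thetaStar_Th hr ⟨by linarith [hτ.2], by linarith [hτ.1]⟩]; rfl

/-- At fixed `τ` the derivative is `Q/Δr + (P/Δθ)(∂θ/∂r)` with `∂θ/∂r = P/Q`; the eikonal identity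
collects the sum into `Υ / (Q Δr Δθ)`. -/
theorem Subextremal.hasDerivAt_Rn_fst (hp : Subextremal p) {r τ : ℝ} (hr : r ∈ Ioo p.rm p.rp)
    (hτ : τ ∈ Ioc 0 (Real.pi / 2)) : HasDerivAt (fun r => Rn p r τ) (RRr p r τ) r := by
  have hpi := Real.pi_pos
  have hτ' : τ ∈ Ioo 0 Real.pi := ⟨hτ.1, by linarith [hτ.2]⟩
  have hr' := Ioo_subset_Icc_self hr
  have hTh := (hp.grad_Th hr' hτ').hasDerivAt_fst
  have hang := HasDerivAt.comp (h := fun x => Th p x τ) r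
    (hp.hasDerivAt_angular (Th p r τ) τ) hTh
  have hd := (((hp.hasDerivAt_base hr).sub (hp.grad_radial hr' τ).hasDerivAt_fst).add hang).add_const
    (p.a ^ 2 / 2 * f p (Real.sin τ ^ 2))
  have heq : (fun r => Rn p r τ) =ᶠ[𝓝 r] fun r => base p r - radial p r τ + angular p (Th p r τ) τ
      + p.a ^ 2 / 2 * f p (Real.sin τ ^ 2) := by
    filter_upwards [isOpen_Ioo.mem_nhds hr] with x hx
    exact hp.Rn_eq hx τ
  refine (hd.congr_of_eventuallyEq heq).congr_deriv ?_
  rw [hp.P_Th hr' ⟨hτ.1.le, hτ.2⟩, ← hp.mq_eq hr]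
  have h1 := hp.Qt_pos hr' τ
  have h2 := (hp.neg r hr).ne
  have h3 : DT p r τ ≠ 0 := by linarith [hp.DT_ge r τ]
  unfold RRr
  rw [hp.UU_eq hr' (Ioo_subset_Icc_self hτ')]
  change nn p r / Δr p r - (nn p r - Qt p r τ) / Δr p r + Pt p r τ / DT p r τ *
    (Pt p r τ / Qt p r τ) = _
  field_simp
  ring

/-- The explicit `λ`-derivative of `ϱ` is `a²/2` times `∫_r^{rp} 1/Q + ∫_0^θ 1/P + f'(λ)`, which is
`(a²/2) F = 0` because `f'` cancels `∫_0^τ 1/P`. Only the variation of `θ` remains. -/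
theorem Subextremal.hasDerivAt_Rn_snd (hp : Subextremal p) {r τ : ℝ} (hr : r ∈ Ioo p.rm p.rp)
    (hτ : τ ∈ Ioo 0 (Real.pi / 2)) : HasDerivAt (fun τ => Rn p r τ) (RRt p r τ) τ := by
  have hpi := Real.pi_pos
  have hτ' : τ ∈ Ioo 0 Real.pi := ⟨hτ.1, by linarith [hτ.2]⟩
  have hr' := Ioo_subset_Icc_self hr
  have hTm := hp.Th_mem hr' hτ'
  have hTle := hp.Th_le hr' hτ
  have hsin : 0 < Real.sin τ := sin_pos_of_mem hτ'
  have hcos : 0 < Real.cos τ := Real.cos_pos_of_mem_Ioo ⟨by linarith [hτ.1], hτ.2⟩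
  have hl : Real.sin τ ^ 2 ∈ Ioo (0 : ℝ) 1 := ⟨by positivity, by rw [Real.sin_sq]; nlinarith⟩
  have hTh := (hp.grad_Th hr' hτ').hasDerivAt_snd
  have hang : HasDerivAt (fun t => angular p (Th p r t) t) _ τ :=
    HasGrad.hasDerivAt_snd (HasGrad.comp₂ (f := fun q => angular p q.1 q.2)
      (u := fun q => Th p q.1 q.2) (v := fun q => q.2) (q := (r, τ))
      (hp.grad_angular hTm.1.le hTle hτ) (hp.grad_Th hr' hτ') HasGrad.snd)
  have hf : HasDerivAt (fun t => f p (Real.sin t ^ 2)) _ τ :=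
    HasDerivAt.comp (h := fun t => Real.sin t ^ 2) τ (hp.hasDerivAt_f hl)
      ((Real.hasDerivAt_sin τ).pow 2)
  have hd := (((hp.grad_radial hr' τ).hasDerivAt_snd.const_sub (base p r)).add hang).add
    (hf.const_mul (p.a ^ 2 / 2))
  have heq : (fun τ => Rn p r τ) = fun τ => base p r - radial p r τ + angular p (Th p r τ) τ
      + p.a ^ 2 / 2 * f p (Real.sin τ ^ 2) := funext fun t => hp.Rn_eq hr t
  rw [heq]
  refine hd.congr_deriv ?_
  rw [hp.P_Th hr' ⟨hτ.1.le, hτ.2.le⟩]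
  have hF := (hp.F_eq_zero_iff hr' hTm.1 hTle hτ.2).2 rfl
  have hgf : gf p (Real.sin τ ^ 2) = -∫ s in (0 : ℝ)..τ, 1 / P p s (Real.sin τ ^ 2) := by
    unfold gf
    rw [Real.sqrt_sq hsin.le, Real.arcsin_sin (by linarith [hτ.1]) hτ.2.le]
  have hint : ∀ x ∈ Icc 0 τ, IntervalIntegrable (fun s => 1 / P p s (Real.sin τ ^ 2)) volume 0 x := by
    intro x hx
    refine ContinuousOn.intervalIntegrable (hp.continuousOn_inv_P.comp
      (f := fun s => (s, Real.sin τ ^ 2)) (by fun_prop) fun s hs => ?_)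
    rw [uIcc_of_le hx.1] at hs
    refine hp.radicand_pos hl (sin_sq_le_of_mem_uIcc hτ.1.le hτ.2.le ?_)
    rw [uIcc_of_le hτ.1.le]; exact ⟨hs.1, hs.2.trans hx.2⟩
  -- This is `F = 0` with the angular integral split at `θ`.
  have hsum : (∫ s in (0 : ℝ)..τ, 1 / P p s (Real.sin τ ^ 2)) =
      (∫ s in (0 : ℝ)..Th p r τ, 1 / P p s (Real.sin τ ^ 2)) + ellT p r τ := by
    have h1 := intervalIntegral.integral_interval_sub_left (hint (Th p r τ) ⟨hTm.1.le, hTle⟩)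
      (hint τ ⟨hτ.1.le, le_rfl⟩)
    unfold F at hF
    have h2 : (∫ s in r..p.rp, 1 / Q p s (Real.sin τ ^ 2)) = ellT p r τ := by
      unfold ellT
      rw [intervalIntegral.integral_symm p.rp r, ← intervalIntegral.integral_neg]
      simp only [Q_eq, gT]
    rw [h2] at hF
    linarith
  rw [hgf, hsum]
  unfold RRt
  change -(-(p.a ^ 2 * (Real.sin τ * Real.cos τ)) * ellT p r τ) + (Pt p r τ / DT p r τ * kk p r τ +
    _ * 1) + _ = _
  simp only [Nat.cast_ofNat, Nat.add_one_sub_one, pow_one]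
  ring

/-! ### Regularity of the auxiliary functions and differentiability of `RR` -/

/-- Needed because `jj` enters the metric through `kk`, and the Christoffel symbols differentiate
the metric. -/
theorem Subextremal.grad_jj (hp : Subextremal p) {r : ℝ} (hr : r ∈ Icc p.rm p.rp) (τ : ℝ) :
    HasGrad (fun q => jj p q.1 q.2)
      (gA₁ p (zz p r τ) τ * (|p.a| * sk p (zz p r τ) * rd p r τ / Qt p r τ) + gT₁ p r τ)
      (gA₁ p (zz p r τ) τ *
        (Real.sin τ * Real.cos τ * (|p.a| * sk p (zz p r τ) * rd p r τ * jj p r τ)) +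
        3 * Real.sin τ * Real.cos τ * (ellA₂ p (zz p r τ) τ + ellT₂ p r τ)) (r, τ) := by
  have h := HasGrad.comp₂ (f := fun q => ellA₁ p q.1 q.2)
    (u := fun q => zz p q.1 q.2) (v := fun q => q.2) (q := (r, τ))
    (hp.grad_ellA₁ (hp.zz_mem hr τ) τ) (hp.grad_zz hr τ) HasGrad.snd
  exact (h.add (hp.grad_ellT₁ hr τ)).congr (by ring) (by ring)

theorem Subextremal.continuousAt_zz (hp : Subextremal p) {q : ℝ × ℝ} (hr : q.1 ∈ Icc p.rm p.rp) :
    ContinuousAt (fun q : ℝ × ℝ => zz p q.1 q.2) q := (hp.grad_zz hr q.2).continuousAt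

theorem Subextremal.continuousAt_jj (hp : Subextremal p) {q : ℝ × ℝ} (hr : q.1 ∈ Icc p.rm p.rp) :
    ContinuousAt (fun q : ℝ × ℝ => jj p q.1 q.2) q := (hp.grad_jj hr q.2).continuousAt

theorem Subextremal.continuousAt_Th (hp : Subextremal p) {q : ℝ × ℝ} (hr : q.1 ∈ Icc p.rm p.rp)
    (hτ : q.2 ∈ Ioo 0 Real.pi) :
    ContinuousAt (fun q : ℝ × ℝ => Th p q.1 q.2) q := (hp.grad_Th hr hτ).continuousAt

theorem Subextremal.continuousAt_rd (hp : Subextremal p) {q : ℝ × ℝ} (hr : q.1 ∈ Icc p.rm p.rp) :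
    ContinuousAt (fun q : ℝ × ℝ => rd p q.1 q.2) q := by
  have := hp.continuousAt_zz hr
  unfold rd dd; fun_prop

theorem Subextremal.continuousAt_sk (hp : Subextremal p) {q : ℝ × ℝ} (hr : q.1 ∈ Icc p.rm p.rp) :
    ContinuousAt (fun q : ℝ × ℝ => sk p (zz p q.1 q.2)) q :=
  (continuous_sk p).continuousAt.comp (hp.continuousAt_zz hr)

theorem continuous_Qt (p : Params) : Continuous fun q : ℝ × ℝ => Qt p q.1 q.2 :=
  Real.continuous_sqrt.comp (continuous_qq p)

theorem Subextremal.continuousAt_Pt (hp : Subextremal p) {q : ℝ × ℝ} (hr : q.1 ∈ Icc p.rm p.rp) :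
    ContinuousAt (fun q : ℝ × ℝ => Pt p q.1 q.2) q := by
  have h1 := hp.continuousAt_sk hr
  unfold Pt
  exact ContinuousAt.div (by fun_prop) (hp.continuousAt_rd hr) (hp.rd_pos hr _).ne'

theorem Subextremal.continuousAt_kk (hp : Subextremal p) {q : ℝ × ℝ} (hr : q.1 ∈ Icc p.rm p.rp) :
    ContinuousAt (fun q : ℝ × ℝ => kk p q.1 q.2) q := by
  have h1 := hp.continuousAt_sk hr
  have h2 := hp.continuousAt_rd hr
  have h3 := hp.continuousAt_zz hr
  have h4 := hp.continuousAt_jj hr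
  unfold kk
  exact ContinuousAt.div (by fun_prop) (by fun_prop) (pow_pos (hp.rd_pos hr _) 2).ne'

theorem Subextremal.continuousAt_DT (hp : Subextremal p) {q : ℝ × ℝ} (hr : q.1 ∈ Icc p.rm p.rp)
    (hτ : q.2 ∈ Ioo 0 Real.pi) : ContinuousAt (fun q : ℝ × ℝ => DT p q.1 q.2) q := by
  have := hp.continuousAt_Th hr hτ
  unfold DT Δθ; fun_prop

theorem Subextremal.continuousAt_UU (hp : Subextremal p) {q : ℝ × ℝ} (hr : q.1 ∈ Icc p.rm p.rp)
    (hτ : q.2 ∈ Ioo 0 Real.pi) : ContinuousAt (fun q : ℝ × ℝ => UU p q.1 q.2) q := by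
  have := hp.continuousAt_Th hr hτ
  unfold UU Υ Δθ Δr; fun_prop

theorem Subextremal.continuousAt_RRr (hp : Subextremal p) {q : ℝ × ℝ} (hr : q.1 ∈ Ioo p.rm p.rp)
    (hτ : q.2 ∈ Ioo 0 Real.pi) : ContinuousAt (fun q : ℝ × ℝ => RRr p q.1 q.2) q := by
  have hr' := Ioo_subset_Icc_self hr
  have h1 : ContinuousAt (fun q : ℝ × ℝ => Δr p q.1) q :=
    ((continuous_Δr p).comp continuous_fst).continuousAt
  refine ContinuousAt.div (hp.continuousAt_UU hr' hτ)
    (((continuous_Qt p).continuousAt.mul h1).mul (hp.continuousAt_DT hr' hτ)) ?_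
  exact mul_ne_zero (mul_ne_zero (hp.Qt_pos hr' _).ne' (hp.neg _ hr).ne)
    (by linarith [hp.DT_ge q.1 q.2])

theorem Subextremal.continuousAt_RRt (hp : Subextremal p) {q : ℝ × ℝ} (hr : q.1 ∈ Icc p.rm p.rp)
    (hτ : q.2 ∈ Ioo 0 Real.pi) : ContinuousAt (fun q : ℝ × ℝ => RRt p q.1 q.2) q :=
  ((hp.continuousAt_Pt hr).mul (hp.continuousAt_kk hr)).div (hp.continuousAt_DT hr hτ)
    (by linarith [hp.DT_ge q.1 q.2])

theorem rd_pi_sub (p : Params) (r τ : ℝ) : rd p r (Real.pi - τ) = rd p r τ := by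
  unfold rd; rw [zz_pi_sub, dd_pi_sub]

theorem Qt_pi_sub (p : Params) (r τ : ℝ) : Qt p r (Real.pi - τ) = Qt p r τ := by
  unfold Qt qq; rw [Real.sin_pi_sub]

theorem jj_pi_sub (p : Params) (r τ : ℝ) : jj p r (Real.pi - τ) = jj p r τ := by
  unfold jj ellA₁ ellT₁ gA₁ gT₁ qq
  simp only [zz_pi_sub, dd_pi_sub, Real.sin_pi_sub]

theorem DT_pi_sub (p : Params) (r τ : ℝ) : DT p r (Real.pi - τ) = DT p r τ := by
  unfold DT Δθ; rw [Th_pi_sub, Real.cos_pi_sub]; ring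

theorem UU_pi_sub (p : Params) (r τ : ℝ) : UU p r (Real.pi - τ) = UU p r τ := by
  unfold UU Υ Δθ; rw [Th_pi_sub, Real.cos_pi_sub, Real.sin_pi_sub]; ring

theorem RRr_pi_sub (p : Params) (r τ : ℝ) : RRr p r (Real.pi - τ) = RRr p r τ := by
  unfold RRr; rw [UU_pi_sub, DT_pi_sub, Qt_pi_sub]

theorem RRt_pi_sub (p : Params) (r τ : ℝ) : RRt p r (Real.pi - τ) = -RRt p r τ := by
  unfold RRt Pt kk
  rw [DT_pi_sub, rd_pi_sub, zz_pi_sub, jj_pi_sub, Real.cos_pi_sub, Real.sin_pi_sub]; ring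

theorem Subextremal.hasDerivAt_RR_fst (hp : Subextremal p) {r τ : ℝ} (hr : r ∈ Ioo p.rm p.rp)
    (hτ : τ ∈ Ioo 0 Real.pi) : HasDerivAt (fun r => RR p r τ) (RRr p r τ) r := by
  have hnb := isOpen_Ioo.mem_nhds hr
  rcases le_total τ (Real.pi / 2) with h | h
  · refine (hp.hasDerivAt_Rn_fst hr ⟨hτ.1, h⟩).congr_of_eventuallyEq ?_
    filter_upwards [hnb] with x hx
    exact hp.RR_eq (Ioo_subset_Icc_self hx) hτ h
  · rw [← RRr_pi_sub]
    refine (hp.hasDerivAt_Rn_fst hr ⟨by linarith [hτ.2], by linarith⟩).congr_of_eventuallyEq ?_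
    filter_upwards [hnb] with x hx
    exact hp.RR_eq' (Ioo_subset_Icc_self hx) hτ h

theorem Subextremal.continuousAt_Rn_half (hp : Subextremal p) {r : ℝ} (hr : r ∈ Ioo p.rm p.rp) :
    ContinuousAt (fun τ => Rn p r τ) (Real.pi / 2) := by
  have hr' := Ioo_subset_Icc_self hr
  have heq : (fun τ => Rn p r τ) = fun τ => base p r - radial p r τ + angular p (Th p r τ) τ
      + p.a ^ 2 / 2 * f p (Real.sin τ ^ 2) := funext fun t => hp.Rn_eq hr t
  have h1 : ContinuousAt (fun τ => radial p r τ) (Real.pi / 2) :=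
    (hp.grad_radial hr' _).hasDerivAt_snd.continuousAt
  have h2 : Continuous fun τ => angular p (Th p r τ) τ :=
    hp.continuous_angular.comp (f := fun τ => (Th p r τ, τ))
      ((hp.continuous_Th hr').prodMk continuous_id)
  have h3 : Continuous fun τ : ℝ => f p (Real.sin τ ^ 2) :=
    hp.continuousOn_f.comp_continuous (by fun_prop) fun τ => ⟨sq_nonneg _, Real.sin_sq_le_one τ⟩
  rw [heq]
  exact ((continuousAt_const.sub h1).add h2.continuousAt).add
    (h3.continuousAt.const_mul (p.a ^ 2 / 2))

/-- Away from the equator this is `hasDerivAt_Rn_snd` and its reflection. At `τ = π/2` the square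
root in `P` degenerates, and the derivative is obtained as the common one-sided limit of
derivatives, `RR` being continuous there and `RRt` being continuous up to and across the equator. -/
theorem Subextremal.hasDerivAt_RR_snd (hp : Subextremal p) {r τ : ℝ} (hr : r ∈ Ioo p.rm p.rp)
    (hτ : τ ∈ Ioo 0 Real.pi) : HasDerivAt (fun τ => RR p r τ) (RRt p r τ) τ := by
  have hpi := Real.pi_pos
  have hr' := Ioo_subset_Icc_self hr
  have hlt : ∀ τ ∈ Ioo 0 (Real.pi / 2), HasDerivAt (fun τ => RR p r τ) (RRt p r τ) τ := by
    intro τ hτ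
    refine (hp.hasDerivAt_Rn_snd hr hτ).congr_of_eventuallyEq ?_
    filter_upwards [isOpen_Ioo.mem_nhds hτ] with x hx
    exact hp.RR_eq hr' ⟨hx.1, by linarith [hx.2]⟩ hx.2.le
  have hgt : ∀ τ ∈ Ioo (Real.pi / 2) Real.pi,
      HasDerivAt (fun τ => RR p r τ) (RRt p r τ) τ := by
    intro τ hτ
    have hm : Real.pi - τ ∈ Ioo 0 (Real.pi / 2) := ⟨by linarith [hτ.2], by linarith [hτ.1]⟩
    have h := HasDerivAt.comp (h := fun t => Real.pi - t) τ (hp.hasDerivAt_Rn_snd hr hm)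
      ((hasDerivAt_id τ).const_sub Real.pi)
    rw [RRt_pi_sub] at h
    refine (h.congr_of_eventuallyEq ?_).congr_deriv (by ring)
    filter_upwards [isOpen_Ioo.mem_nhds hτ] with x hx
    exact hp.RR_eq' hr' ⟨by linarith [hx.1], hx.2⟩ hx.1.le
  rcases lt_trichotomy τ (Real.pi / 2) with h | h | h
  · exact hlt τ ⟨hτ.1, h⟩
  · subst h
    have hg : ContinuousAt (fun τ => RRt p r τ) (Real.pi / 2) :=
      (hp.continuousAt_RRt (q := (r, Real.pi / 2)) hr' hτ).comp (f := fun τ => (r, τ))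
        (by fun_prop)
    have hcl : ContinuousWithinAt (fun τ => RR p r τ) (Iic (Real.pi / 2)) (Real.pi / 2) := by
      refine (hp.continuousAt_Rn_half hr).continuousWithinAt.congr_of_eventuallyEq ?_
        (hp.RR_eq hr' hτ le_rfl)
      filter_upwards [self_mem_nhdsWithin, mem_nhdsWithin_of_mem_nhds (isOpen_Ioo.mem_nhds hτ)]
        with x hx hx'
      exact hp.RR_eq hr' hx' hx
    have hcr : ContinuousWithinAt (fun τ => RR p r τ) (Ici (Real.pi / 2)) (Real.pi / 2) := by
      have h1 : ContinuousAt (fun τ => Rn p r (Real.pi - τ)) (Real.pi / 2) := by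
        refine ContinuousAt.comp' (f := fun τ => Real.pi - τ) (g := fun τ => Rn p r τ) ?_
          (by fun_prop)
        have : Real.pi - Real.pi / 2 = Real.pi / 2 := by ring
        rw [this]; exact hp.continuousAt_Rn_half hr
      refine h1.continuousWithinAt.congr_of_eventuallyEq ?_ (hp.RR_eq' hr' hτ le_rfl)
      filter_upwards [self_mem_nhdsWithin, mem_nhdsWithin_of_mem_nhds (isOpen_Ioo.mem_nhds hτ)]
        with x hx hx'
      exact hp.RR_eq' hr' hx' hx
    have hl : Ioo 0 (Real.pi / 2) ∈ 𝓝[<] (Real.pi / 2) := Ioo_mem_nhdsLT (by positivity)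
    have hr2 : Ioo (Real.pi / 2) Real.pi ∈ 𝓝[>] (Real.pi / 2) := Ioo_mem_nhdsGT (by linarith)
    have A : HasDerivWithinAt (fun τ => RR p r τ) (RRt p r (Real.pi / 2)) (Iic (Real.pi / 2))
        (Real.pi / 2) := by
      refine hasDerivWithinAt_Iic_of_tendsto_deriv (s := Ioo 0 (Real.pi / 2))
        (fun τ hτ => (hlt τ hτ).differentiableAt.differentiableWithinAt)
        (hcl.mono fun x hx => hx.2.le) hl ?_
      refine (tendsto_nhdsWithin_of_tendsto_nhds hg).congr' ?_
      filter_upwards [hl] with x hx using (hlt x hx).deriv.symm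
    have B : HasDerivWithinAt (fun τ => RR p r τ) (RRt p r (Real.pi / 2)) (Ici (Real.pi / 2))
        (Real.pi / 2) := by
      refine hasDerivWithinAt_Ici_of_tendsto_deriv (s := Ioo (Real.pi / 2) Real.pi)
        (fun τ hτ => (hgt τ hτ).differentiableAt.differentiableWithinAt)
        (hcr.mono fun x hx => hx.1.le) hr2 ?_
      refine (tendsto_nhdsWithin_of_tendsto_nhds hg).congr' ?_
      filter_upwards [hr2] with x hx using (hgt x hx).deriv.symm
    simpa using A.union B
  · exact hgt τ ⟨h, hτ.2⟩

theorem Subextremal.grad_RR (hp : Subextremal p) {r τ : ℝ} (hr : r ∈ Ioo p.rm p.rp)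
    (hτ : τ ∈ Ioo 0 Real.pi) :
    HasGrad (fun q => RR p q.1 q.2) (RRr p r τ) (RRt p r τ) (r, τ) := by
  have hnb : ∀ᶠ v : ℝ × ℝ in 𝓝 (r, τ), v ∈ Ioo p.rm p.rp ×ˢ Ioo 0 Real.pi :=
    (isOpen_Ioo.prod isOpen_Ioo).mem_nhds ⟨hr, hτ⟩
  refine HasGrad.of_partial (q := (r, τ)) (f := RR p) (f₁ := fun q => RRr p q.1 q.2)
    (f₂ := fun q => RRt p q.1 q.2) ?_ ?_ (hp.continuousAt_RRr hr hτ)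
    (hp.continuousAt_RRt (Ioo_subset_Icc_self hr) hτ)
  · filter_upwards [hnb] with v hv using hp.hasDerivAt_RR_fst hv.1 hv.2
  · filter_upwards [hnb] with v hv using hp.hasDerivAt_RR_snd hv.1 hv.2

end

end KNdS

namespace KNdS

open Filter Topology MeasureTheory

noncomputable section

variable {p : Params}

/-! ### The coordinate map is a bijection -/

theorem Subextremal.DT_le (hp : Subextremal p) (r τ : ℝ) : DT p r τ ≤ Ξ p := by
  unfold DT
  rw [Δθ_eq, Xi_eq]
  have := Real.cos_sq_le_one (Th p r τ)
  nlinarith [hp.ell_pos]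

theorem Subextremal.exists_Qt_le (hp : Subextremal p) :
    ∃ C > 0, ∀ r ∈ Icc p.rm p.rp, ∀ τ, Qt p r τ ≤ C := by
  have hc : ContinuousOn (fun r => nn p r ^ 2 + p.a ^ 2 * -Δr p r) (Icc p.rm p.rp) := by
    have h1 := continuous_nn p
    have h2 := continuous_Δr p
    fun_prop
  obtain ⟨C, hC⟩ := isCompact_Icc.exists_bound_of_continuousOn hc
  refine ⟨Real.sqrt C + 1, by positivity, fun r hr τ => ?_⟩
  have h1 := (le_abs_self _).trans (hC r hr)
  have h2 : Qt p r τ ≤ Real.sqrt C := by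
    refine Real.sqrt_le_sqrt (le_trans ?_ h1)
    have h3 : 0 ≤ p.a ^ 2 * -Δr p r := mul_nonneg (sq_nonneg _) (by linarith [hp.nonpos hr])
    have h4 := Real.sin_sq_le_one τ
    unfold qq; nlinarith
  linarith

theorem Subextremal.RRr_bound (hp : Subextremal p) : ∃ c > 0, ∀ r ∈ Ioo p.rm p.rp, ∀ τ,
    RRr p r τ ≤ -(c / (p.rp - r)) ∧ RRr p r τ ≤ -(c / (r - p.rm)) := by
  obtain ⟨C, hC, hΔ⟩ := hp.vanish
  obtain ⟨K, hK, hQ⟩ := hp.exists_Qt_le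
  have hΞ := hp.Xi_gt
  have ha : 0 < p.a ^ 2 := by have := hp.a_ne; positivity
  -- In `RRr` the numerator is at least `a⁴`, while `Qt ≤ K`, `DT ≤ Ξ` and `-Δr` is at most `C`
  -- times the distance to either horizon.
  refine ⟨(p.a ^ 2) ^ 2 / (K * C * Ξ p), by positivity, fun r hr τ => ?_⟩
  have hr' := Ioo_subset_Icc_self hr
  have h1 : (p.a ^ 2) ^ 2 ≤ UU p r τ := by
    refine le_trans ?_ (hp.nn_sq_le_UU hr' τ)
    have : p.a ^ 2 ≤ nn p r := by unfold nn; nlinarith [sq_nonneg r]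
    gcongr
  have h2 := hQ r hr' τ
  have h3 := hp.Qt_pos hr' τ
  have h4 := hp.DT_le r τ
  have h5 := hp.DT_ge r τ
  have h6 : 0 < -Δr p r := by linarith [hp.neg r hr]
  have key : ∀ x, 0 < x → -Δr p r ≤ C * x →
      RRr p r τ ≤ -((p.a ^ 2) ^ 2 / (K * C * Ξ p) / x) := by
    intro x hx hle
    have h7 : RRr p r τ = -(UU p r τ / (Qt p r τ * -Δr p r * DT p r τ)) := by
      unfold RRr; rw [mul_neg, neg_mul, div_neg, neg_neg]
    rw [h7, neg_le_neg_iff, div_div]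
    refine div_le_div₀ (by linarith [sq_nonneg (p.a ^ 2)]) h1 (by positivity) ?_
    calc Qt p r τ * -Δr p r * DT p r τ ≤ K * (C * x) * Ξ p := by gcongr
      _ = _ := by ring
  exact ⟨key _ (sub_pos.2 hr.2) (hΔ r hr).1, key _ (sub_pos.2 hr.1) (hΔ r hr).2⟩

theorem Subextremal.RRr_neg (hp : Subextremal p) {r : ℝ} (hr : r ∈ Ioo p.rm p.rp) (τ : ℝ) :
    RRr p r τ < 0 := by
  obtain ⟨c, hc, h⟩ := hp.RRr_bound
  have h1 := (h r hr τ).1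
  have h2 : 0 < c / (p.rp - r) := div_pos hc (sub_pos.2 hr.2)
  linarith

theorem Subextremal.strictAntiOn_RR (hp : Subextremal p) {τ : ℝ} (hτ : τ ∈ Ioo 0 Real.pi) :
    StrictAntiOn (fun r => RR p r τ) (Ioo p.rm p.rp) := by
  refine strictAntiOn_of_deriv_neg (convex_Ioo _ _)
    (fun r hr => (hp.hasDerivAt_RR_fst hr hτ).continuousAt.continuousWithinAt) fun r hr => ?_
  rw [interior_Ioo] at hr
  rw [(hp.hasDerivAt_RR_fst hr hτ).deriv]
  exact hp.RRr_neg hr τ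

/-- By `RRr_bound`, `RR - c log (rp - r)` is nonincreasing near the event horizon, so `RR` tends to
`-∞` there at least as fast as `c log (rp - r)`. The Cauchy horizon is treated alike in
`exists_le_RR`. -/
theorem Subextremal.exists_RR_le (hp : Subextremal p) {τ : ℝ} (hτ : τ ∈ Ioo 0 Real.pi) (s : ℝ) :
    ∃ r ∈ Ioo p.rm p.rp, RR p r τ ≤ s := by
  obtain ⟨c, hc, hb⟩ := hp.RRr_bound
  obtain ⟨h01, h02⟩ := hp.r0_mem
  have hanti : AntitoneOn (fun r => RR p r τ - c * Real.log (p.rp - r)) (Ico p.r0 p.rp) := by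
    have hd : ∀ r ∈ Ico p.r0 p.rp, HasDerivAt (fun r => RR p r τ - c * Real.log (p.rp - r))
        (RRr p r τ + c / (p.rp - r)) r := by
      intro r hr
      have hx : p.rp - r ≠ 0 := (sub_pos.2 hr.2).ne'
      refine ((hp.hasDerivAt_RR_fst ⟨h01.trans_le hr.1, hr.2⟩ hτ).sub
        ((((hasDerivAt_id r).const_sub p.rp).log hx).const_mul c)).congr_deriv ?_
      simp only [id]; field_simp; ring
    refine antitoneOn_of_deriv_nonpos (convex_Ico _ _)
      (fun r hr => (hd r hr).continuousAt.continuousWithinAt)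
      (fun r hr => (hd r (interior_subset hr)).differentiableAt.differentiableWithinAt)
      fun r hr => ?_
    have hr' := interior_subset hr
    rw [(hd r hr').deriv]
    linarith [(hb r ⟨h01.trans_le hr'.1, hr'.2⟩ τ).1]
  set K := RR p p.r0 τ - c * Real.log (p.rp - p.r0)
  -- The exponential makes `K + c log ε ≤ s`; the other argument of `min` keeps `rp - ε ≥ r0`.
  set ε := min (p.rp - p.r0) (Real.exp ((s - K) / c))
  have hε : 0 < ε := lt_min (sub_pos.2 h02) (Real.exp_pos _)
  have hε1 : ε ≤ p.rp - p.r0 := min_le_left _ _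
  have hlog : Real.log ε ≤ (s - K) / c := by
    rw [Real.log_le_iff_le_exp hε]; exact min_le_right _ _
  refine ⟨p.rp - ε, ⟨by linarith, by linarith⟩, ?_⟩
  have h := hanti (left_mem_Ico.2 h02) (show p.rp - ε ∈ Ico p.r0 p.rp from
    ⟨by linarith, by linarith⟩) (by linarith)
  simp only [sub_sub_cancel] at h
  have h2 : c * Real.log ε ≤ s - K := by
    rw [le_div_iff₀ hc] at hlog; linarith
  linarith

theorem Subextremal.exists_le_RR (hp : Subextremal p) {τ : ℝ} (hτ : τ ∈ Ioo 0 Real.pi) (s : ℝ) :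
    ∃ r ∈ Ioo p.rm p.rp, s ≤ RR p r τ := by
  obtain ⟨c, hc, hb⟩ := hp.RRr_bound
  obtain ⟨h01, h02⟩ := hp.r0_mem
  have hanti : AntitoneOn (fun r => RR p r τ + c * Real.log (r - p.rm)) (Ioc p.rm p.r0) := by
    have hd : ∀ r ∈ Ioc p.rm p.r0, HasDerivAt (fun r => RR p r τ + c * Real.log (r - p.rm))
        (RRr p r τ + c / (r - p.rm)) r := by
      intro r hr
      have hx : r - p.rm ≠ 0 := (sub_pos.2 hr.1).ne'
      refine ((hp.hasDerivAt_RR_fst ⟨hr.1, hr.2.trans_lt h02⟩ hτ).add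
        ((((hasDerivAt_id r).sub_const p.rm).log hx).const_mul c)).congr_deriv ?_
      simp only [id]; field_simp
    refine antitoneOn_of_deriv_nonpos (convex_Ioc _ _)
      (fun r hr => (hd r hr).continuousAt.continuousWithinAt)
      (fun r hr => (hd r (interior_subset hr)).differentiableAt.differentiableWithinAt)
      fun r hr => ?_
    have hr' := interior_subset hr
    rw [(hd r hr').deriv]
    linarith [(hb r ⟨hr'.1, hr'.2.trans_lt h02⟩ τ).2]
  set K := RR p p.r0 τ + c * Real.log (p.r0 - p.rm)
  set ε := min (p.r0 - p.rm) (Real.exp ((K - s) / c))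
  have hε : 0 < ε := lt_min (sub_pos.2 h01) (Real.exp_pos _)
  have hε1 : ε ≤ p.r0 - p.rm := min_le_left _ _
  have hlog : Real.log ε ≤ (K - s) / c := by
    rw [Real.log_le_iff_le_exp hε]; exact min_le_right _ _
  refine ⟨p.rm + ε, ⟨by linarith, by linarith⟩, ?_⟩
  have h := hanti (show p.rm + ε ∈ Ioc p.rm p.r0 from ⟨by linarith, by linarith⟩)
    (right_mem_Ioc.2 h01) (by linarith)
  simp only [add_sub_cancel_left] at h
  have h2 : c * Real.log ε ≤ K - s := by
    rw [le_div_iff₀ hc] at hlog; linarith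
  linarith

theorem Subextremal.exists_RR_eq (hp : Subextremal p) {τ : ℝ} (hτ : τ ∈ Ioo 0 Real.pi) (s : ℝ) :
    ∃ r ∈ Ioo p.rm p.rp, RR p r τ = s := by
  obtain ⟨r₁, h₁, h₁'⟩ := hp.exists_RR_le hτ s
  obtain ⟨r₂, h₂, h₂'⟩ := hp.exists_le_RR hτ s
  have hsub : uIcc r₁ r₂ ⊆ Ioo p.rm p.rp := (ordConnected_Ioo).uIcc_subset h₁ h₂
  have hc : ContinuousOn (fun r => RR p r τ) (uIcc r₁ r₂) := fun r hr =>
    (hp.hasDerivAt_RR_fst (hsub hr) hτ).continuousAt.continuousWithinAt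
  obtain ⟨r, hr, h⟩ := intermediate_value_uIcc hc (mem_uIcc_of_le h₁' h₂')
  exact ⟨r, hsub hr, h⟩

/-- In the intermediate coordinates `(r, τ)` the map is a skew product over `τ`, so its bijectivity
reduces to that of `RR · τ` for each `τ`. -/
theorem Subextremal.starMap_Th (hp : Subextremal p) {r τ : ℝ} (hr : r ∈ Icc p.rm p.rp)
    (hτ : τ ∈ Ioo 0 Real.pi) : starMap p (r, Th p r τ) = (RR p r τ, τ) := by
  unfold starMap
  simp only [hp.thetaStar_Th hr hτ]; rfl

theorem Subextremal.bijOn_starMap (hp : Subextremal p) :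
    BijOn (starMap p) (region p) (univ ×ˢ Ioo 0 Real.pi) := by
  refine ⟨?_, ?_, ?_⟩
  · rintro ⟨r, θ⟩ ⟨hr, hθ⟩
    simp only at hr hθ
    obtain ⟨τ, hτ, rfl⟩ := hp.exists_Th (Ioo_subset_Icc_self hr) hθ
    simp only [hp.starMap_Th (Ioo_subset_Icc_self hr) hτ]
    exact ⟨mem_univ _, hτ⟩
  · rintro ⟨r, θ⟩ ⟨hr, hθ⟩ ⟨r', θ'⟩ ⟨hr', hθ'⟩ h
    simp only at hr hθ hr' hθ'
    obtain ⟨τ, hτ, rfl⟩ := hp.exists_Th (Ioo_subset_Icc_self hr) hθ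
    obtain ⟨τ', hτ', rfl⟩ := hp.exists_Th (Ioo_subset_Icc_self hr') hθ'
    simp only [hp.starMap_Th (Ioo_subset_Icc_self hr) hτ,
      hp.starMap_Th (Ioo_subset_Icc_self hr') hτ', Prod.mk.injEq] at h
    obtain ⟨h1, rfl⟩ := h
    have := (hp.strictAntiOn_RR hτ).injOn hr hr' h1
    subst this; rfl
  · rintro ⟨s, τ⟩ ⟨-, hτ⟩
    obtain ⟨r, hr, h⟩ := hp.exists_RR_eq hτ s
    refine ⟨(r, Th p r τ), ⟨hr, hp.Th_mem (Ioo_subset_Icc_self hr) hτ⟩, ?_⟩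
    rw [hp.starMap_Th (Ioo_subset_Icc_self hr) hτ, h]

/-! ### The inverse coordinate map -/

/-- The range of the coordinates `(r⋆, θ⋆)`. -/
def DD : Set (ℝ × ℝ) := univ ×ˢ Ioo 0 Real.pi

theorem isOpen_DD : IsOpen DD := isOpen_univ.prod isOpen_Ioo

/-- `r` as a function of `(r⋆, θ⋆)`. -/
def rs (p : Params) (q : ℝ × ℝ) : ℝ := (starInv p q).1

theorem Subextremal.starInv_spec (hp : Subextremal p) {q : ℝ × ℝ} (hq : q ∈ DD) :
    rs p q ∈ Ioo p.rm p.rp ∧ RR p (rs p q) q.2 = q.1 ∧ (starInv p q).2 = Th p (rs p q) q.2 := by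
  have h1 := hp.bijOn_starMap.surjOn.mapsTo_invFunOn hq
  have h2 := hp.bijOn_starMap.surjOn.rightInvOn_invFunOn hq
  change starInv p q ∈ region p at h1
  change starMap p (starInv p q) = q at h2
  obtain ⟨τ, hτ, e⟩ := hp.exists_Th (Ioo_subset_Icc_self h1.1) h1.2
  have h3 : starInv p q = (rs p q, Th p (rs p q) τ) := Prod.ext rfl e.symm
  have h4 : rs p q ∈ Ioo p.rm p.rp := h1.1
  rw [h3, hp.starMap_Th (Ioo_subset_Icc_self h4) hτ] at h2
  have h5 : τ = q.2 := congrArg Prod.snd h2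
  subst h5
  exact ⟨h4, congrArg Prod.fst h2, e.symm⟩

theorem Subextremal.rs_RR (hp : Subextremal p) {r τ : ℝ} (hr : r ∈ Ioo p.rm p.rp)
    (hτ : τ ∈ Ioo 0 Real.pi) : rs p (RR p r τ, τ) = r := by
  obtain ⟨h1, h2, -⟩ := hp.starInv_spec (show (RR p r τ, τ) ∈ DD from ⟨mem_univ _, hτ⟩)
  exact (hp.strictAntiOn_RR hτ).injOn h1 hr h2

theorem Subextremal.rs_mem (hp : Subextremal p) {q : ℝ × ℝ} (hq : q ∈ DD) :
    rs p q ∈ Icc p.rm p.rp := Ioo_subset_Icc_self (hp.starInv_spec hq).1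

theorem Subextremal.Δr_rs_neg (hp : Subextremal p) {q : ℝ × ℝ} (hq : q ∈ DD) :
    Δr p (rs p q) < 0 := hp.neg _ (hp.starInv_spec hq).1

/-- The function of `(r⋆, θ⋆)` given by a function of `(r, θ⋆)`. -/
def pull (p : Params) (φ : ℝ → ℝ → ℝ) (q : ℝ × ℝ) : ℝ := φ (rs p q) q.2

/-- Inverse of the skew product `(r, τ) ↦ (RR r τ, τ)`. Both derivatives carry the factor `Δr`,
since `RRr` contains `1/Δr` and `RRt` does not. -/
theorem Subextremal.grad_rs (hp : Subextremal p) {q : ℝ × ℝ} (hq : q ∈ DD) :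
    HasGrad (rs p)
      (Δr p (rs p q) * (pull p (Qt p) q * pull p (DT p) q / pull p (UU p) q))
      (Δr p (rs p q) * -(pull p (Pt p) q * pull p (kk p) q * pull p (Qt p) q / pull p (UU p) q))
      q := by
  obtain ⟨h1, h2, -⟩ := hp.starInv_spec hq
  have h1' := Ioo_subset_Icc_self h1
  have h := HasGrad.local_left_inverse (g := rs p) (hp.grad_RR h1 hq.2) (hp.RRr_neg h1 q.2).ne (by
    filter_upwards [(isOpen_Ioo.prod isOpen_Ioo).mem_nhds
      (show (rs p q, q.2) ∈ Ioo p.rm p.rp ×ˢ Ioo 0 Real.pi from ⟨h1, hq.2⟩)] with v hv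
    exact hp.rs_RR hv.1 hv.2)
  simp only [h2, Prod.mk.eta] at h
  have hQ := hp.Qt_pos h1' q.2
  have hD : DT p (rs p q) q.2 ≠ 0 := by linarith [hp.DT_ge (rs p q) q.2]
  have hU := hp.UU_pos h1' q.2
  have hΔ := (hp.neg _ h1).ne
  refine h.congr ?_ ?_
  · unfold RRr pull; field_simp
  · unfold RRr RRt pull; field_simp

end

end KNdS

namespace KNdS

open Filter Topology MeasureTheory

noncomputable section

/-! ### Functions with controlled derivatives in `(r⋆, θ⋆)` -/

/-- `Δr` as a function of `(r⋆, θ⋆)`. -/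
def delt (p : Params) (q : ℝ × ℝ) : ℝ := Δr p (rs p q)

/-- Boundedness on the range of the coordinates. -/
def Bd (f : ℝ × ℝ → ℝ) : Prop := ∃ C, ∀ q ∈ DD, |f q| ≤ C

theorem Bd.const (c : ℝ) : Bd fun _ => c := ⟨|c|, fun _ _ => le_rfl⟩

theorem Bd.add {f g : ℝ × ℝ → ℝ} (hf : Bd f) (hg : Bd g) : Bd fun q => f q + g q := by
  obtain ⟨C, hC⟩ := hf
  obtain ⟨D, hD⟩ := hg
  exact ⟨C + D, fun q hq => (abs_add_le _ _).trans (add_le_add (hC q hq) (hD q hq))⟩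

theorem Bd.mul {f g : ℝ × ℝ → ℝ} (hf : Bd f) (hg : Bd g) : Bd fun q => f q * g q := by
  obtain ⟨C, hC⟩ := hf
  obtain ⟨D, hD⟩ := hg
  refine ⟨C * D, fun q hq => ?_⟩
  rw [abs_mul]
  exact mul_le_mul (hC q hq) (hD q hq) (abs_nonneg _) ((abs_nonneg _).trans (hC q hq))

theorem Bd.neg {f : ℝ × ℝ → ℝ} (hf : Bd f) : Bd fun q => -f q := by
  obtain ⟨C, hC⟩ := hf
  exact ⟨C, fun q hq => by rw [abs_neg]; exact hC q hq⟩

theorem Bd.congr {f g : ℝ × ℝ → ℝ} (hf : Bd f) (h : EqOn f g DD) : Bd g := by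
  obtain ⟨C, hC⟩ := hf
  exact ⟨C, fun q hq => by rw [← h hq]; exact hC q hq⟩

theorem Bd.sub {f g : ℝ × ℝ → ℝ} (hf : Bd f) (hg : Bd g) : Bd fun q => f q - g q :=
  (hf.add hg.neg).congr fun _ _ => (sub_eq_add_neg _ _).symm

theorem Bd.inv {f : ℝ × ℝ → ℝ} {c : ℝ} (hc : 0 < c) (hf : ∀ q ∈ DD, c ≤ |f q|) :
    Bd fun q => (f q)⁻¹ :=
  ⟨c⁻¹, fun q hq => by rw [abs_inv]; exact inv_anti₀ hc (hf q hq)⟩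

/-- `f` is `C¹` on the range of `(r⋆, θ⋆)`, with gradient `(f₁, f₂)`; it is bounded, `f₁` is
bounded by a multiple of `Δr`, and `f₂` is bounded. -/
structure GoodGrad (p : Params) (f f₁ f₂ : ℝ × ℝ → ℝ) : Prop where
  grad : ∀ q ∈ DD, HasGrad f (f₁ q) (f₂ q) q
  cont₁ : ContinuousOn f₁ DD
  cont₂ : ContinuousOn f₂ DD
  bd : Bd f
  bd₁ : ∃ C, ∀ q ∈ DD, |f₁ q| ≤ C * |delt p q|
  bd₂ : Bd f₂

/-- `f` is `C¹` with derivatives controlled as in `GoodGrad`. -/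
def Good (p : Params) (f : ℝ × ℝ → ℝ) : Prop := ∃ f₁ f₂, GoodGrad p f f₁ f₂

variable {p : Params} {f g : ℝ × ℝ → ℝ}

theorem GoodGrad.continuousOn {f₁ f₂ : ℝ × ℝ → ℝ} (h : GoodGrad p f f₁ f₂) : ContinuousOn f DD :=
  fun q hq => (h.grad q hq).continuousAt.continuousWithinAt

theorem Good.bd (h : Good p f) : Bd f := by
  obtain ⟨f₁, f₂, h⟩ := h; exact h.bd

theorem Good.const (p : Params) (c : ℝ) : Good p fun _ => c :=
  ⟨fun _ => 0, fun _ => 0, fun _ _ => HasGrad.const c, continuousOn_const, continuousOn_const,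
    Bd.const c, ⟨0, fun _ _ => by simp⟩, Bd.const 0⟩

theorem bound_delt_add {f₁ g₁ : ℝ × ℝ → ℝ} (hf : ∃ C, ∀ q ∈ DD, |f₁ q| ≤ C * |delt p q|)
    (hg : ∃ C, ∀ q ∈ DD, |g₁ q| ≤ C * |delt p q|) :
    ∃ C, ∀ q ∈ DD, |f₁ q + g₁ q| ≤ C * |delt p q| := by
  obtain ⟨C, hC⟩ := hf
  obtain ⟨D, hD⟩ := hg
  exact ⟨C + D, fun q hq => (abs_add_le _ _).trans
    (by rw [add_mul]; exact add_le_add (hC q hq) (hD q hq))⟩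

theorem bound_delt_mul {f₁ : ℝ × ℝ → ℝ} (hf : ∃ C, ∀ q ∈ DD, |f₁ q| ≤ C * |delt p q|)
    (hg : Bd g) : ∃ C, ∀ q ∈ DD, |f₁ q * g q| ≤ C * |delt p q| := by
  obtain ⟨C, hC⟩ := hf
  obtain ⟨D, hD⟩ := hg
  refine ⟨C * D, fun q hq => ?_⟩
  rw [abs_mul]
  calc |f₁ q| * |g q| ≤ C * |delt p q| * D :=
        mul_le_mul (hC q hq) (hD q hq) (abs_nonneg _) ((abs_nonneg _).trans (hC q hq))
    _ = _ := by ring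

theorem Good.add (hf : Good p f) (hg : Good p g) : Good p fun q => f q + g q := by
  obtain ⟨f₁, f₂, hf⟩ := hf
  obtain ⟨g₁, g₂, hg⟩ := hg
  exact ⟨fun q => f₁ q + g₁ q, fun q => f₂ q + g₂ q, fun q hq => (hf.grad q hq).add (hg.grad q hq),
    hf.cont₁.add hg.cont₁, hf.cont₂.add hg.cont₂, hf.bd.add hg.bd, bound_delt_add hf.bd₁ hg.bd₁,
    hf.bd₂.add hg.bd₂⟩

theorem Good.mul (hf : Good p f) (hg : Good p g) : Good p fun q => f q * g q := by
  obtain ⟨f₁, f₂, hf⟩ := hf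
  obtain ⟨g₁, g₂, hg⟩ := hg
  refine ⟨fun q => f₁ q * g q + f q * g₁ q, fun q => f₂ q * g q + f q * g₂ q,
    fun q hq => (hf.grad q hq).mul (hg.grad q hq),
    (hf.cont₁.mul hg.continuousOn).add (hf.continuousOn.mul hg.cont₁),
    (hf.cont₂.mul hg.continuousOn).add (hf.continuousOn.mul hg.cont₂), hf.bd.mul hg.bd, ?_,
    (hf.bd₂.mul hg.bd).add (hf.bd.mul hg.bd₂)⟩
  refine bound_delt_add (bound_delt_mul hf.bd₁ hg.bd) ?_
  simpa only [mul_comm] using bound_delt_mul hg.bd₁ hf.bd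

theorem Good.congr (hf : Good p f) (h : EqOn f g DD) : Good p g := by
  obtain ⟨f₁, f₂, hf⟩ := hf
  exact ⟨f₁, f₂, fun q hq => (hf.grad q hq).congr_of_eventuallyEq
    (h.eventuallyEq_of_mem (isOpen_DD.mem_nhds hq)), hf.cont₁, hf.cont₂, hf.bd.congr h, hf.bd₁,
    hf.bd₂⟩

theorem Good.neg (hf : Good p f) : Good p fun q => -f q :=
  ((Good.const p (-1)).mul hf).congr fun q _ => by ring

theorem Good.sub (hf : Good p f) (hg : Good p g) : Good p fun q => f q - g q :=
  (hf.add hg.neg).congr fun q _ => by ring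

theorem Good.pow (hf : Good p f) (n : ℕ) : Good p fun q => f q ^ n := by
  induction n with
  | zero => exact (Good.const p 1).congr fun q _ => by simp
  | succ n ih => exact (ih.mul hf).congr fun q _ => by simp only [pow_succ]

theorem Good.const_mul (c : ℝ) (hf : Good p f) : Good p fun q => c * f q := (Good.const p c).mul hf

/-- Composition with a `C¹` function of one variable. -/
theorem Good.comp {φ : ℝ → ℝ} {V k : Set ℝ} (hf : Good p f) (hV : IsOpen V)
    (hφ : ContDiffOn ℝ 1 φ V) (hk : IsCompact k) (hkV : k ⊆ V) (hfk : MapsTo f DD k) :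
    Good p fun q => φ (f q) := by
  obtain ⟨f₁, f₂, hf⟩ := hf
  have hd : ContinuousOn (deriv φ) V := hφ.continuousOn_deriv_of_isOpen hV le_rfl
  have hdf : ContinuousOn (fun q => deriv φ (f q)) DD :=
    hd.comp hf.continuousOn fun q hq => hkV (hfk hq)
  have hb : ∀ {ψ : ℝ → ℝ}, ContinuousOn ψ V → Bd fun q => ψ (f q) := by
    intro ψ hψ
    obtain ⟨C, hC⟩ := hk.exists_bound_of_continuousOn (hψ.mono hkV)
    exact ⟨C, fun q hq => hC _ (hfk hq)⟩
  refine ⟨fun q => deriv φ (f q) * f₁ q, fun q => deriv φ (f q) * f₂ q, fun q hq => ?_,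
    hdf.mul hf.cont₁, hdf.mul hf.cont₂, hb hφ.continuousOn, ?_, (hb hd).mul hf.bd₂⟩
  · exact HasGrad.comp_deriv ((hφ.contDiffAt (hV.mem_nhds (hkV (hfk hq)))).hasStrictDerivAt
      one_ne_zero) (hf.grad q hq)
  · simpa only [mul_comm] using bound_delt_mul hf.bd₁ (hb hd)

theorem Good.exists_mapsTo_Icc (hf : Good p f) {c : ℝ} (h : ∀ q ∈ DD, c ≤ f q) :
    ∃ C, MapsTo f DD (Icc c C) := by
  obtain ⟨C, hC⟩ := hf.bd
  exact ⟨C, fun q hq => ⟨h q hq, (le_abs_self _).trans (hC q hq)⟩⟩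

theorem Good.inv (hf : Good p f) {c : ℝ} (hc : 0 < c) (h : ∀ q ∈ DD, c ≤ f q) :
    Good p fun q => (f q)⁻¹ := by
  obtain ⟨C, hC⟩ := hf.exists_mapsTo_Icc h
  exact hf.comp isOpen_Ioi (fun x (hx : 0 < x) => (contDiffAt_inv ℝ hx.ne').contDiffWithinAt)
    isCompact_Icc (fun x hx => lt_of_lt_of_le hc hx.1) hC

theorem Good.sqrt (hf : Good p f) {c : ℝ} (hc : 0 < c) (h : ∀ q ∈ DD, c ≤ f q) :
    Good p fun q => Real.sqrt (f q) := by
  obtain ⟨C, hC⟩ := hf.exists_mapsTo_Icc h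
  exact hf.comp (φ := Real.sqrt) isOpen_Ioi
    (fun x (hx : 0 < x) => (Real.contDiffAt_sqrt hx.ne').contDiffWithinAt)
    isCompact_Icc (fun x hx => lt_of_lt_of_le hc hx.1) hC

/-! ### Bounds for the auxiliary functions -/

/-- Continuity is required on the horizons and poles, which are missing from `DD`, so that the
compact rectangle `[rm, rp] × [0, π]` provides the bound. -/
theorem Subextremal.abs_le_of_continuous (hp : Subextremal p) {φ : ℝ → ℝ → ℝ}
    (hφ : ∀ q : ℝ × ℝ, q.1 ∈ Icc p.rm p.rp → ContinuousAt (fun q : ℝ × ℝ => φ q.1 q.2) q) :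
    Bd (pull p φ) := by
  obtain ⟨C, hC⟩ := (isCompact_Icc.prod isCompact_Icc :
    IsCompact (Icc p.rm p.rp ×ˢ Icc 0 Real.pi)).exists_bound_of_continuousOn
    (f := fun q : ℝ × ℝ => φ q.1 q.2) fun q hq => (hφ q hq.1).continuousWithinAt
  exact ⟨C, fun q hq => hC (rs p q, q.2) ⟨hp.rs_mem hq, Ioo_subset_Icc_self hq.2⟩⟩

theorem Subextremal.continuousOn_rs (hp : Subextremal p) : ContinuousOn (rs p) DD :=
  fun _ hq => (hp.grad_rs hq).continuousAt.continuousWithinAt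

theorem Subextremal.continuousOn_pull (hp : Subextremal p) {φ : ℝ → ℝ → ℝ}
    (hφ : ∀ q : ℝ × ℝ, q.1 ∈ Icc p.rm p.rp → q.2 ∈ Ioo 0 Real.pi →
      ContinuousAt (fun q : ℝ × ℝ => φ q.1 q.2) q) : ContinuousOn (pull p φ) DD := by
  intro q hq
  exact ContinuousAt.comp_continuousWithinAt (f := fun x : ℝ × ℝ => (rs p x, x.2))
    (g := fun q : ℝ × ℝ => φ q.1 q.2) (hφ (rs p q, q.2) (hp.rs_mem hq) hq.2)
    ((hp.continuousOn_rs q hq).prodMk continuousWithinAt_snd)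

theorem Subextremal.le_UU (hp : Subextremal p) {r : ℝ} (hr : r ∈ Icc p.rm p.rp) (τ : ℝ) :
    (p.a ^ 2) ^ 2 ≤ UU p r τ := by
  refine le_trans ?_ (hp.nn_sq_le_UU hr τ)
  have : p.a ^ 2 ≤ nn p r := by unfold nn; nlinarith [sq_nonneg r]
  gcongr

theorem Subextremal.a_pow_pos (hp : Subextremal p) : 0 < (p.a ^ 2) ^ 2 := by
  have := hp.a_ne; positivity

theorem Subextremal.bd_inv_UU (hp : Subextremal p) : Bd fun q => (pull p (UU p) q)⁻¹ :=
  Bd.inv hp.a_pow_pos fun q hq => by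
    have := hp.le_UU (hp.rs_mem hq) q.2
    exact this.trans (le_abs_self _)

theorem Subextremal.bd_DT (hp : Subextremal p) : Bd (pull p (DT p)) :=
  ⟨Ξ p, fun q _ => by
    unfold pull
    rw [abs_of_nonneg (by linarith [hp.DT_ge (rs p q) q.2])]; exact hp.DT_le _ _⟩

theorem Subextremal.bd_Qt (hp : Subextremal p) : Bd (pull p (Qt p)) :=
  hp.abs_le_of_continuous fun _ _ => (continuous_Qt p).continuousAt

theorem Subextremal.bd_Pt (hp : Subextremal p) : Bd (pull p (Pt p)) :=
  hp.abs_le_of_continuous fun _ h => hp.continuousAt_Pt h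

theorem Subextremal.bd_kk (hp : Subextremal p) : Bd (pull p (kk p)) :=
  hp.abs_le_of_continuous fun _ h => hp.continuousAt_kk h

/-- The quotient of `∂r/∂r⋆` by `Δr`. -/
def rsq₁ (p : Params) (q : ℝ × ℝ) : ℝ := pull p (Qt p) q * pull p (DT p) q / pull p (UU p) q

/-- The quotient of `∂r/∂θ⋆` by `Δr`. -/
def rsq₂ (p : Params) (q : ℝ × ℝ) : ℝ :=
  -(pull p (Pt p) q * pull p (kk p) q * pull p (Qt p) q / pull p (UU p) q)

theorem Subextremal.continuousOn_UU (hp : Subextremal p) : ContinuousOn (pull p (UU p)) DD :=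
  hp.continuousOn_pull fun _ h h' => hp.continuousAt_UU h h'

theorem Subextremal.UU_ne (hp : Subextremal p) {q : ℝ × ℝ} (hq : q ∈ DD) :
    pull p (UU p) q ≠ 0 := (hp.UU_pos (hp.rs_mem hq) q.2).ne'

theorem Subextremal.continuousOn_rsq₁ (hp : Subextremal p) : ContinuousOn (rsq₁ p) DD :=
  ((hp.continuousOn_pull fun _ _ _ => (continuous_Qt p).continuousAt).mul
    (hp.continuousOn_pull fun _ h h' => hp.continuousAt_DT h h')).div hp.continuousOn_UU
    fun _ hq => hp.UU_ne hq

theorem Subextremal.continuousOn_rsq₂ (hp : Subextremal p) : ContinuousOn (rsq₂ p) DD :=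
  ((((hp.continuousOn_pull fun _ h _ => hp.continuousAt_Pt h).mul
    (hp.continuousOn_pull fun _ h _ => hp.continuousAt_kk h)).mul
    (hp.continuousOn_pull fun _ _ _ => (continuous_Qt p).continuousAt)).div hp.continuousOn_UU
    fun _ hq => hp.UU_ne hq).neg

theorem Subextremal.bd_rsq₁ (hp : Subextremal p) : Bd (rsq₁ p) :=
  ((hp.bd_Qt.mul hp.bd_DT).mul hp.bd_inv_UU).congr fun _ _ => (div_eq_mul_inv _ _).symm

theorem Subextremal.bd_rsq₂ (hp : Subextremal p) : Bd (rsq₂ p) :=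
  (((hp.bd_Pt.mul hp.bd_kk).mul hp.bd_Qt).mul hp.bd_inv_UU).neg.congr
    fun _ _ => by simp only [rsq₂, div_eq_mul_inv]

theorem continuousOn_delt (hp : Subextremal p) : ContinuousOn (delt p) DD :=
  (continuous_Δr p).comp_continuousOn hp.continuousOn_rs

theorem Subextremal.bd_delt (hp : Subextremal p) : Bd (delt p) :=
  hp.abs_le_of_continuous (φ := fun r _ => Δr p r) fun _ _ =>
    ((continuous_Δr p).comp continuous_fst).continuousAt

/-- A `C¹` function of `(r, θ⋆)` is well behaved as a function of `(r⋆, θ⋆)`. -/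
theorem Subextremal.good_pull (hp : Subextremal p) {φ φ₁ φ₂ : ℝ → ℝ → ℝ}
    (hφ : ∀ r ∈ Icc p.rm p.rp, ∀ τ, HasGrad (fun q => φ q.1 q.2) (φ₁ r τ) (φ₂ r τ) (r, τ))
    (h₁ : ∀ q : ℝ × ℝ, q.1 ∈ Icc p.rm p.rp → ContinuousAt (fun q : ℝ × ℝ => φ₁ q.1 q.2) q)
    (h₂ : ∀ q : ℝ × ℝ, q.1 ∈ Icc p.rm p.rp → ContinuousAt (fun q : ℝ × ℝ => φ₂ q.1 q.2) q) :
    Good p (pull p φ) := by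
  have c₁ := hp.continuousOn_pull fun q h _ => h₁ q h
  have c₂ := hp.continuousOn_pull fun q h _ => h₂ q h
  have b₁ := hp.abs_le_of_continuous h₁
  have b₂ := hp.abs_le_of_continuous h₂
  refine ⟨fun q => pull p φ₁ q * (delt p q * rsq₁ p q),
    fun q => pull p φ₁ q * (delt p q * rsq₂ p q) + pull p φ₂ q, fun q hq => ?_,
    c₁.mul ((continuousOn_delt hp).mul hp.continuousOn_rsq₁),
    (c₁.mul ((continuousOn_delt hp).mul hp.continuousOn_rsq₂)).add c₂,
    hp.abs_le_of_continuous fun q h => (hφ q.1 h q.2).continuousAt, ?_,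
    (b₁.mul (hp.bd_delt.mul hp.bd_rsq₂)).add b₂⟩
  · exact (HasGrad.comp₂ (f := fun q => φ q.1 q.2) (u := rs p) (v := fun q => q.2)
      (hφ _ (hp.rs_mem hq) q.2) (hp.grad_rs hq) HasGrad.snd).congr
      (by unfold pull delt rsq₁; simp only [mul_zero, add_zero]; rfl)
      (by unfold pull delt rsq₂; simp only [mul_one]; rfl)
  · have h : ∃ C, ∀ q ∈ DD, |delt p q| ≤ C * |delt p q| := ⟨1, fun q _ => by rw [one_mul]⟩
    have := bound_delt_mul (bound_delt_mul h hp.bd_rsq₁) b₁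
    simpa only [mul_comm] using this

theorem Subextremal.good_rs (hp : Subextremal p) : Good p (rs p) :=
  hp.good_pull (φ := fun r _ => r) (φ₁ := fun _ _ => 1) (φ₂ := fun _ _ => 0)
    (fun _ _ _ => HasGrad.fst) (fun _ _ => continuousAt_const) (fun _ _ => continuousAt_const)

theorem Subextremal.good_sin (hp : Subextremal p) : Good p fun q => Real.sin q.2 :=
  hp.good_pull (φ := fun _ τ => Real.sin τ) (φ₁ := fun _ _ => 0) (φ₂ := fun _ τ => Real.cos τ)
    (fun r _ τ => (HasGrad.comp_deriv (q := (r, τ)) (Real.hasStrictDerivAt_sin τ)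
      HasGrad.snd).congr (by ring) (by ring)) (fun _ _ => continuousAt_const)
    (fun _ _ => by fun_prop)

theorem Subextremal.good_cos (hp : Subextremal p) : Good p fun q => Real.cos q.2 :=
  hp.good_pull (φ := fun _ τ => Real.cos τ) (φ₁ := fun _ _ => 0) (φ₂ := fun _ τ => -Real.sin τ)
    (fun r _ τ => (HasGrad.comp_deriv (q := (r, τ)) (Real.hasStrictDerivAt_cos τ)
      HasGrad.snd).congr (by ring) (by ring)) (fun _ _ => continuousAt_const)
    (fun _ _ => by fun_prop)

theorem Subextremal.good_zz (hp : Subextremal p) : Good p (pull p (zz p)) := by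
  refine hp.good_pull (fun r hr τ => hp.grad_zz hr τ) (fun q h => ?_) (fun q h => ?_)
  · have h1 := hp.continuousAt_sk h
    have h2 := hp.continuousAt_rd h
    exact ContinuousAt.div (by fun_prop) (continuous_Qt p).continuousAt (hp.Qt_pos h _).ne'
  · have h1 := hp.continuousAt_sk h
    have h2 := hp.continuousAt_rd h
    have h3 := hp.continuousAt_jj h
    fun_prop

theorem Subextremal.good_jj (hp : Subextremal p) : Good p (pull p (jj p)) := by
  have hA : ∀ q : ℝ × ℝ, q.1 ∈ Icc p.rm p.rp →
      ContinuousAt (fun q : ℝ × ℝ => gA₁ p (zz p q.1 q.2) q.2) q := fun q h =>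
    ContinuousAt.comp (f := fun q : ℝ × ℝ => (zz p q.1 q.2, q.2))
      (g := fun q : ℝ × ℝ => gA₁ p q.1 q.2)
      (hp.continuousOn_gA₁.continuousAt ((isOpen_UA p).mem_nhds ⟨hp.zz_mem h _, mem_univ _⟩))
      ((hp.continuousAt_zz h).prodMk continuousAt_snd)
  refine hp.good_pull (fun r hr τ => hp.grad_jj hr τ) (fun q h => ?_) (fun q h => ?_)
  · have h1 := hp.continuousAt_sk h
    have h2 := hp.continuousAt_rd h
    refine ContinuousAt.add ((hA q h).mul (ContinuousAt.div (by fun_prop)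
      (continuous_Qt p).continuousAt (hp.Qt_pos h _).ne')) ?_
    exact (continuousOn_gT₁ p).continuousAt ((isOpen_UT p).mem_nhds (hp.qq_pos h _))
  · have h1 := hp.continuousAt_sk h
    have h2 := hp.continuousAt_rd h
    have h3 := hp.continuousAt_jj h
    have h4 := hA q h
    have h5 : ContinuousAt (fun q : ℝ × ℝ => ellA₂ p (zz p q.1 q.2) q.2) q :=
      ContinuousAt.comp (f := fun q : ℝ × ℝ => (zz p q.1 q.2, q.2))
        (g := fun q : ℝ × ℝ => ellA₂ p q.1 q.2) (hp.continuousAt_ellA₂ (hp.zz_mem h _) q.2)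
        ((hp.continuousAt_zz h).prodMk continuousAt_snd)
    have h6 : ContinuousAt (fun q : ℝ × ℝ => ellT₂ p q.1 q.2) q := hp.continuousAt_ellT₂ h q.2
    fun_prop

theorem Subextremal.good_delt (hp : Subextremal p) : Good p (delt p) :=
  hp.good_rs.comp (φ := Δr p) isOpen_univ (by unfold Δr; fun_prop) isCompact_Icc (subset_univ _)
    fun _ hq => hp.rs_mem hq

theorem Subextremal.zz_bounds (hp : Subextremal p) {q : ℝ × ℝ} (hq : q ∈ DD) :
    zmin p ≤ pull p (zz p) q ∧ pull p (zz p) q ≤ 1 := (hp.zz_spec (hp.rs_mem hq) q.2).1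

theorem Subextremal.good_rd (hp : Subextremal p) : Good p (pull p (rd p)) := by
  refine Good.sqrt (f := fun q => dd (pull p (zz p) q) q.2)
    ((hp.good_cos.pow 2).add ((hp.good_zz.pow 2).mul (hp.good_sin.pow 2)))
    (pow_pos hp.zmin_pos 2) fun q hq => ?_
  obtain ⟨h1, h2⟩ := hp.zz_bounds hq
  have h0 := hp.zmin_pos
  exact le_trans (by gcongr) (sq_le_dd (h0.le.trans h1) h2 q.2)

theorem Subextremal.zmin_le_rd (hp : Subextremal p) {q : ℝ × ℝ} (hq : q ∈ DD) :
    zmin p ≤ pull p (rd p) q := by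
  obtain ⟨h1, h2⟩ := hp.zz_bounds hq
  have h0 := hp.zmin_pos
  exact Real.le_sqrt_of_sq_le (le_trans (by gcongr) (sq_le_dd (h0.le.trans h1) h2 q.2))

theorem Subextremal.good_inv_rd (hp : Subextremal p) : Good p fun q => (pull p (rd p) q)⁻¹ :=
  hp.good_rd.inv hp.zmin_pos fun _ hq => hp.zmin_le_rd hq

theorem Subextremal.good_sk (hp : Subextremal p) : Good p fun q => sk p (pull p (zz p) q) := by
  refine Good.sqrt (f := fun q => Ξ p - pull p (zz p) q ^ 2)
    ((Good.const p _).sub (hp.good_zz.pow 2)) hp.ell_pos fun q hq => ?_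
  obtain ⟨h1, h2⟩ := hp.zz_bounds hq
  have := pow_le_one₀ (n := 2) (hp.zmin_pos.le.trans h1) h2
  rw [Xi_eq]; linarith

/-- `cos θ` as a function of `(r⋆, θ⋆)`. -/
def cT (p : Params) (q : ℝ × ℝ) : ℝ := Real.cos q.2 * (pull p (rd p) q)⁻¹

/-- `sin θ / sin θ⋆` as a function of `(r⋆, θ⋆)`. -/
def sT (p : Params) (q : ℝ × ℝ) : ℝ := pull p (zz p) q * (pull p (rd p) q)⁻¹

/-- The gradient of `Th` is available only off the axis. Uniform control near the poles therefore
goes through `cos θ` and `sin θ / sin θ⋆`, which are built from `zz` and regular there. -/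
theorem Subextremal.good_cT (hp : Subextremal p) : Good p (cT p) := hp.good_cos.mul hp.good_inv_rd

theorem Subextremal.good_sT (hp : Subextremal p) : Good p (sT p) := hp.good_zz.mul hp.good_inv_rd

theorem Subextremal.cos_Th_pull (hp : Subextremal p) {q : ℝ × ℝ} (hq : q ∈ DD) :
    Real.cos (pull p (Th p) q) = cT p q := hp.cos_Th (hp.rs_mem hq) q.2

theorem Subextremal.sin_Th_pull (hp : Subextremal p) {q : ℝ × ℝ} (hq : q ∈ DD) :
    Real.sin (pull p (Th p) q) = sT p q * Real.sin q.2 := by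
  unfold sT
  rw [mul_right_comm]
  exact hp.sin_Th (hp.rs_mem hq) (Ioo_subset_Icc_self hq.2)

theorem Subextremal.good_nn (hp : Subextremal p) : Good p fun q => nn p (rs p q) :=
  (hp.good_rs.pow 2).add (Good.const p _)

theorem Subextremal.good_DT (hp : Subextremal p) : Good p (pull p (DT p)) :=
  ((Good.const p 1).add ((hp.good_cT.pow 2).const_mul (ell p))).congr fun q hq => by
    simp only [← hp.cos_Th_pull hq]; rfl

theorem Subextremal.good_Qt (hp : Subextremal p) : Good p (pull p (Qt p)) := by
  refine Good.sqrt (f := fun q => qq p (rs p q) q.2) ((hp.good_nn.pow 2).sub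
    (((hp.good_sin.pow 2).const_mul (p.a ^ 2)).mul hp.good_delt)) hp.a_pow_pos fun q hq => ?_
  refine le_trans ?_ (hp.nn_sq_le_qq (hp.rs_mem hq) q.2)
  have : p.a ^ 2 ≤ nn p (rs p q) := by unfold nn; nlinarith [sq_nonneg (rs p q)]
  gcongr

theorem Subextremal.good_UU (hp : Subextremal p) : Good p (pull p (UU p)) :=
  (((hp.good_nn.pow 2).mul hp.good_DT).sub
    ((((hp.good_sT.mul hp.good_sin).pow 2).const_mul (p.a ^ 2)).mul hp.good_delt)).congr
    fun q hq => by simp only [← hp.sin_Th_pull hq]; rfl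

theorem Subextremal.good_inv_UU (hp : Subextremal p) : Good p fun q => (pull p (UU p) q)⁻¹ :=
  hp.good_UU.inv hp.a_pow_pos fun q hq => hp.le_UU (hp.rs_mem hq) q.2

/-- `P / sin θ⋆` as a function of `(r⋆, θ⋆)`. -/
def pT (p : Params) (q : ℝ × ℝ) : ℝ :=
  |p.a| * Real.cos q.2 * sk p (pull p (zz p) q) * (pull p (rd p) q)⁻¹

theorem Pt_eq_pT (p : Params) (q : ℝ × ℝ) : pull p (Pt p) q = Real.sin q.2 * pT p q := by
  unfold pull Pt pT pull; rw [div_eq_mul_inv]; ring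

theorem Subextremal.good_pT (hp : Subextremal p) : Good p (pT p) :=
  ((hp.good_cos.const_mul |p.a|).mul hp.good_sk).mul hp.good_inv_rd

theorem Subextremal.good_kk (hp : Subextremal p) : Good p (pull p (kk p)) :=
  ((hp.good_zz.add (((hp.good_sin.mul hp.good_cos).pow 2).mul
    (((hp.good_sk.const_mul |p.a|).mul hp.good_rd).mul hp.good_jj))).mul
    (hp.good_inv_rd.pow 2)).congr fun q _ => by
      simp only [pull, kk, div_eq_mul_inv, inv_pow]

end

end KNdS

namespace KNdS

open Filter Topology MeasureTheory

noncomputable section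

/-! ### The frame-dragging coefficient and the function `h` -/

/-- The derivative of `Δr`. -/
def Δr' (p : Params) (r : ℝ) : ℝ :=
  2 * r * (1 - p.Λ / 3 * r ^ 2) - (r ^ 2 + p.a ^ 2) * (p.Λ / 3 * (2 * r)) - 2 * p.M

theorem hasStrictDerivAt_Δr (p : Params) (r : ℝ) : HasStrictDerivAt (Δr p) (Δr' p r) r := by
  have h2 : HasStrictDerivAt (fun x : ℝ => x ^ 2) (2 * r) r := by
    simpa using hasStrictDerivAt_pow 2 r
  have h1 := hasStrictDerivAt_id r
  refine (((h2.add_const (p.a ^ 2)).mul ((h2.const_mul (p.Λ / 3)).const_sub 1)).sub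
    (h1.const_mul (2 * p.M))).add_const (p.e ^ 2) |>.congr_deriv ?_
  unfold Δr'; ring

variable {p : Params}

/-- The partial derivative of `B` in `r`. -/
def Br (p : Params) (r θ : ℝ) : ℝ :=
  Ξ p * p.a * ((2 * r * Δθ p θ - Δr' p r) * Υ p r θ - (nn p r * Δθ p θ - Δr p r) *
    (4 * r * nn p r * Δθ p θ - p.a ^ 2 * Real.sin θ ^ 2 * Δr' p r)) / Υ p r θ ^ 2

/-- The partial derivative of `B` in `θ`. -/
def Bθ (p : Params) (r θ : ℝ) : ℝ :=
  2 * Real.sin θ * Real.cos θ * Δr p r * (Ξ p * p.a * (p.a ^ 2 * nn p r * Ξ p -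
    nn p r ^ 2 * ell p - p.a ^ 2 * Δr p r)) / Υ p r θ ^ 2

theorem grad_Δr (p : Params) (q : ℝ × ℝ) : HasGrad (fun q => Δr p q.1) (Δr' p q.1) 0 q :=
  (HasGrad.comp_deriv (q := q) (hasStrictDerivAt_Δr p q.1) HasGrad.fst).congr (by ring) (by ring)

theorem grad_nn (p : Params) (q : ℝ × ℝ) : HasGrad (fun q => nn p q.1) (2 * q.1) 0 q := by
  have h : HasStrictDerivAt (nn p) (2 * q.1) q.1 :=
    ((hasStrictDerivAt_pow 2 q.1).add_const (p.a ^ 2)).congr_deriv (by simp)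
  exact (HasGrad.comp_deriv (q := q) h HasGrad.fst).congr (by ring) (by ring)

theorem grad_Δθ (p : Params) (q : ℝ × ℝ) : HasGrad (fun q => Δθ p q.2) 0
    (-(2 * ell p * Real.cos q.2 * Real.sin q.2)) q := by
  have h : HasStrictDerivAt (Δθ p) (-(2 * ell p * Real.cos q.2 * Real.sin q.2)) q.2 := by
    refine ((((Real.hasStrictDerivAt_cos q.2).pow 2).const_mul (ell p)).const_add 1).congr_deriv ?_
    simp only [Nat.cast_ofNat]; ring
  exact (HasGrad.comp_deriv (q := q) h HasGrad.snd).congr (by ring) (by ring)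

theorem grad_sin_sq (q : ℝ × ℝ) : HasGrad (fun q => Real.sin q.2 ^ 2) 0
    (2 * Real.sin q.2 * Real.cos q.2) q := by
  have h : HasStrictDerivAt (fun θ => Real.sin θ ^ 2) (2 * Real.sin q.2 * Real.cos q.2) q.2 := by
    refine ((Real.hasStrictDerivAt_sin q.2).pow 2).congr_deriv ?_
    simp only [Nat.cast_ofNat]; ring
  exact (HasGrad.comp_deriv (q := q) h HasGrad.snd).congr (by ring) (by ring)

theorem grad_Υ (p : Params) (q : ℝ × ℝ) : HasGrad (fun q => Υ p q.1 q.2)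
    (4 * q.1 * nn p q.1 * Δθ p q.2 - p.a ^ 2 * Real.sin q.2 ^ 2 * Δr' p q.1)
    (-(2 * Real.sin q.2 * Real.cos q.2 * (nn p q.1 ^ 2 * ell p + p.a ^ 2 * Δr p q.1))) q := by
  refine (((((grad_nn p q).mul (grad_nn p q)).mul (grad_Δθ p q)).sub
    (((HasGrad.const (p.a ^ 2)).mul (grad_sin_sq q)).mul (grad_Δr p q))).congr_of_eventuallyEq
    (Eventually.of_forall fun x => ?_)).congr ?_ ?_
  · simp only [Υ, nn]; ring
  · ring
  · ring

/-- The `θ`-derivative carries the factor `Δr`: on a horizon `Υ = (r² + a²)² Δθ`, and `B = Ξ a / (r²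
+ a²)` is constant in `θ`. -/
theorem grad_B {q : ℝ × ℝ} (hU : Υ p q.1 q.2 ≠ 0) :
    HasGrad (fun q => B p q.1 q.2) (Br p q.1 q.2) (Bθ p q.1 q.2) q := by
  refine (((HasGrad.const (Ξ p * p.a)).mul (((grad_nn p q).mul (grad_Δθ p q)).sub (grad_Δr p q))).mul
    (HasGrad.comp_deriv (q := q) (f := fun q => Υ p q.1 q.2) (φ := fun x => x⁻¹)
      (hasStrictDerivAt_inv hU) (grad_Υ p q)) |>.congr_of_eventuallyEq
    (Eventually.of_forall fun x => ?_)).congr ?_ ?_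
  · simp only [B, nn, div_eq_mul_inv]
  · unfold Br; field_simp; ring
  · have h1 : Υ p q.1 q.2 = nn p q.1 ^ 2 * Δθ p q.2 - p.a ^ 2 * Real.sin q.2 ^ 2 * Δr p q.1 := rfl
    have h2 : Δθ p q.2 = Ξ p - ell p * Real.sin q.2 ^ 2 := by
      rw [Δθ_eq, Xi_eq, Real.sin_sq]; ring
    unfold Bθ; field_simp; rw [h1, h2, Xi_eq]; ring

/-- `B` as a function of `(r⋆, θ⋆)`. -/
def bet (p : Params) (q : ℝ × ℝ) : ℝ := B p (starInv p q).1 (starInv p q).2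

theorem Subextremal.bet_eq (hp : Subextremal p) {q : ℝ × ℝ} (hq : q ∈ DD) :
    bet p q = B p (rs p q) (pull p (Th p) q) := by
  unfold bet; rw [(hp.starInv_spec hq).2.2]; rfl

theorem Subextremal.bet_eq' (hp : Subextremal p) {q : ℝ × ℝ} (hq : q ∈ DD) :
    bet p q = Ξ p * p.a * (nn p (rs p q) * pull p (DT p) q - delt p q) * (pull p (UU p) q)⁻¹ := by
  rw [hp.bet_eq hq, B, div_eq_mul_inv]; rfl

theorem Subextremal.good_bet (hp : Subextremal p) : Good p (bet p) :=
  ((((hp.good_nn.mul hp.good_DT).sub hp.good_delt).const_mul (Ξ p * p.a)).mul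
    hp.good_inv_UU).congr fun _ hq => (hp.bet_eq' hq).symm

theorem Subextremal.grad_theta (hp : Subextremal p) {q : ℝ × ℝ} (hq : q ∈ DD) :
    HasGrad (pull p (Th p)) (pull p (Pt p) q * delt p q * pull p (DT p) q / pull p (UU p) q)
      (pull p (kk p) q * pull p (Qt p) q ^ 2 * pull p (DT p) q / pull p (UU p) q) q := by
  have hr := hp.rs_mem hq
  have hU := hp.UU_ne hq
  have hQ : pull p (Qt p) q ≠ 0 := (hp.Qt_pos hr _).ne'
  have hUU : pull p (UU p) q = pull p (Qt p) q ^ 2 * pull p (DT p) q +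
    pull p (Pt p) q ^ 2 * delt p q := hp.UU_eq hr (Ioo_subset_Icc_self hq.2)
  have h := HasGrad.comp₂ (f := fun q => Th p q.1 q.2) (u := rs p) (v := fun q => q.2) (q := q)
    (hp.grad_Th hr hq.2) (hp.grad_rs hq) HasGrad.snd
  refine HasGrad.congr (f := pull p (Th p)) h ?_ ?_
  · unfold pull delt at *; field_simp; ring
  · unfold pull delt at *; field_simp; rw [hUU]; ring

/-- `∂B/∂θ⋆ = sin θ⋆ · Δr · bq`. -/
def bq (p : Params) (q : ℝ × ℝ) : ℝ :=
  Ξ p * p.a * ((2 * rs p q * pull p (DT p) q - Δr' p (rs p q)) * pull p (UU p) q -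
      (nn p (rs p q) * pull p (DT p) q - delt p q) *
      (4 * rs p q * nn p (rs p q) * pull p (DT p) q -
        p.a ^ 2 * (sT p q * Real.sin q.2) ^ 2 * Δr' p (rs p q))) * (pull p (UU p) q)⁻¹ ^ 2 *
      -(pT p q * pull p (kk p) q * pull p (Qt p) q * (pull p (UU p) q)⁻¹) +
    2 * sT p q * cT p q * (Ξ p * p.a * (p.a ^ 2 * nn p (rs p q) * Ξ p -
      nn p (rs p q) ^ 2 * ell p - p.a ^ 2 * delt p q)) * (pull p (UU p) q)⁻¹ ^ 2 *
      (pull p (kk p) q * pull p (Qt p) q ^ 2 * pull p (DT p) q * (pull p (UU p) q)⁻¹)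

theorem Subextremal.good_Δr' (hp : Subextremal p) : Good p fun q => Δr' p (rs p q) :=
  hp.good_rs.comp (φ := Δr' p) isOpen_univ (by unfold Δr'; fun_prop) isCompact_Icc (subset_univ _)
    fun _ hq => hp.rs_mem hq

theorem Subextremal.good_bq (hp : Subextremal p) : Good p (bq p) := by
  have h1 := hp.good_rs
  have h2 := hp.good_DT
  have h3 := hp.good_Δr'
  have h4 := hp.good_nn
  have h5 := hp.good_inv_UU
  have h6 := hp.good_Qt
  have h7 := hp.good_delt
  refine Good.add ?_ ?_
  · refine ((Good.const_mul _ ((((h1.const_mul 2).mul h2).sub h3).mul hp.good_UU |>.sub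
      (((h4.mul h2).sub h7).mul ((((h1.const_mul 4).mul h4).mul h2).sub ((((hp.good_sT.mul
      hp.good_sin).pow 2).const_mul _).mul h3))))).mul (h5.pow 2)).mul ?_
    exact (((hp.good_pT.mul hp.good_kk).mul h6).mul h5).neg
  · refine ((((hp.good_sT.const_mul 2).mul hp.good_cT).mul (Good.const_mul _ ?_)).mul
      (h5.pow 2)).mul (((hp.good_kk.mul (h6.pow 2)).mul h2).mul h5)
    exact (((h4.const_mul _).mul (Good.const p _)).sub ((h4.pow 2).mul (Good.const p _))).sub
      (h7.const_mul _)

/-- Uniqueness of derivatives allows an abstractly controlled `θ⋆`-derivative to be replaced by an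
explicit formula while keeping the bounds. -/
theorem GoodGrad.congr_snd {f f₁ f₂ g₁ g₂ : ℝ × ℝ → ℝ} (h : GoodGrad p f f₁ f₂)
    (hg : ∀ q ∈ DD, HasGrad f (g₁ q) (g₂ q) q) : GoodGrad p f f₁ g₂ := by
  have he : EqOn f₂ g₂ DD := fun q hq =>
    (HasGrad.hasDerivAt_snd (x := q.1) (y := q.2) (h.grad q hq)).unique
      (HasGrad.hasDerivAt_snd (x := q.1) (y := q.2) (hg q hq))
  exact ⟨fun q hq => (h.grad q hq).congr rfl (he hq), h.cont₁, h.cont₂.congr he.symm, h.bd, h.bd₁,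
    h.bd₂.congr he⟩

/-- Chain rule through `(r, θ)`. In `Br · ∂r/∂θ⋆` the second factor is divisible by `Δr` and by `P`,
hence by `sin θ⋆`; in `Bθ · ∂θ/∂θ⋆` the first factor is divisible by `Δr` and `sin θ`. -/
theorem Subextremal.goodGrad_bet (hp : Subextremal p) :
    ∃ f₁, GoodGrad p (bet p) f₁ fun q => Real.sin q.2 * (delt p q * bq p q) := by
  obtain ⟨f₁, f₂, h⟩ := hp.good_bet
  refine ⟨f₁, h.congr_snd (g₁ := fun q => Br p (rs p q) (pull p (Th p) q) * (delt p q * rsq₁ p q) +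
    Bθ p (rs p q) (pull p (Th p) q) *
      (pull p (Pt p) q * delt p q * pull p (DT p) q / pull p (UU p) q)) fun q hq => ?_⟩
  have hU : pull p (UU p) q ≠ 0 := hp.UU_ne hq
  have hg := HasGrad.comp₂ (f := fun q => B p q.1 q.2) (u := rs p) (v := pull p (Th p)) (q := q)
    (grad_B (q := (rs p q, pull p (Th p) q)) hU) (hp.grad_rs hq) (hp.grad_theta hq)
  refine (hg.congr_of_eventuallyEq ?_).congr rfl ?_
  · filter_upwards [isOpen_DD.mem_nhds hq] with x hx
    exact (hp.bet_eq hx).symm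
  · have e1 := hp.sin_Th_pull hq
    have e2 := hp.cos_Th_pull hq
    have e3 := Pt_eq_pT p q
    have e4 : Υ p (rs p q) (pull p (Th p) q) = pull p (UU p) q := rfl
    have e5 : Δθ p (pull p (Th p) q) = pull p (DT p) q := rfl
    have e6 : Δr p (rs p q) = delt p q := rfl
    simp only [Br, Bθ, bq]
    rw [e4, e5, e6, e1, e2, e3]
    field_simp

/-! ### Integrals over lines of constant `θ⋆` -/

/-- Since `Υ = Q² Δθ + P² Δr ≤ Q² Δθ`, the quotient `rsq₁ = Q Δθ / Υ` is at least `1/Q`, and `Q` is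
bounded. -/
theorem Subextremal.exists_delt_le (hp : Subextremal p) :
    ∃ K, ∀ q ∈ DD, |delt p q| ≤ K * -(delt p q * rsq₁ p q) := by
  obtain ⟨C, hC⟩ := hp.bd_Qt
  refine ⟨C, fun q hq => ?_⟩
  have hr := hp.rs_mem hq
  have hQ : 0 < pull p (Qt p) q := hp.Qt_pos hr _
  have hU : 0 < pull p (UU p) q := hp.UU_pos hr _
  have hd : delt p q < 0 := hp.Δr_rs_neg hq
  have hUU : pull p (UU p) q = pull p (Qt p) q ^ 2 * pull p (DT p) q +
    pull p (Pt p) q ^ 2 * delt p q := hp.UU_eq hr (Ioo_subset_Icc_self hq.2)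
  have hCq : pull p (Qt p) q ≤ C := (le_abs_self _).trans (hC q hq)
  have hD : 1 ≤ pull p (DT p) q := hp.DT_ge _ _
  have h1 : 1 ≤ C * rsq₁ p q := by
    unfold rsq₁
    rw [← mul_div_assoc, one_le_div hU, hUU]
    have h2 : pull p (Qt p) q * (pull p (Qt p) q * pull p (DT p) q) ≤
      C * (pull p (Qt p) q * pull p (DT p) q) := by gcongr
    nlinarith [sq_nonneg (pull p (Pt p) q)]
  rw [abs_of_neg hd]
  nlinarith

theorem mem_DD_of_snd {q : ℝ × ℝ} (hq : q ∈ DD) (x : ℝ) : (x, q.2) ∈ DD := ⟨mem_univ _, hq.2⟩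

theorem continuous_line {f : ℝ × ℝ → ℝ} (hf : ContinuousOn f DD) {q : ℝ × ℝ} (hq : q ∈ DD) :
    Continuous fun x => f (x, q.2) :=
  continuousOn_univ.1 (hf.comp (by fun_prop) fun x _ => mem_DD_of_snd hq x)

/-- By `exists_delt_le`, `|Δr|` is at most a multiple of `-∂r/∂r⋆`, whose integral over any segment
of a line of constant `θ⋆` is a difference of values of `r`. The length of the segment does not
matter. -/
theorem Subextremal.bd_integral (hp : Subextremal p) {f : ℝ × ℝ → ℝ}
    (hf : ∃ C, ∀ q ∈ DD, |f q| ≤ C * |delt p q|) :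
    Bd fun q => ∫ x in (0 : ℝ)..q.1, f (x, q.2) := by
  obtain ⟨C, hC⟩ := hf
  obtain ⟨K, hK⟩ := hp.exists_delt_le
  refine ⟨|C| * |K| * (p.rp - p.rm), fun q hq => ?_⟩
  have hder : ∀ x, HasDerivAt (fun x => |C| * |K| * -rs p (x, q.2))
      (|C| * |K| * -(delt p (x, q.2) * rsq₁ p (x, q.2))) x := fun x =>
    (hp.grad_rs (mem_DD_of_snd hq x)).hasDerivAt_fst.neg.const_mul _
  have hcont : Continuous fun x => |C| * |K| * -(delt p (x, q.2) * rsq₁ p (x, q.2)) :=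
    continuous_const.mul (continuous_line (f := fun q => delt p q * rsq₁ p q)
      ((continuousOn_delt hp).mul hp.continuousOn_rsq₁) hq).neg
  have hbd : ∀ x, ‖f (x, q.2)‖ ≤ |C| * |K| * -(delt p (x, q.2) * rsq₁ p (x, q.2)) := by
    intro x
    have h1 := hC _ (mem_DD_of_snd hq x)
    have h2 := hK _ (mem_DD_of_snd hq x)
    have hpos : 0 ≤ -(delt p (x, q.2) * rsq₁ p (x, q.2)) := by
      have := hp.Δr_rs_neg (mem_DD_of_snd hq x)
      have hr := hp.rs_mem (mem_DD_of_snd hq x)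
      have h4 : 0 ≤ rsq₁ p (x, q.2) := div_nonneg (mul_nonneg (hp.Qt_pos hr _).le
        (zero_le_one.trans (hp.DT_ge _ _))) (hp.UU_pos hr _).le
      unfold delt; nlinarith
    calc |f (x, q.2)| ≤ C * |delt p (x, q.2)| := h1
      _ ≤ |C| * |delt p (x, q.2)| := by gcongr; exact le_abs_self C
      _ ≤ |C| * (|K| * -(delt p (x, q.2) * rsq₁ p (x, q.2))) := by
        gcongr; exact h2.trans (by gcongr; exact le_abs_self K)
      _ = _ := by ring
  have h := intervalIntegral.norm_integral_le_abs_of_norm_le (a := 0) (b := q.1) (μ := volume)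
    (Eventually.of_forall hbd) (hcont.intervalIntegrable _ _)
  rw [intervalIntegral.integral_eq_sub_of_hasDerivAt (fun x _ => hder x)
    (hcont.intervalIntegrable _ _), ← mul_sub, abs_mul, abs_of_nonneg (by positivity)] at h
  refine h.trans (mul_le_mul_of_nonneg_left ?_ (by positivity))
  have h5 := hp.rs_mem (mem_DD_of_snd hq q.1)
  have h6 := hp.rs_mem (mem_DD_of_snd hq 0)
  rw [abs_le]
  constructor <;> linarith [h5.1, h5.2, h6.1, h6.2]

theorem grad_integral {f f₁ f₂ : ℝ × ℝ → ℝ} (hf : GoodGrad p f f₁ f₂) {q : ℝ × ℝ} (hq : q ∈ DD) :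
    HasGrad (fun q => ∫ x in (0 : ℝ)..q.1, f (x, q.2)) (f q) (∫ x in (0 : ℝ)..q.1, f₂ (x, q.2)) q :=
  hasGrad_integral_param (g := fun x y => f (x, y)) (g' := fun x y => f₂ (x, y)) isOpen_DD
    hf.continuousOn hf.cont₂ (fun _ _ h => (hf.grad _ h).hasDerivAt_snd)
    fun x _ => mem_DD_of_snd hq x

/-- The integral of a controlled function which is bounded, with its `θ⋆`-derivative, by a multiple
of `Δr` is controlled. -/
theorem Subextremal.goodGrad_integral (hp : Subextremal p) {f f₁ f₂ : ℝ × ℝ → ℝ}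
    (hf : GoodGrad p f f₁ f₂) (h : ∃ C, ∀ q ∈ DD, |f q| ≤ C * |delt p q|)
    (h₂ : ∃ C, ∀ q ∈ DD, |f₂ q| ≤ C * |delt p q|) :
    ∃ g₂, GoodGrad p (fun q => ∫ x in (0 : ℝ)..q.1, f (x, q.2)) f g₂ := by
  refine ⟨_, fun q hq => grad_integral hf hq, hf.continuousOn, fun q hq => ?_, hp.bd_integral h, h,
    hp.bd_integral h₂⟩
  refine ContinuousAt.continuousWithinAt ?_
  exact continuousAt_integral_param (g := fun x y => f₂ (x, y)) isOpen_DD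
    hf.cont₂ fun x _ => mem_DD_of_snd hq x

/-- The derivative of `h` in `θ⋆`, divided by `sin θ⋆`. -/
def w0 (p : Params) (q : ℝ × ℝ) : ℝ := ∫ x in (0 : ℝ)..q.1, -(delt p (x, q.2) * bq p (x, q.2))

/-- The derivative of `h` in `θ⋆`. -/
def ww (p : Params) (q : ℝ × ℝ) : ℝ := Real.sin q.2 * w0 p q

theorem Subextremal.grad_delt (hp : Subextremal p) {q : ℝ × ℝ} (hq : q ∈ DD) :
    HasGrad (delt p) (delt p q * (Δr' p (rs p q) * rsq₁ p q))
      (delt p q * (Δr' p (rs p q) * rsq₂ p q)) q :=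
  (HasGrad.comp_deriv (q := q) (f := rs p) (hasStrictDerivAt_Δr p (rs p q))
    (hp.grad_rs hq)).congr (by unfold delt rsq₁ pull; ring) (by unfold delt rsq₂ pull; ring)

theorem delt_mul_le {g : ℝ × ℝ → ℝ} (hg : Bd g) :
    ∃ C, ∀ q ∈ DD, |delt p q * g q| ≤ C * |delt p q| :=
  bound_delt_mul ⟨1, fun q _ => by rw [one_mul]⟩ hg

theorem Subextremal.bd_w0 (hp : Subextremal p) : Bd (w0 p) :=
  hp.bd_integral (f := fun q => -(delt p q * bq p q))
    (by simpa only [abs_neg] using delt_mul_le hp.good_bq.bd)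

/-- The product of `Δr` with a controlled function has both derivatives bounded by `Δr`. -/
theorem Subextremal.goodGrad_delt_mul (hp : Subextremal p) {g : ℝ × ℝ → ℝ} (hg : Good p g) :
    ∃ f₁ f₂, GoodGrad p (fun q => delt p q * g q) f₁ f₂ ∧
      (∃ C, ∀ q ∈ DD, |delt p q * g q| ≤ C * |delt p q|) ∧
      ∃ C, ∀ q ∈ DD, |f₂ q| ≤ C * |delt p q| := by
  obtain ⟨f₁, f₂, h⟩ := hp.good_delt.mul hg
  obtain ⟨g₁, g₂, h'⟩ := hg
  -- The `θ⋆`-derivative of `Δr` is itself divisible by `Δr`, so the product rule keeps this factor.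
  have hg' : ∀ q ∈ DD, HasGrad (fun q => delt p q * g q) _
      (delt p q * (Δr' p (rs p q) * rsq₂ p q * g q + g₂ q)) q := fun q hq =>
    ((hp.grad_delt hq).mul (h'.grad q hq)).congr rfl (by ring)
  refine ⟨f₁, _, h.congr_snd hg', delt_mul_le h'.bd, delt_mul_le
    (((hp.good_Δr'.bd.mul hp.bd_rsq₂).mul h'.bd).add h'.bd₂)⟩

theorem ww_eq (q : ℝ × ℝ) :
    ww p q = ∫ x in (0 : ℝ)..q.1, delt p (x, q.2) * -(Real.sin q.2 * bq p (x, q.2)) := by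
  unfold ww w0
  rw [← intervalIntegral.integral_const_mul]
  congr 1; ext x; ring

/-- The integrand in `ww_eq` is `Δr` times a good function, so it and its `θ⋆`-derivative are
`O(Δr)` and both integrate to bounded functions. -/
theorem Subextremal.goodGrad_ww (hp : Subextremal p) :
    ∃ w₂, GoodGrad p (ww p) (fun q => delt p q * -(Real.sin q.2 * bq p q)) w₂ := by
  obtain ⟨f₁, f₂, h, h₁, h₂⟩ := hp.goodGrad_delt_mul (hp.good_sin.mul hp.good_bq).neg
  obtain ⟨g₂, hg⟩ := hp.goodGrad_integral h h₁ h₂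
  exact ⟨g₂, by rw [show ww p = _ from funext ww_eq]; exact hg⟩

/-- `h` itself is not claimed to be bounded, since `B` does not vanish at the horizons; only its
gradient enters the metric. -/
theorem Subextremal.grad_h (hp : Subextremal p) {q : ℝ × ℝ} (hq : q ∈ DD) :
    HasGrad (fun q => h p q.1 q.2) (-bet p q) (ww p q) q := by
  obtain ⟨f₁, hf⟩ := hp.goodGrad_bet
  have h := ((HasGrad.const (-1)).mul (grad_integral hf hq))
  refine (h.congr_of_eventuallyEq (Eventually.of_forall fun x => ?_)).congr ?_ ?_
  · simp only [KNdS.h, bet, intervalIntegral.integral_neg, neg_mul, one_mul]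
  · ring
  · rw [ww_eq, zero_mul, zero_add, ← intervalIntegral.integral_const_mul]
    congr 1; ext x; ring

end

end KNdS

namespace KNdS

open Filter Topology MeasureTheory

noncomputable section

/-! ### Functions of `(u + v, θ⋆)` -/

/-- The variables `(r⋆, θ⋆)` of a point with coordinates `(u, v, θ⋆, φ⋆)`. -/
def st (y : Fin 4 → ℝ) : ℝ × ℝ := (y 0 + y 1, y 2)

theorem st_mem {y : Fin 4 → ℝ} (hy : y ∈ nullDomain) : st y ∈ DD := ⟨mem_univ _, hy⟩

theorem isOpen_nullDomain : IsOpen nullDomain :=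
  isOpen_Ioo.preimage (continuous_apply (2 : Fin 4))

theorem hasFDerivAt_coord (y : Fin 4 → ℝ) (i : Fin 4) :
    HasFDerivAt (fun z : Fin 4 → ℝ => z i) (ContinuousLinearMap.proj i : (Fin 4 → ℝ) →L[ℝ] ℝ) y :=
  (ContinuousLinearMap.proj (R := ℝ) (φ := fun _ : Fin 4 => ℝ) i).hasFDerivAt

/-- The derivative of `(u, v, θ⋆, φ⋆) ↦ (r⋆, θ⋆)`. -/
def st' : (Fin 4 → ℝ) →L[ℝ] ℝ × ℝ :=
  ((ContinuousLinearMap.proj 0 : (Fin 4 → ℝ) →L[ℝ] ℝ) + ContinuousLinearMap.proj 1).prod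
    (ContinuousLinearMap.proj 2)

theorem hasFDerivAt_st (y : Fin 4 → ℝ) : HasFDerivAt st st' y :=
  ((hasFDerivAt_coord y 0).add (hasFDerivAt_coord y 1)).prodMk (hasFDerivAt_coord y 2)

variable {f : ℝ × ℝ → ℝ} {a b : ℝ} {y : Fin 4 → ℝ}

theorem HasGrad.comp_st (h : HasGrad f a b (st y)) :
    HasFDerivAt (fun z => f (st z)) ((lin a b).comp st') y :=
  h.hasFDerivAt.comp y (hasFDerivAt_st y)

theorem lin_comp_st'_single (i : Fin 4) :
    (lin a b).comp st' (Pi.single i 1) = ![a, a, b, 0] i := by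
  fin_cases i <;> simp [st']

theorem HasGrad.partialDeriv_st (h : HasGrad f a b (st y)) (i : Fin 4) :
    partialDeriv i (fun z => f (st z)) y = ![a, a, b, 0] i := by
  rw [partialDeriv, h.comp_st.fderiv, lin_comp_st'_single]

/-! ### Symmetric matrices -/

/-- The symmetric matrix with the given upper triangle. -/
def sym (m₀₀ m₀₁ m₀₂ m₀₃ m₁₁ m₁₂ m₁₃ m₂₂ m₂₃ m₃₃ : ℝ) : Matrix (Fin 4) (Fin 4) ℝ :=
  !![m₀₀, m₀₁, m₀₂, m₀₃; m₀₁, m₁₁, m₁₂, m₁₃; m₀₂, m₁₂, m₂₂, m₂₃; m₀₃, m₁₃, m₂₃, m₃₃]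

theorem sym_apply (m₀₀ m₀₁ m₀₂ m₀₃ m₁₁ m₁₂ m₁₃ m₂₂ m₂₃ m₃₃ : ℝ) :
    let m := sym m₀₀ m₀₁ m₀₂ m₀₃ m₁₁ m₁₂ m₁₃ m₂₂ m₂₃ m₃₃
    m 0 0 = m₀₀ ∧ m 0 1 = m₀₁ ∧ m 0 2 = m₀₂ ∧ m 0 3 = m₀₃ ∧ m 1 0 = m₀₁ ∧ m 1 1 = m₁₁ ∧
      m 1 2 = m₁₂ ∧ m 1 3 = m₁₃ ∧ m 2 0 = m₀₂ ∧ m 2 1 = m₁₂ ∧ m 2 2 = m₂₂ ∧ m 2 3 = m₂₃ ∧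
      m 3 0 = m₀₃ ∧ m 3 1 = m₁₃ ∧ m 3 2 = m₂₃ ∧ m 3 3 = m₃₃ :=
  ⟨rfl, rfl, rfl, rfl, rfl, rfl, rfl, rfl, rfl, rfl, rfl, rfl, rfl, rfl, rfl, rfl⟩

theorem sym_symm (m₀₀ m₀₁ m₀₂ m₀₃ m₁₁ m₁₂ m₁₃ m₂₂ m₂₃ m₃₃ : ℝ) (i j : Fin 4) :
    sym m₀₀ m₀₁ m₀₂ m₀₃ m₁₁ m₁₂ m₁₃ m₂₂ m₂₃ m₃₃ i j =
      sym m₀₀ m₀₁ m₀₂ m₀₃ m₁₁ m₁₂ m₁₃ m₂₂ m₂₃ m₃₃ j i := by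
  fin_cases i <;> fin_cases j <;> rfl

/-- To identify two symmetric matrices it suffices to compare their upper triangles. -/
theorem eq_of_upper {M N : Fin 4 → Fin 4 → ℝ} (hM : ∀ i j, M i j = M j i)
    (hN : ∀ i j, N i j = N j i) (h : ∀ i j, i ≤ j → M i j = N i j) (i j : Fin 4) :
    M i j = N i j := by
  rcases le_total i j with h' | h'
  · exact h i j h'
  · rw [hM, hN]; exact h j i h'

theorem grad_sym {q : ℝ × ℝ} {m₀₀ m₀₁ m₀₂ m₀₃ m₁₁ m₁₂ m₁₃ m₂₂ m₂₃ m₃₃ : ℝ × ℝ → ℝ}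
    {a₀₀ a₀₁ a₀₂ a₀₃ a₁₁ a₁₂ a₁₃ a₂₂ a₂₃ a₃₃ b₀₀ b₀₁ b₀₂ b₀₃ b₁₁ b₁₂ b₁₃ b₂₂ b₂₃ b₃₃ : ℝ}
    (h₀₀ : HasGrad m₀₀ a₀₀ b₀₀ q) (h₀₁ : HasGrad m₀₁ a₀₁ b₀₁ q) (h₀₂ : HasGrad m₀₂ a₀₂ b₀₂ q)
    (h₀₃ : HasGrad m₀₃ a₀₃ b₀₃ q) (h₁₁ : HasGrad m₁₁ a₁₁ b₁₁ q) (h₁₂ : HasGrad m₁₂ a₁₂ b₁₂ q)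
    (h₁₃ : HasGrad m₁₃ a₁₃ b₁₃ q) (h₂₂ : HasGrad m₂₂ a₂₂ b₂₂ q) (h₂₃ : HasGrad m₂₃ a₂₃ b₂₃ q)
    (h₃₃ : HasGrad m₃₃ a₃₃ b₃₃ q) (i j : Fin 4) :
    HasGrad (fun q => sym (m₀₀ q) (m₀₁ q) (m₀₂ q) (m₀₃ q) (m₁₁ q) (m₁₂ q) (m₁₃ q) (m₂₂ q) (m₂₃ q)
      (m₃₃ q) i j) (sym a₀₀ a₀₁ a₀₂ a₀₃ a₁₁ a₁₂ a₁₃ a₂₂ a₂₃ a₃₃ i j)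
      (sym b₀₀ b₀₁ b₀₂ b₀₃ b₁₁ b₁₂ b₁₃ b₂₂ b₂₃ b₃₃ i j) q := by
  fin_cases i <;> fin_cases j
  exacts [h₀₀, h₀₁, h₀₂, h₀₃, h₀₁, h₁₁, h₁₂, h₁₃, h₀₂, h₁₂, h₂₂, h₂₃, h₀₃, h₁₃, h₂₃, h₃₃]

/-! ### The metric in double null coordinates -/

/-- The metric `-4 W du dv + E dθ⋆² + H (dφ⋆ + w dθ⋆ + b dv)²`. -/
def nullForm (W b E H w : ℝ) : Matrix (Fin 4) (Fin 4) ℝ :=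
  sym 0 (-2 * W) 0 0 (H * b ^ 2) (H * b * w) (H * b) (E + H * w ^ 2) (H * w) H

/-- The differential of `nullForm`. -/
def nullForm' (b H w dW db dE dH dw : ℝ) : Matrix (Fin 4) (Fin 4) ℝ :=
  sym 0 (-2 * dW) 0 0 (dH * b ^ 2 + 2 * H * b * db) (dH * b * w + H * db * w + H * b * dw)
    (dH * b + H * db) (dE + dH * w ^ 2 + 2 * H * w * dw) (dH * w + H * dw) dH

/-- The inverse of `nullForm`. -/
def nullFormInv (W b E H w : ℝ) : Matrix (Fin 4) (Fin 4) ℝ :=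
  sym 0 (-1 / (2 * W)) 0 (b / (2 * W)) 0 0 0 (1 / E) (-w / E) (1 / H + w ^ 2 / E)

theorem nullForm_mul_inv {W b E H w : ℝ} (hW : W ≠ 0) (hE : E ≠ 0) (hH : H ≠ 0) :
    nullForm W b E H w * nullFormInv W b E H w = 1 := by
  ext i j
  fin_cases i <;> fin_cases j <;>
    simp [nullForm, nullFormInv, sym, Matrix.mul_apply, Fin.sum_univ_four] <;> field_simp <;> ring

theorem grad_nullForm {q : ℝ × ℝ} {W b E H w : ℝ × ℝ → ℝ}
    {W₁ W₂ b₁ b₂ E₁ E₂ H₁ H₂ w₁ w₂ : ℝ} (hW : HasGrad W W₁ W₂ q) (hb : HasGrad b b₁ b₂ q)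
    (hE : HasGrad E E₁ E₂ q) (hH : HasGrad H H₁ H₂ q) (hw : HasGrad w w₁ w₂ q) (i j : Fin 4) :
    HasGrad (fun q => nullForm (W q) (b q) (E q) (H q) (w q) i j)
      (nullForm' (b q) (H q) (w q) W₁ b₁ E₁ H₁ w₁ i j)
      (nullForm' (b q) (H q) (w q) W₂ b₂ E₂ H₂ w₂ i j) q := by
  have h0 := HasGrad.const (q := q) 0
  refine grad_sym h0 (((HasGrad.const (-2)).mul hW).congr (by ring) (by ring)) h0 h0
    (((hH.mul (hb.mul hb)).congr (a' := H₁ * b q ^ 2 + 2 * H q * b q * b₁)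
      (b' := H₂ * b q ^ 2 + 2 * H q * b q * b₂) (by ring) (by ring)).congr_of_eventuallyEq
      (Eventually.of_forall fun x => by simp only [pow_two]))
    (((hH.mul hb).mul hw).congr (by ring) (by ring))
    (hH.mul hb) ((hE.add ((hH.mul (hw.mul hw)).congr_of_eventuallyEq
      (g := fun q => H q * w q ^ 2)
      (Eventually.of_forall fun x => by simp only [pow_two]))).congr (by ring) (by ring))
    (hH.mul hw) hH i j

end

end KNdS

namespace KNdS

open Filter Topology MeasureTheory

noncomputable section

variable {p : Params}

/-! ### The components of the metric -/

/-- `ρ²` as a function of `(r⋆, θ⋆)`. -/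
def rho (p : Params) (q : ℝ × ℝ) : ℝ := rs p q ^ 2 + p.a ^ 2 * cT p q ^ 2

/-- The coefficient of `-4 du dv` in the metric, divided by `Δr`. -/
def W1 (p : Params) (q : ℝ × ℝ) : ℝ := -(pull p (DT p) q * rho p q * (pull p (UU p) q)⁻¹)

/-- The coefficient of `dv` in the one-form `dφ⋆ + w dθ⋆ + b dv`. -/
def bb (p : Params) (q : ℝ × ℝ) : ℝ := -2 * bet p q

/-- The coefficient of `dθ⋆²` in the metric. -/
def EE (p : Params) (q : ℝ × ℝ) : ℝ :=
  rho p q * (pull p (kk p) q * pull p (Qt p) q) ^ 2 * (pull p (UU p) q)⁻¹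

/-- The coefficient of `dφ⋆²` in the metric, divided by `sin² θ⋆`. -/
def H1 (p : Params) (q : ℝ × ℝ) : ℝ :=
  sT p q ^ 2 * pull p (UU p) q * (Ξ p ^ 2)⁻¹ * (rho p q)⁻¹

theorem Subextremal.rho_ge (hp : Subextremal p) {q : ℝ × ℝ} (hq : q ∈ DD) :
    p.rm ^ 2 ≤ rho p q := by
  have h1 := (hp.rs_mem hq).1
  have h2 := hp.rm_pos
  have h3 : p.rm ^ 2 ≤ rs p q ^ 2 := by gcongr
  unfold rho
  nlinarith [sq_nonneg (p.a * cT p q)]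

theorem Subextremal.rho_pos (hp : Subextremal p) {q : ℝ × ℝ} (hq : q ∈ DD) : 0 < rho p q :=
  lt_of_lt_of_le (pow_pos hp.rm_pos 2) (hp.rho_ge hq)

theorem Subextremal.good_rho (hp : Subextremal p) : Good p (rho p) :=
  (hp.good_rs.pow 2).add ((hp.good_cT.pow 2).const_mul _)

theorem Subextremal.good_W1 (hp : Subextremal p) : Good p (W1 p) :=
  ((hp.good_DT.mul hp.good_rho).mul hp.good_inv_UU).neg

theorem Subextremal.good_bb (hp : Subextremal p) : Good p (bb p) := hp.good_bet.const_mul _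

theorem Subextremal.good_EE (hp : Subextremal p) : Good p (EE p) :=
  (hp.good_rho.mul ((hp.good_kk.mul hp.good_Qt).pow 2)).mul hp.good_inv_UU

theorem Subextremal.good_H1 (hp : Subextremal p) : Good p (H1 p) :=
  (((hp.good_sT.pow 2).mul hp.good_UU).mul (Good.const p _)).mul
    (hp.good_rho.inv (pow_pos hp.rm_pos 2) fun _ hq => hp.rho_ge hq)

theorem Bd.exists_pos {f : ℝ × ℝ → ℝ} (hf : Bd f) : ∃ C > 0, ∀ q ∈ DD, |f q| ≤ C := by
  obtain ⟨C, hC⟩ := hf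
  exact ⟨|C| + 1, by positivity, fun q hq => (hC q hq).trans ((le_abs_self C).trans (by linarith))⟩

theorem Subextremal.kk_ne (hp : Subextremal p) {q : ℝ × ℝ} (hq : q ∈ DD) :
    pull p (kk p) q ≠ 0 := by
  have h := (hp.kk_pos (hp.rs_mem hq) q.2)
  exact (lt_of_lt_of_le hp.zmin_pos h).ne'

theorem Subextremal.sT_ne (hp : Subextremal p) {q : ℝ × ℝ} (hq : q ∈ DD) : sT p q ≠ 0 :=
  mul_ne_zero (hp.zmin_pos.trans_le (hp.zz_bounds hq).1).ne'
    (inv_ne_zero (hp.zmin_pos.trans_le (hp.zmin_le_rd hq)).ne')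

theorem Subextremal.Qt_ne (hp : Subextremal p) {q : ℝ × ℝ} (hq : q ∈ DD) :
    pull p (Qt p) q ≠ 0 := (hp.Qt_pos (hp.rs_mem hq) q.2).ne'

theorem Subextremal.DT_ne (hp : Subextremal p) (q : ℝ × ℝ) : pull p (DT p) q ≠ 0 :=
  (zero_lt_one.trans_le (hp.DT_ge (rs p q) q.2)).ne'

theorem Subextremal.Xi_ne (hp : Subextremal p) : Ξ p ≠ 0 := by
  rw [Xi_eq]; have := hp.ell_pos; positivity

theorem Subextremal.delt_ne (hp : Subextremal p) {q : ℝ × ℝ} (hq : q ∈ DD) : delt p q ≠ 0 :=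
  (hp.Δr_rs_neg hq).ne

theorem Subextremal.W1_ne (hp : Subextremal p) {q : ℝ × ℝ} (hq : q ∈ DD) : W1 p q ≠ 0 :=
  neg_ne_zero.2 (mul_ne_zero (mul_ne_zero (hp.DT_ne q) (hp.rho_pos hq).ne')
    (inv_ne_zero (hp.UU_ne hq)))

theorem Subextremal.EE_ne (hp : Subextremal p) {q : ℝ × ℝ} (hq : q ∈ DD) : EE p q ≠ 0 :=
  mul_ne_zero (mul_ne_zero (hp.rho_pos hq).ne' (pow_ne_zero 2 (mul_ne_zero (hp.kk_ne hq)
    (hp.Qt_ne hq)))) (inv_ne_zero (hp.UU_ne hq))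

theorem Subextremal.H1_ne (hp : Subextremal p) {q : ℝ × ℝ} (hq : q ∈ DD) : H1 p q ≠ 0 :=
  mul_ne_zero (mul_ne_zero (mul_ne_zero (pow_ne_zero 2 (hp.sT_ne hq)) (hp.UU_ne hq))
    (inv_ne_zero (pow_ne_zero 2 hp.Xi_ne))) (inv_ne_zero (hp.rho_pos hq).ne')

theorem Subextremal.bd_inv_Qt (hp : Subextremal p) : Bd fun q => (pull p (Qt p) q)⁻¹ :=
  Bd.inv (abs_pos.2 hp.a_ne |> fun h => pow_pos h 2) fun q hq => by
    have h1 := hp.nn_sq_le_qq (hp.rs_mem hq) q.2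
    have h2 : |p.a| ^ 2 ≤ nn p (rs p q) := by
      rw [sq_abs]; unfold nn; nlinarith [sq_nonneg (rs p q)]
    refine le_trans ?_ (le_abs_self _)
    exact Real.le_sqrt_of_sq_le (le_trans (by gcongr) h1)

theorem Subextremal.bd_inv_kk (hp : Subextremal p) : Bd fun q => (pull p (kk p) q)⁻¹ :=
  Bd.inv hp.zmin_pos fun q hq => (hp.kk_pos (hp.rs_mem hq) q.2).trans (le_abs_self _)

theorem Subextremal.bd_inv_DT (hp : Subextremal p) : Bd fun q => (pull p (DT p) q)⁻¹ :=
  Bd.inv one_pos fun q _ => (hp.DT_ge (rs p q) q.2).trans (le_abs_self _)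

theorem Subextremal.bd_inv_rho (hp : Subextremal p) : Bd fun q => (rho p q)⁻¹ :=
  Bd.inv (pow_pos hp.rm_pos 2) fun _ hq => (hp.rho_ge hq).trans (le_abs_self _)

theorem Subextremal.bd_inv_W1 (hp : Subextremal p) : Bd fun q => (W1 p q)⁻¹ :=
  ((hp.bd_inv_DT.mul hp.bd_inv_rho).mul hp.good_UU.bd).neg.congr fun q _ => by
    simp only [W1, inv_neg, mul_inv, inv_inv]

theorem Subextremal.bd_inv_EE (hp : Subextremal p) : Bd fun q => (EE p q)⁻¹ :=
  ((hp.bd_inv_rho.mul ((hp.bd_inv_kk.mul hp.bd_inv_Qt).mul (hp.bd_inv_kk.mul hp.bd_inv_Qt))).mul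
    hp.good_UU.bd).congr fun q _ => by
    simp only [EE, mul_inv, inv_inv, pow_two]

theorem Subextremal.bd_inv_sT (hp : Subextremal p) : Bd fun q => (sT p q)⁻¹ :=
  (Bd.mul (Bd.inv hp.zmin_pos fun q hq => (hp.zz_bounds hq).1.trans (le_abs_self _))
    hp.good_rd.bd).congr fun q _ => by simp only [sT, mul_inv, inv_inv]

theorem Subextremal.bd_inv_H1 (hp : Subextremal p) : Bd fun q => (H1 p q)⁻¹ :=
  ((((hp.bd_inv_sT.mul hp.bd_inv_sT).mul hp.bd_inv_UU).mul (Bd.const (Ξ p ^ 2))).mul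
    hp.good_rho.bd).congr fun q _ => by
    simp only [H1, mul_inv, inv_inv, pow_two]

/-! ### The Jacobian of the coordinate change -/

theorem Subextremal.jacobian_toBL (hp : Subextremal p) {y : Fin 4 → ℝ} (hy : y ∈ nullDomain) :
    DifferentiableAt ℝ (toBL p) y ∧ ∀ i,
      partialDeriv i (fun z => toBL p z 0) y = ![-1, 1, 0, 0] i ∧
      partialDeriv i (fun z => toBL p z 1) y =
        ![delt p (st y) * rsq₁ p (st y), delt p (st y) * rsq₁ p (st y),
          delt p (st y) * rsq₂ p (st y), 0] i ∧
      partialDeriv i (fun z => toBL p z 2) y =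
        ![pull p (Pt p) (st y) * delt p (st y) * pull p (DT p) (st y) / pull p (UU p) (st y),
          pull p (Pt p) (st y) * delt p (st y) * pull p (DT p) (st y) / pull p (UU p) (st y),
          pull p (kk p) (st y) * pull p (Qt p) (st y) ^ 2 * pull p (DT p) (st y) /
            pull p (UU p) (st y), 0] i ∧
      partialDeriv i (fun z => toBL p z 3) y =
        ![-bet p (st y), -bet p (st y), ww p (st y), 1] i := by
  have hq := st_mem hy
  -- The four components of `toBL` are differentiated separately; all but `t = v - u` factor, up to
  -- the summand `φ⋆`, through `(u + v, θ⋆)`.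
  have d0 : HasFDerivAt (fun z => toBL p z 0) _ y :=
    (hasFDerivAt_coord y 1).sub (hasFDerivAt_coord y 0)
  have g1 := hp.grad_rs hq
  have g2 : HasGrad (fun q => (starInv p q).2) _ _ (st y) :=
    (hp.grad_theta hq).congr_of_eventuallyEq <| by
      filter_upwards [isOpen_DD.mem_nhds hq] with z hz
      exact (hp.starInv_spec hz).2.2.symm
  have g3 := hp.grad_h hq
  have d1 : HasFDerivAt (fun z => toBL p z 1) _ y := g1.comp_st
  have d2 : HasFDerivAt (fun z => toBL p z 2) _ y := g2.comp_st
  have d3 : HasFDerivAt (fun z => toBL p z 3) _ y := (hasFDerivAt_coord y 3).add g3.comp_st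
  refine ⟨differentiableAt_pi.2 fun i => ?_, fun i => ⟨?_, ?_, ?_, ?_⟩⟩
  · fin_cases i
    exacts [d0.differentiableAt, d1.differentiableAt, d2.differentiableAt, d3.differentiableAt]
  · rw [partialDeriv, d0.fderiv]
    fin_cases i <;> simp
  · exact g1.partialDeriv_st i
  · exact g2.partialDeriv_st i
  · rw [partialDeriv, d3.fderiv, add_apply, lin_comp_st'_single]
    fin_cases i <;> simp

/-- A stationary axisymmetric metric in adapted double null coordinates. -/
theorem sum_eq_nullForm {A G H grr gθθ W β E w rs rt θs θt : ℝ} (hA : A = W + β ^ 2 * H)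
    (hG : G = -(β * H)) (h₁ : grr * rs * rs + gθθ * θs * θs = -W)
    (h₂ : grr * rs * rt + gθθ * θs * θt = 0) (h₃ : grr * rt * rt + gθθ * θt * θt = E)
    (i j : Fin 4) :
    ∑ k, ∑ l, !![A, 0, 0, G; 0, grr, 0, 0; 0, 0, gθθ, 0; G, 0, 0, H] k l *
      !![-1, 1, 0, 0; rs, rs, rt, 0; θs, θs, θt, 0; -β, -β, w, 1] k i *
      !![-1, 1, 0, 0; rs, rs, rt, 0; θs, θs, θt, 0; -β, -β, w, 1] l j =
    nullForm W (-2 * β) E H w i j := by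
  subst hA hG
  fin_cases i <;> fin_cases j <;>
    simp [nullForm, sym, Fin.sum_univ_four] <;>
    first
      | linear_combination h₁
      | linear_combination h₂
      | linear_combination h₃
      | ring

/-- `sum_eq_nullForm` reduces the claim to five scalar identities: two for the `(t, φ)` block, where
`B` completes the square, and three for the `(r, θ)` block, where the eikonal identity enters. -/
theorem Subextremal.metricNull_eq (hp : Subextremal p) {y : Fin 4 → ℝ} (hy : y ∈ nullDomain) :
    metricNull p y = nullForm (delt p (st y) * W1 p (st y)) (bb p (st y)) (EE p (st y))
      (Real.sin (st y).2 ^ 2 * H1 p (st y)) (ww p (st y)) := by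
  have hq := st_mem hy
  obtain ⟨-, hJ⟩ := hp.jacobian_toBL hy
  have hr := hp.rs_mem hq
  have hU := hp.UU_ne hq
  have hD := hp.DT_ne (st y)
  have hd := hp.delt_ne hq
  have hρ := (hp.rho_pos hq).ne'
  have hΞ := hp.Xi_ne
  have hUU : pull p (UU p) (st y) = pull p (Qt p) (st y) ^ 2 * pull p (DT p) (st y) +
    pull p (Pt p) (st y) ^ 2 * delt p (st y) := hp.UU_eq hr (Ioo_subset_Icc_self hq.2)
  have hUU' : pull p (UU p) (st y) = nn p (rs p (st y)) ^ 2 * pull p (DT p) (st y) -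
    p.a ^ 2 * Real.sin (pull p (Th p) (st y)) ^ 2 * delt p (st y) := rfl
  have eθ : (starInv p (st y)).2 = pull p (Th p) (st y) := (hp.starInv_spec hq).2.2
  have es := hp.sin_Th_pull hq
  have hρ' : rhoSq p (rs p (st y)) (pull p (Th p) (st y)) = rho p (st y) := by
    rw [rhoSq, hp.cos_Th_pull hq]; rfl
  have hN : nn p (rs p (st y)) = rho p (st y) + p.a ^ 2 * Real.sin (pull p (Th p) (st y)) ^ 2 := by
    rw [← hρ', Real.sin_sq]; unfold nn rhoSq; ring
  have hm : metricBL p (toBL p y) =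
      !![(p.a ^ 2 * Real.sin (pull p (Th p) (st y)) ^ 2 * pull p (DT p) (st y) - delt p (st y)) /
          rho p (st y), 0, 0, gtφ p (rs p (st y)) (pull p (Th p) (st y));
        0, rho p (st y) / delt p (st y), 0, 0; 0, 0, rho p (st y) / pull p (DT p) (st y), 0;
        gtφ p (rs p (st y)) (pull p (Th p) (st y)), 0, 0,
        Real.sin (st y).2 ^ 2 * H1 p (st y)] := by
    have e4 : Real.sin (st y).2 ^ 2 * H1 p (st y) = Real.sin (pull p (Th p) (st y)) ^ 2 /
        (Ξ p ^ 2 * rho p (st y)) * pull p (UU p) (st y) := by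
      rw [es]; unfold H1; field_simp
    rw [e4, ← hρ']
    simp only [metricBL, show toBL p y 1 = rs p (st y) from rfl,
      show toBL p y 2 = pull p (Th p) (st y) from eθ]
    rfl
  have hX : ∀ k i, partialDeriv i (fun z => toBL p z k) y = !![-1, 1, 0, 0;
      delt p (st y) * rsq₁ p (st y), delt p (st y) * rsq₁ p (st y), delt p (st y) * rsq₂ p (st y), 0;
      pull p (Pt p) (st y) * delt p (st y) * pull p (DT p) (st y) / pull p (UU p) (st y),
        pull p (Pt p) (st y) * delt p (st y) * pull p (DT p) (st y) / pull p (UU p) (st y),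
        pull p (kk p) (st y) * pull p (Qt p) (st y) ^ 2 * pull p (DT p) (st y) /
          pull p (UU p) (st y), 0;
      -bet p (st y), -bet p (st y), ww p (st y), 1] k i := by
    intro k i
    obtain ⟨h0, h1, h2, h3⟩ := hJ i
    fin_cases k
    exacts [h0, h1, h2, h3]
  ext i j
  rw [metricNull, pullbackMetric, Matrix.of_apply]
  simp only [hX, hm]
  refine sum_eq_nullForm ?_ ?_ ?_ ?_ ?_ i j
  · rw [hp.bet_eq' hq]
    unfold W1 H1
    -- Up to the factors `Ξ` and `sin² θ`, this is the determinant of the `(t, φ)` block, after `r²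
    -- + a² = ρ² + a² sin² θ`.
    have key : (p.a ^ 2 * Real.sin (pull p (Th p) (st y)) ^ 2 * pull p (DT p) (st y) -
        delt p (st y)) * pull p (UU p) (st y) =
        -(delt p (st y) * pull p (DT p) (st y) * rho p (st y) ^ 2) +
        p.a ^ 2 * Real.sin (pull p (Th p) (st y)) ^ 2 *
          (nn p (rs p (st y)) * pull p (DT p) (st y) - delt p (st y)) ^ 2 := by
      rw [hUU', hN]; ring
    rw [es] at key ⊢
    field_simp
    linear_combination key
  · rw [hp.bet_eq' hq]
    unfold gtφ H1
    rw [hρ', es]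
    have e5 : Δθ p (pull p (Th p) (st y)) = pull p (DT p) (st y) := rfl
    have e6 : Δr p (rs p (st y)) = delt p (st y) := rfl
    rw [e5, e6]
    unfold nn
    field_simp
  -- The `(r, θ)` part of the metric on `∂/∂r⋆` equals `-W`, by `Υ = Q² Δθ + P² Δr`: this is what
  -- makes `∂/∂u` null.
  · unfold rsq₁ W1
    field_simp
    rw [hUU]; ring
  -- The directions `∂/∂r⋆` and `∂/∂θ⋆` are orthogonal in the `(r, θ)` part, which removes the `dr⋆
  -- dθ⋆` term.
  · unfold rsq₁ rsq₂
    field_simp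
    ring
  · unfold rsq₂ EE
    field_simp
    rw [hUU]; ring

end

end KNdS

namespace KNdS

open Filter Topology MeasureTheory

noncomputable section

/-! ### Christoffel symbols of a double null metric -/

/-- The values at a point of the coefficients of the metric `nullForm (δ W) b E (σ² H) (σ w)` and of
their derivatives. The derivatives of `δ W`, `b`, `E`, `H`, `σ w` in `r⋆` are `δ ω₁`, `δ β₁`, `δ ε₁`,
`δ η₁`, `σ δ ν / 2`; those in `θ⋆` are `δ ω₂`, `σ δ ν`, `ε₂`, `η₂`, `w₂`. -/
structure Jet where
  δ : ℝ
  σ : ℝ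
  c : ℝ
  W : ℝ
  ω₁ : ℝ
  ω₂ : ℝ
  b : ℝ
  β₁ : ℝ
  ν : ℝ
  E : ℝ
  ε₁ : ℝ
  ε₂ : ℝ
  H : ℝ
  η₁ : ℝ
  η₂ : ℝ
  w : ℝ
  w₂ : ℝ

namespace Jet

variable (x : Jet)

/-- The derivative of `σ² H` in `θ⋆`, divided by `σ`. -/
def χ : ℝ := 2 * x.c * x.H + x.σ * x.η₂

/-- The derivative of the metric in `r⋆`. -/
def Ds : Matrix (Fin 4) (Fin 4) ℝ :=
  nullForm' x.b (x.σ ^ 2 * x.H) (x.σ * x.w) (x.δ * x.ω₁) (x.δ * x.β₁) (x.δ * x.ε₁)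
    (x.σ ^ 2 * (x.δ * x.η₁)) (1 / 2 * (x.σ * x.δ * x.ν))

/-- The derivative of the metric in `θ⋆`. -/
def Dt : Matrix (Fin 4) (Fin 4) ℝ :=
  nullForm' x.b (x.σ ^ 2 * x.H) (x.σ * x.w) (x.δ * x.ω₂) (x.σ * x.δ * x.ν) x.ε₂ (x.σ * x.χ) x.w₂

/-- The derivatives of the components of the metric in the four coordinates. -/
def D (l i j : Fin 4) : ℝ := ![x.Ds i j, x.Ds i j, x.Dt i j, 0] l

/-- Twice the Christoffel symbols of the first kind. -/
def L (l i j : Fin 4) : ℝ := x.D i j l + x.D j i l - x.D l i j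

/-- The Christoffel symbols. -/
def Γ (k i j : Fin 4) : ℝ :=
  1 / 2 * ∑ l, nullFormInv (x.δ * x.W) x.b x.E (x.σ ^ 2 * x.H) (x.σ * x.w) k l * x.L l i j

/-- The products of `W` with the symbols `Γ^u`. -/
def Γu : Matrix (Fin 4) (Fin 4) ℝ :=
  sym (x.ω₁) (-(1 / 4 * (x.σ * x.σ * x.H * x.b * x.β₁)))
    (-(1 / 2 * (1 / 2 * (x.σ * x.σ * x.σ * x.H * x.w * x.β₁) - x.ω₂)))
    (-(1 / 4 * (x.σ * x.σ * x.H * x.β₁)))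
    (1 / 4 * (x.b * x.b * x.σ * x.σ * x.η₁))
    (-(1 / 4 * (x.σ * x.σ * x.σ * x.b * (1 / 2 * x.H * x.ν - x.η₁ * x.w))))
    (1 / 4 * (x.b * x.σ * x.σ * x.η₁))
    (-(1 / 4 * (x.σ * x.σ * x.σ * x.σ * (x.H * x.w * x.ν - x.η₁ * x.w * x.w) - x.ε₁)))
    (-(1 / 4 * (x.σ * x.σ * x.σ * (1 / 2 * x.H * x.ν - x.η₁ * x.w))))
    (1 / 4 * (x.σ * x.σ * x.η₁))

/-- The products of `W` with the symbols `Γ^v`. -/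
def Γv : Matrix (Fin 4) (Fin 4) ℝ :=
  sym 0 0 0 0
    (x.ω₁ + 1 / 4 * (x.σ * x.σ * x.b * (x.η₁ * x.b + 2 * x.H * x.β₁)))
    (1 / 2 * (x.ω₂ + 1 / 2 * (x.σ * x.σ * x.σ *
      (x.η₁ * x.b * x.w + x.H * x.w * x.β₁ + 1 / 2 * x.H * x.b * x.ν))))
    (1 / 4 * (x.σ * x.σ * (x.η₁ * x.b + x.H * x.β₁)))
    (1 / 4 * (x.ε₁ + x.σ * x.σ * x.σ * x.σ * x.w * (x.η₁ * x.w + x.H * x.ν)))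
    (1 / 4 * (x.σ * x.σ * x.σ * (x.η₁ * x.w + 1 / 2 * x.H * x.ν)))
    (1 / 4 * (x.σ * x.σ * x.η₁))

/-- The products of `E` with the symbols `Γ^θ⋆`. -/
def Γθ : Matrix (Fin 4) (Fin 4) ℝ :=
  sym 0 (x.δ * (1 / 4 * (x.σ * x.σ * x.σ * x.H * x.b * x.ν) + x.ω₂))
    (1 / 2 * (x.δ * (x.ε₁ + 1 / 2 * (x.σ * x.σ * x.σ * x.σ * x.H * x.w * x.ν))))
    (1 / 4 * (x.σ * x.σ * x.σ * x.H * x.δ * x.ν))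
    (-(1 / 2 * (x.σ * x.b * (x.χ * x.b + x.σ * x.σ * x.H * x.δ * x.ν))))
    (1 / 2 * (x.δ * x.ε₁ - x.σ * x.σ * x.w *
      (x.χ * x.b + 1 / 2 * (x.σ * x.σ * x.H * x.δ * x.ν))))
    (-(1 / 2 * (x.σ * (x.χ * x.b + 1 / 2 * (x.σ * x.σ * x.H * x.δ * x.ν)))))
    (1 / 2 * (x.ε₂ - x.σ * x.σ * x.σ * x.χ * x.w * x.w))
    (-(1 / 2 * (x.σ * x.σ * x.w * x.χ)))
    (-(1 / 2 * (x.σ * x.χ)))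

/-- The products of `H` with the part of the symbols `Γ^φ⋆` that does not come from `Γ^v` and `Γ^θ⋆`
and remains bounded. -/
def Γφ : Matrix (Fin 4) (Fin 4) ℝ :=
  sym 0 (1 / 2 * (x.δ * (x.η₁ * x.b + x.H * x.β₁)))
    (1 / 2 * (x.δ * x.σ * (x.η₁ * x.w + 1 / 2 * x.H * x.ν)))
    (1 / 2 * (x.δ * x.η₁))
    (x.δ * (x.η₁ * x.b + x.H * x.β₁))
    (1 / 2 * (x.δ * x.σ * (x.η₁ * x.w + 3 / 2 * x.H * x.ν) + x.η₂ * x.b))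
    (1 / 2 * (x.δ * x.η₁))
    (2 * x.c * x.w * x.H + x.η₂ * x.σ * x.w + x.H * x.w₂)
    (1 / 2 * x.η₂) 0

/-- The coefficients of `cot θ⋆` in the symbols `Γ^φ⋆`. -/
def Γcot : Matrix (Fin 4) (Fin 4) ℝ := sym 0 0 0 0 0 x.b 0 0 1 0

variable {x}

theorem D_apply (i j : Fin 4) :
    x.D 0 i j = x.Ds i j ∧ x.D 1 i j = x.Ds i j ∧ x.D 2 i j = x.Dt i j ∧ x.D 3 i j = 0 :=
  ⟨rfl, rfl, rfl, rfl⟩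

theorem D_symm (l i j : Fin 4) : x.D l i j = x.D l j i := by
  unfold D
  rw [show x.Ds i j = x.Ds j i from sym_symm _ _ _ _ _ _ _ _ _ _ i j,
    show x.Dt i j = x.Dt j i from sym_symm _ _ _ _ _ _ _ _ _ _ i j]

theorem L_symm (l i j : Fin 4) : x.L l i j = x.L l j i := by
  unfold L; rw [D_symm l i j]; ring

/-- The vector `∂_v - b ∂_φ⋆` pairs only with `∂_u`. Contracting with it cancels the
`θ⋆`-derivatives of `H`; what is left are derivatives in `r⋆` and derivatives of `W` and `b`, all
divisible by `δ`. This compensates the `1/W` of the inverse metric. -/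
theorem L_one (i j : Fin 4) : x.L 1 i j - x.b * x.L 3 i j = -4 * x.δ * x.Γu i j := by
  refine eq_of_upper (M := fun i j => x.L 1 i j - x.b * x.L 3 i j)
    (N := fun i j => -4 * x.δ * x.Γu i j) (fun i j => by simp only [L_symm _ i j])
    (fun i j => by rw [Γu, sym_symm]) (fun i j h => ?_) i j
  fin_cases i <;> fin_cases j <;> first | exact absurd h (by decide) | skip
  all_goals
    simp only [Fin.zero_eta, Fin.mk_one, Fin.reduceFinMk, L, D_apply, Ds, Dt, nullForm', Γu,
      sym_apply]
    ring

/-- The only component of the metric with an index `u` is `-2 W`, and `∂_u` is a derivative in `r⋆`;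
so every term carries `δ`. -/
theorem L_zero (i j : Fin 4) : x.L 0 i j = -4 * x.δ * x.Γv i j := by
  refine eq_of_upper (M := fun i j => x.L 0 i j)
    (N := fun i j => -4 * x.δ * x.Γv i j) (fun i j => by simp only [L_symm _ i j])
    (fun i j => by rw [Γv, sym_symm]) (fun i j h => ?_) i j
  fin_cases i <;> fin_cases j <;> first | exact absurd h (by decide) | skip
  all_goals
    simp only [Fin.zero_eta, Fin.mk_one, Fin.reduceFinMk, L, D_apply, Ds, Dt, nullForm', Γv,
      sym_apply]
    ring

/-- The vector `∂_θ⋆ - σ w ∂_φ⋆` pairs only with `∂_θ⋆`, with product `E`. Since `1/E` is bounded,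
no factor has to be gained here. -/
theorem L_two (i j : Fin 4) : x.L 2 i j - x.σ * x.w * x.L 3 i j = 2 * x.Γθ i j := by
  refine eq_of_upper (M := fun i j => x.L 2 i j - x.σ * x.w * x.L 3 i j)
    (N := fun i j => 2 * x.Γθ i j) (fun i j => by simp only [L_symm _ i j])
    (fun i j => by rw [Γθ, sym_symm]) (fun i j h => ?_) i j
  fin_cases i <;> fin_cases j <;> first | exact absurd h (by decide) | skip
  all_goals
    simp only [Fin.zero_eta, Fin.mk_one, Fin.reduceFinMk, L, D_apply, Ds, Dt, nullForm', Γθ,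
      sym_apply]
    ring

/-- Nothing depends on `φ⋆`, so only derivatives of `σ² H · (0, b, σ w, 1)` occur. The derivative of
`σ²` in `θ⋆` is `2 σ c`, one power of `σ` short; the component with `σ w` makes up for it, those
with `b` and `1` do not, and they form `Γcot`. -/
theorem L_three (i j : Fin 4) :
    x.L 3 i j = 2 * x.σ ^ 2 * x.Γφ i j + 2 * x.σ * x.c * x.H * x.Γcot i j := by
  refine eq_of_upper (M := fun i j => x.L 3 i j)
    (N := fun i j => 2 * x.σ ^ 2 * x.Γφ i j + 2 * x.σ * x.c * x.H * x.Γcot i j)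
    (fun i j => by simp only [L_symm _ i j])
    (fun i j => by rw [Γφ, Γcot, sym_symm, sym_symm _ _ _ _ _ x.b]) (fun i j h => ?_) i j
  fin_cases i <;> fin_cases j <;> first | exact absurd h (by decide) | skip
  all_goals
    simp only [Fin.zero_eta, Fin.mk_one, Fin.reduceFinMk, L, D_apply, Ds, Dt, nullForm', Γφ, Γcot, χ,
      sym_apply]
    ring

theorem Γ_zero (hδ : x.δ ≠ 0) (hW : x.W ≠ 0) (i j : Fin 4) :
    x.Γ 0 i j = x.W⁻¹ * x.Γu i j := by
  have h := L_one (x := x) i j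
  simp only [Γ, Fin.sum_univ_four, nullFormInv, sym_apply]
  field_simp
  linear_combination -h

theorem Γ_one (hδ : x.δ ≠ 0) (hW : x.W ≠ 0) (i j : Fin 4) :
    x.Γ 1 i j = x.W⁻¹ * x.Γv i j := by
  have h := L_zero (x := x) i j
  simp only [Γ, Fin.sum_univ_four, nullFormInv, sym_apply]
  field_simp
  linear_combination -h

theorem Γ_two (hE : x.E ≠ 0) (i j : Fin 4) : x.Γ 2 i j = x.E⁻¹ * x.Γθ i j := by
  have h := L_two (x := x) i j
  simp only [Γ, Fin.sum_univ_four, nullFormInv, sym_apply]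
  field_simp
  linear_combination h

/-- Expanding the `φ⋆` row of the inverse metric reproduces `Γ^v` and `Γ^θ⋆`, already regular, plus
`L 3` divided by `2 σ² H`, which `L_three` evaluates. -/
theorem Γ_three (hσ : x.σ ≠ 0) (hδ : x.δ ≠ 0) (hW : x.W ≠ 0) (hE : x.E ≠ 0) (hH : x.H ≠ 0)
    (i j : Fin 4) : x.Γ 3 i j = -(x.b * (x.W⁻¹ * x.Γv i j)) - x.σ * x.w * (x.E⁻¹ * x.Γθ i j) +
      x.H⁻¹ * x.Γφ i j + x.c / x.σ * x.Γcot i j := by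
  have h : x.Γ 3 i j = -(x.b * x.Γ 1 i j) - x.σ * x.w * x.Γ 2 i j +
      x.L 3 i j / (2 * (x.σ ^ 2 * x.H)) := by
    simp only [Γ, Fin.sum_univ_four, nullFormInv, sym_apply]
    field_simp
    ring
  rw [h, Γ_one hδ hW, Γ_two hE, L_three]
  field_simp
  ring

end Jet

end

end KNdS

namespace KNdS

open Filter Topology MeasureTheory

noncomputable section

variable {p : Params}

/-! ### The Christoffel symbols in the coordinates `(u, v, θ⋆, φ⋆)` -/

/-- The derivative in `r⋆`, divided by `Δr`. -/
def sd (p : Params) (f : ℝ × ℝ → ℝ) (q : ℝ × ℝ) : ℝ := fderiv ℝ f q (1, 0) / delt p q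

/-- The derivative in `θ⋆`. -/
def td (f : ℝ × ℝ → ℝ) (q : ℝ × ℝ) : ℝ := fderiv ℝ f q (0, 1)

theorem Subextremal.sd_eq (hp : Subextremal p) {f : ℝ × ℝ → ℝ} {a b : ℝ} {q : ℝ × ℝ}
    (h : HasGrad f a b q) (hq : q ∈ DD) : delt p q * sd p f q = a := by
  rw [sd, h.hasFDerivAt.fderiv, mul_div_cancel₀ _ (hp.delt_ne hq)]; simp

theorem td_eq {f : ℝ × ℝ → ℝ} {a b : ℝ} {q : ℝ × ℝ} (h : HasGrad f a b q) : td f q = b := by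
  rw [td, h.hasFDerivAt.fderiv]; simp

theorem Subextremal.grad_of_good (hp : Subextremal p) {f : ℝ × ℝ → ℝ} (h : Good p f) {q : ℝ × ℝ}
    (hq : q ∈ DD) : HasGrad f (delt p q * sd p f q) (td f q) q := by
  obtain ⟨f₁, f₂, h⟩ := h
  exact (h.grad q hq).congr (hp.sd_eq (h.grad q hq) hq).symm (td_eq (h.grad q hq)).symm

theorem Subextremal.bd_sd (hp : Subextremal p) {f : ℝ × ℝ → ℝ} (h : Good p f) : Bd (sd p f) := by
  obtain ⟨f₁, f₂, h⟩ := h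
  obtain ⟨C, hC⟩ := h.bd₁
  refine ⟨C, fun q hq => le_of_mul_le_mul_left ?_ (abs_pos.2 (hp.delt_ne hq))⟩
  rw [← abs_mul, hp.sd_eq (h.grad q hq) hq, mul_comm]
  exact hC q hq

theorem Good.bd_td {f : ℝ × ℝ → ℝ} (h : Good p f) : Bd (td f) := by
  obtain ⟨f₁, f₂, h⟩ := h
  exact h.bd₂.congr fun q hq => (td_eq (h.grad q hq)).symm

/-- The coefficients of the metric in double null coordinates and their derivatives. -/
def jet (p : Params) (q : ℝ × ℝ) : Jet where
  δ := delt p q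
  σ := Real.sin q.2
  c := Real.cos q.2
  W := W1 p q
  ω₁ := Δr' p (rs p q) * rsq₁ p q * W1 p q + delt p q * sd p (W1 p) q
  ω₂ := Δr' p (rs p q) * rsq₂ p q * W1 p q + td (W1 p) q
  b := bb p q
  β₁ := sd p (bb p) q
  ν := -2 * bq p q
  E := EE p q
  ε₁ := sd p (EE p) q
  ε₂ := td (EE p) q
  H := H1 p q
  η₁ := sd p (H1 p) q
  η₂ := td (H1 p) q
  w := w0 p q
  w₂ := td (ww p) q

/-- The metric as a function of `(r⋆, θ⋆)`. -/
def gg (p : Params) (q : ℝ × ℝ) : Matrix (Fin 4) (Fin 4) ℝ :=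
  nullForm (delt p q * W1 p q) (bb p q) (EE p q) (Real.sin q.2 ^ 2 * H1 p q) (ww p q)

/-- The same `ν` governs two derivatives, `∂b/∂θ⋆ = σ δ ν` and `∂w/∂r⋆ = σ δ ν / 2`: since `b = -2
B` and `∂h/∂r⋆ = -B`, this is the equality of the mixed derivatives of `h`. -/
theorem Subextremal.grad_gg (hp : Subextremal p) {q : ℝ × ℝ} (hq : q ∈ DD) (i j : Fin 4) :
    HasGrad (fun q => gg p q i j) ((jet p q).Ds i j) ((jet p q).Dt i j) q := by
  have hW := ((hp.grad_delt hq).mul (hp.grad_of_good hp.good_W1 hq)).congr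
    (a' := delt p q * (jet p q).ω₁) (b' := delt p q * (jet p q).ω₂)
    (by simp only [jet]; ring) (by simp only [jet]; ring)
  obtain ⟨f₁, hf⟩ := hp.goodGrad_bet
  have hb : HasGrad (bb p) (delt p q * (jet p q).β₁) (Real.sin q.2 * delt p q * (jet p q).ν) q := by
    refine (hp.grad_of_good hp.good_bb hq).congr rfl ?_
    rw [td_eq (f := bb p) ((HasGrad.const (-2)).mul (hf.grad q hq))]
    simp only [jet]; ring
  have hE := hp.grad_of_good hp.good_EE hq
  have hH := ((grad_sin_sq q).mul (hp.grad_of_good hp.good_H1 hq)).congr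
    (a' := Real.sin q.2 ^ 2 * (delt p q * (jet p q).η₁)) (b' := Real.sin q.2 * (jet p q).χ)
    (by simp only [jet]; ring) (by simp only [jet, Jet.χ]; ring)
  obtain ⟨w₂, hw⟩ := hp.goodGrad_ww
  have hw' : HasGrad (ww p) (1 / 2 * (Real.sin q.2 * delt p q * (jet p q).ν)) (jet p q).w₂ q :=
    (hw.grad q hq).congr (by simp only [jet]; ring) (td_eq (hw.grad q hq)).symm
  exact grad_nullForm hW hb hE hH hw' i j

theorem Subextremal.metricNull_eventuallyEq (hp : Subextremal p) {y : Fin 4 → ℝ}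
    (hy : y ∈ nullDomain) (i j : Fin 4) :
    (fun z => metricNull p z i j) =ᶠ[𝓝 y] fun z => gg p (st z) i j := by
  filter_upwards [isOpen_nullDomain.mem_nhds hy] with z hz
  rw [hp.metricNull_eq hz]; rfl

theorem Subextremal.differentiableAt_metricNull (hp : Subextremal p) {y : Fin 4 → ℝ}
    (hy : y ∈ nullDomain) (i j : Fin 4) : DifferentiableAt ℝ (fun z => metricNull p z i j) y :=
  (hp.grad_gg (st_mem hy) i j).comp_st.differentiableAt.congr_of_eventuallyEq
    (hp.metricNull_eventuallyEq hy i j)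

theorem Subextremal.partialDeriv_metricNull (hp : Subextremal p) {y : Fin 4 → ℝ}
    (hy : y ∈ nullDomain) (l i j : Fin 4) :
    partialDeriv l (fun z => metricNull p z i j) y = (jet p (st y)).D l i j := by
  rw [partialDeriv, (hp.metricNull_eventuallyEq hy i j).fderiv_eq]
  exact (hp.grad_gg (st_mem hy) i j).partialDeriv_st l

theorem Subextremal.metricNull_mul_inv (hp : Subextremal p) {y : Fin 4 → ℝ} (hy : y ∈ nullDomain) :
    metricNull p y * nullFormInv (delt p (st y) * W1 p (st y)) (bb p (st y)) (EE p (st y))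
      (Real.sin (st y).2 ^ 2 * H1 p (st y)) (ww p (st y)) = 1 := by
  have hq := st_mem hy
  rw [hp.metricNull_eq hy]
  exact nullForm_mul_inv (mul_ne_zero (hp.delt_ne hq) (hp.W1_ne hq)) (hp.EE_ne hq)
    (mul_ne_zero (pow_ne_zero 2 (sin_pos_of_mem hq.2).ne') (hp.H1_ne hq))

theorem Subextremal.det_metricNull_ne (hp : Subextremal p) {y : Fin 4 → ℝ} (hy : y ∈ nullDomain) :
    (metricNull p y).det ≠ 0 := by
  intro h
  have := congrArg Matrix.det (hp.metricNull_mul_inv hy)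
  rw [Matrix.det_mul, h, zero_mul, Matrix.det_one] at this
  exact zero_ne_one this

theorem Subextremal.christoffel_eq (hp : Subextremal p) {y : Fin 4 → ℝ} (hy : y ∈ nullDomain)
    (k i j : Fin 4) : christoffel (metricNull p) k i j y = (jet p (st y)).Γ k i j := by
  rw [christoffel, Matrix.inv_eq_right_inv (hp.metricNull_mul_inv hy)]
  simp only [hp.partialDeriv_metricNull hy]
  rfl

/-! ### Bounds for the Christoffel symbols and the blow-up at the poles -/

theorem Bd.sym {m₀₀ m₀₁ m₀₂ m₀₃ m₁₁ m₁₂ m₁₃ m₂₂ m₂₃ m₃₃ : ℝ × ℝ → ℝ} (h₀₀ : Bd m₀₀)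
    (h₀₁ : Bd m₀₁) (h₀₂ : Bd m₀₂) (h₀₃ : Bd m₀₃) (h₁₁ : Bd m₁₁) (h₁₂ : Bd m₁₂) (h₁₃ : Bd m₁₃)
    (h₂₂ : Bd m₂₂) (h₂₃ : Bd m₂₃) (h₃₃ : Bd m₃₃) (i j : Fin 4) :
    Bd fun q => sym (m₀₀ q) (m₀₁ q) (m₀₂ q) (m₀₃ q) (m₁₁ q) (m₁₂ q) (m₁₃ q) (m₂₂ q) (m₂₃ q)
      (m₃₃ q) i j := by
  fin_cases i <;> fin_cases j
  exacts [h₀₀, h₀₁, h₀₂, h₀₃, h₀₁, h₁₁, h₁₂, h₁₃, h₀₂, h₁₂, h₂₂, h₂₃, h₀₃, h₁₃, h₂₃, h₃₃]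

/-- The coefficients in `jet` are bounded. -/
structure BdJet (x : ℝ × ℝ → Jet) : Prop where
  δ : Bd fun q => (x q).δ
  σ : Bd fun q => (x q).σ
  c : Bd fun q => (x q).c
  ω₁ : Bd fun q => (x q).ω₁
  ω₂ : Bd fun q => (x q).ω₂
  b : Bd fun q => (x q).b
  β₁ : Bd fun q => (x q).β₁
  ν : Bd fun q => (x q).ν
  ε₁ : Bd fun q => (x q).ε₁
  ε₂ : Bd fun q => (x q).ε₂
  H : Bd fun q => (x q).H
  η₁ : Bd fun q => (x q).η₁
  η₂ : Bd fun q => (x q).η₂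
  w : Bd fun q => (x q).w
  w₂ : Bd fun q => (x q).w₂

theorem Subextremal.bdJet (hp : Subextremal p) : BdJet (jet p) where
  δ := hp.bd_delt
  σ := hp.good_sin.bd
  c := hp.good_cos.bd
  ω₁ := ((hp.good_Δr'.bd.mul hp.bd_rsq₁).mul hp.good_W1.bd).add
    (hp.bd_delt.mul (hp.bd_sd hp.good_W1))
  ω₂ := ((hp.good_Δr'.bd.mul hp.bd_rsq₂).mul hp.good_W1.bd).add hp.good_W1.bd_td
  b := hp.good_bb.bd
  β₁ := hp.bd_sd hp.good_bb
  ν := (Bd.const _).mul hp.good_bq.bd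
  ε₁ := hp.bd_sd hp.good_EE
  ε₂ := hp.good_EE.bd_td
  H := hp.good_H1.bd
  η₁ := hp.bd_sd hp.good_H1
  η₂ := hp.good_H1.bd_td
  w := hp.bd_w0
  w₂ := by
    obtain ⟨w₂, hw⟩ := hp.goodGrad_ww
    exact Good.bd_td ⟨_, _, hw⟩

variable {x : ℝ × ℝ → Jet}

theorem BdJet.χ (hx : BdJet x) : Bd fun q => (x q).χ :=
  (((Bd.const 2).mul hx.c).mul hx.H).add (hx.σ.mul hx.η₂)

/-- All entries are polynomials in the jet, written without powers, so closure of `Bd` under sums,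
products and negation suffices; no inverse occurs. -/
theorem BdJet.bd_Γ (hx : BdJet x) (i j : Fin 4) : Bd (fun q => (x q).Γu i j) ∧
    Bd (fun q => (x q).Γv i j) ∧ Bd (fun q => (x q).Γθ i j) ∧ Bd (fun q => (x q).Γφ i j) ∧
    Bd (fun q => (x q).Γcot i j) := by
  have hχ := hx.χ
  obtain ⟨hδ, hσ, hc, hω₁, hω₂, hb, hβ₁, hν, hε₁, hε₂, hH, hη₁, hη₂, hw, hw₂⟩ := hx
  refine ⟨?_, ?_, ?_, ?_, ?_⟩ <;> refine Bd.sym ?_ ?_ ?_ ?_ ?_ ?_ ?_ ?_ ?_ ?_ i j <;>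
    repeat' first
      | assumption
      | exact Bd.const _
      | apply Bd.neg
      | apply Bd.mul
      | apply Bd.add

/-- The symbols other than `Γ^φ⋆` are bounded. -/
theorem Subextremal.bd_christoffel (hp : Subextremal p) {k : Fin 4} (hk : k ≠ 3) (i j : Fin 4) :
    ∃ C, ∀ y ∈ nullDomain, |christoffel (metricNull p) k i j y| ≤ C := by
  suffices h : Bd fun q => (jet p q).Γ k i j by
    obtain ⟨C, hC⟩ := h
    exact ⟨C, fun y hy => by rw [hp.christoffel_eq hy]; exact hC _ (st_mem hy)⟩
  obtain ⟨hu, hv, hθ, -, -⟩ := hp.bdJet.bd_Γ i j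
  fin_cases k
  · exact (hp.bd_inv_W1.mul hu).congr fun q hq =>
      (Jet.Γ_zero (x := jet p q) (hp.delt_ne hq) (hp.W1_ne hq) i j).symm
  · exact (hp.bd_inv_W1.mul hv).congr fun q hq =>
      (Jet.Γ_one (x := jet p q) (hp.delt_ne hq) (hp.W1_ne hq) i j).symm
  · exact (hp.bd_inv_EE.mul hθ).congr fun q hq =>
      (Jet.Γ_two (x := jet p q) (hp.EE_ne hq) i j).symm
  · exact absurd rfl hk

/-- The symbols `Γ^φ⋆` are bounded up to a multiple of `cot θ⋆`. -/
theorem Subextremal.christoffel_three (hp : Subextremal p) (i j : Fin 4) :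
    ∃ C > 0, ∀ y ∈ nullDomain, |christoffel (metricNull p) 3 i j y -
      Real.cos (y 2) / Real.sin (y 2) * (jet p (st y)).Γcot i j| ≤ C := by
  obtain ⟨-, hv, hθ, hφ, -⟩ := hp.bdJet.bd_Γ i j
  have hb := hp.bdJet
  obtain ⟨C, hC0, hC⟩ := Bd.exists_pos (((hb.b.mul (hp.bd_inv_W1.mul hv)).neg.sub
    ((hb.σ.mul hb.w).mul (hp.bd_inv_EE.mul hθ))).add (hp.bd_inv_H1.mul hφ))
  refine ⟨C, hC0, fun y hy => ?_⟩
  have hq := st_mem hy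
  have h := Jet.Γ_three (x := jet p (st y)) (sin_pos_of_mem hq.2).ne' (hp.delt_ne hq) (hp.W1_ne hq)
    (hp.EE_ne hq) (hp.H1_ne hq) i j
  rw [hp.christoffel_eq hy, h]
  refine le_of_eq_of_le ?_ (hC _ hq)
  congr 1
  exact add_sub_cancel_right _ _

/-- Since `Δr < 0` and `Δθ ≥ 1`, the numerator of `B` is at least `|Ξ a| a²` in absolute value, and
`Υ` is bounded. Here `a ≠ 0` is essential. -/
theorem Subextremal.bb_ge (hp : Subextremal p) : ∃ c > 0, ∀ q ∈ DD, c ≤ |bb p q| := by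
  obtain ⟨C, hC0, hC⟩ := hp.good_UU.bd.exists_pos
  have ha := abs_pos.2 hp.a_ne
  have hΞ : 0 < |Ξ p| := abs_pos.2 hp.Xi_ne
  have ha2 : 0 < p.a ^ 2 := by have := hp.a_ne; positivity
  refine ⟨2 * (|Ξ p| * |p.a| * p.a ^ 2 * C⁻¹), by positivity, fun q hq => ?_⟩
  have hU := hp.UU_pos (hp.rs_mem hq) q.2
  have h1 : p.a ^ 2 ≤ nn p (rs p q) * pull p (DT p) q - delt p q := by
    have h2 : p.a ^ 2 ≤ nn p (rs p q) := by unfold nn; nlinarith [sq_nonneg (rs p q)]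
    have h3 : 1 ≤ pull p (DT p) q := hp.DT_ge _ _
    have h4 : delt p q < 0 := hp.Δr_rs_neg hq
    nlinarith
  have h5 : C⁻¹ ≤ |(pull p (UU p) q)⁻¹| := by
    rw [abs_inv]; exact inv_anti₀ (abs_pos.2 hU.ne') (hC q hq)
  rw [bb, hp.bet_eq' hq, abs_mul, abs_mul, abs_mul, abs_mul, abs_neg, abs_two]
  have h6 := h1.trans (le_abs_self _)
  gcongr

/-- A function which is bounded up to a multiple of `cot τ` whose coefficient is bounded and bounded
away from zero blows up like `1 / sin τ`. -/
theorem blow_up {ι : Type*} {S : Set ι} {τ Γ s : ι → ℝ} {C s₀ s₁ : ℝ}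
    (hτ : ∀ y ∈ S, 0 < Real.sin (τ y))
    (hC : 0 < C) (hs₀ : 0 < s₀)
    (h : ∀ y ∈ S, |Γ y - Real.cos (τ y) / Real.sin (τ y) * s y| ≤ C)
    (hs : ∀ y ∈ S, s₀ ≤ |s y| ∧ |s y| ≤ s₁) :
    ∃ c C δ : ℝ, 0 < c ∧ 0 < C ∧ 0 < δ ∧ ∀ y ∈ S, |Γ y| ≤ C / Real.sin (τ y) ∧
      (Real.sin (τ y) < δ → c / Real.sin (τ y) ≤ |Γ y|) := by
  -- For `sin τ < 1/2` one has `|cos τ| ≥ 1/2`, so the main term of `Γ sin τ` is at least `s₀ / 2`;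
  -- for `sin τ < s₀ / (4 C)` the error `C sin τ` is at most `s₀ / 4`.
  refine ⟨s₀ / 4, C + |s₁|, min (1 / 2) (s₀ / (4 * C)), by positivity, by positivity,
    by positivity, fun y hy => ?_⟩
  have hσ := hτ y hy
  have hσ1 := Real.sin_le_one (τ y)
  have hc1 := Real.abs_cos_le_one (τ y)
  obtain ⟨h1, h2⟩ := hs y hy
  have h3 : |Γ y * Real.sin (τ y) - Real.cos (τ y) * s y| ≤ C * Real.sin (τ y) := by
    have := mul_le_mul_of_nonneg_right (h y hy) hσ.le
    rwa [← abs_of_pos hσ, ← abs_mul, sub_mul, abs_of_pos hσ,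
      show Real.cos (τ y) / Real.sin (τ y) * s y * Real.sin (τ y) = Real.cos (τ y) * s y by
        field_simp] at this
  have h4 : |Γ y| * Real.sin (τ y) = |Γ y * Real.sin (τ y)| := by rw [abs_mul, abs_of_pos hσ]
  constructor
  · rw [le_div_iff₀ hσ, h4]
    calc |Γ y * Real.sin (τ y)| ≤ |Γ y * Real.sin (τ y) - Real.cos (τ y) * s y| +
          |Real.cos (τ y) * s y| := by
          simpa using abs_add_le (Γ y * Real.sin (τ y) - Real.cos (τ y) * s y) (Real.cos (τ y) * s y)
      _ ≤ C * 1 + 1 * |s₁| := by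
          rw [abs_mul]
          have := h2.trans (le_abs_self s₁)
          refine add_le_add (h3.trans (by gcongr)) (by gcongr)
      _ = _ := by ring
  · intro hlt
    have h5 : Real.sin (τ y) < 1 / 2 := hlt.trans_le (min_le_left _ _)
    have h6 : Real.sin (τ y) * (4 * C) < s₀ :=
      (lt_div_iff₀ (by positivity)).1 (hlt.trans_le (min_le_right _ _))
    have h7 : 1 / 2 ≤ |Real.cos (τ y)| := by
      by_contra! h'
      nlinarith [Real.sin_sq_add_cos_sq (τ y), sq_abs (Real.cos (τ y)), abs_nonneg (Real.cos (τ y))]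
    rw [div_le_iff₀ hσ, h4]
    have h8 : |Real.cos (τ y) * s y| ≤ |Γ y * Real.sin (τ y)| +
        |Γ y * Real.sin (τ y) - Real.cos (τ y) * s y| := by
      have := abs_sub_abs_le_abs_sub (Real.cos (τ y) * s y) (Γ y * Real.sin (τ y))
      rw [abs_sub_comm] at this
      linarith
    have h9 : 1 / 2 * s₀ ≤ |Real.cos (τ y) * s y| := by rw [abs_mul]; gcongr
    nlinarith

theorem Subextremal.christoffel_exceptional (hp : Subextremal p) {k i j : Fin 4}
    (h : (k, i, j) ∈ exceptional) :
    ∃ c C δ : ℝ, 0 < c ∧ 0 < C ∧ 0 < δ ∧ ∀ y ∈ nullDomain,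
      |christoffel (metricNull p) k i j y| ≤ C / Real.sin (y 2) ∧
      (Real.sin (y 2) < δ → c / Real.sin (y 2) ≤ |christoffel (metricNull p) k i j y|) := by
  have key : ∀ i j : Fin 4, (∃ s₀ > 0, ∃ s₁, ∀ y ∈ nullDomain,
      s₀ ≤ |(jet p (st y)).Γcot i j| ∧ |(jet p (st y)).Γcot i j| ≤ s₁) →
      ∃ c C δ : ℝ, 0 < c ∧ 0 < C ∧ 0 < δ ∧ ∀ y ∈ nullDomain,
      |christoffel (metricNull p) 3 i j y| ≤ C / Real.sin (y 2) ∧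
      (Real.sin (y 2) < δ → c / Real.sin (y 2) ≤ |christoffel (metricNull p) 3 i j y|) := by
    rintro i j ⟨s₀, hs₀, s₁, hs⟩
    obtain ⟨C, hC0, hC⟩ := hp.christoffel_three i j
    exact blow_up (τ := fun y : Fin 4 → ℝ => y 2) (fun y hy => sin_pos_of_mem hy) hC0 hs₀ hC hs
  obtain ⟨c, hc, hb⟩ := hp.bb_ge
  obtain ⟨C, hC⟩ := hp.good_bb.bd
  have hbb : ∃ s₀ > 0, ∃ s₁, ∀ y ∈ nullDomain, s₀ ≤ |(jet p (st y)).b| ∧ |(jet p (st y)).b| ≤ s₁ :=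
    ⟨c, hc, C, fun y hy => ⟨hb _ (st_mem hy), hC _ (st_mem hy)⟩⟩
  have h1 : ∃ s₀ > (0 : ℝ), ∃ s₁, ∀ y ∈ nullDomain, s₀ ≤ |(1 : ℝ)| ∧ |(1 : ℝ)| ≤ s₁ :=
    ⟨1, one_pos, 1, fun _ _ => by simp⟩
  simp only [exceptional, mem_insert_iff, mem_singleton_iff, Prod.mk.injEq] at h
  rcases h with ⟨rfl, rfl, rfl⟩ | ⟨rfl, rfl, rfl⟩ | ⟨rfl, rfl, rfl⟩ | ⟨rfl, rfl, rfl⟩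
  exacts [key _ _ hbb, key _ _ hbb, key _ _ h1, key _ _ h1]

theorem Subextremal.christoffel_not_exceptional (hp : Subextremal p) {k i j : Fin 4}
    (h : (k, i, j) ∉ exceptional) :
    ∃ C, ∀ y ∈ nullDomain, |christoffel (metricNull p) k i j y| ≤ C := by
  by_cases hk : k = 3
  · subst hk
    obtain ⟨C, -, hC⟩ := hp.christoffel_three i j
    refine ⟨C, fun y hy => ?_⟩
    -- The nonzero entries of `Γcot` sit exactly at the exceptional index pairs.
    have h0 : (jet p (st y)).Γcot i j = 0 := by
      fin_cases i <;> fin_cases j <;> first | rfl | exact absurd (by simp [exceptional]) h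
    simpa [h0] using hC y hy
  · exact hp.bd_christoffel hk i j

end

end KNdS

/-- In the coordinates `(u, v, θ⋆, φ⋆)` of the interior of a subextremal KNdS black hole, all
Christoffel symbols are bounded, except for `Γ^{φ⋆}_{v θ⋆}` and `Γ^{φ⋆}_{θ⋆ φ⋆}`, which blow up
exactly like `1 / sin θ⋆`. The first three conjuncts say that the objects are well defined. -/
theorem mainTheorem11 (p : KNdS.Params) (rn rc : ℝ)
    (hΛ : 0 < p.Λ) (ha : p.a ≠ 0)
    (hrn : KNdS.Δr p rn = 0) (hrm : KNdS.Δr p p.rm = 0)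
    (hrp : KNdS.Δr p p.rp = 0) (hrc : KNdS.Δr p rc = 0)
    (h_n : rn < 0) (h_m : 0 < p.rm) (h_mp : p.rm < p.rp) (h_pc : p.rp < rc)
    (hr0 : p.r0 ∈ Set.Ioo p.rm p.rp) :
    (∀ r ∈ Set.Icc p.rm p.rp, ∀ θ ∈ Set.Ioo 0 (Real.pi / 2),
      ∃! τ : ℝ, τ ∈ Set.Ico θ (Real.pi / 2) ∧ KNdS.F p r θ τ = 0) ∧
    Set.BijOn (KNdS.starMap p) (KNdS.region p) (Set.univ ×ˢ Set.Ioo 0 Real.pi) ∧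
    (∀ y ∈ KNdS.nullDomain,
      DifferentiableAt ℝ (KNdS.toBL p) y ∧
      (∀ i j, DifferentiableAt ℝ (fun z => KNdS.metricNull p z i j) y) ∧
      (KNdS.metricNull p y).det ≠ 0) ∧
    (∀ k i j : Fin 4, (k, i, j) ∉ KNdS.exceptional →
      ∃ C : ℝ, ∀ y ∈ KNdS.nullDomain, |christoffel (KNdS.metricNull p) k i j y| ≤ C) ∧
    (∀ k i j : Fin 4, (k, i, j) ∈ KNdS.exceptional →
      ∃ c C δ : ℝ, 0 < c ∧ 0 < C ∧ 0 < δ ∧ ∀ y ∈ KNdS.nullDomain,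
        |christoffel (KNdS.metricNull p) k i j y| ≤ C / Real.sin (y 2) ∧
        (Real.sin (y 2) < δ →
          c / Real.sin (y 2) ≤ |christoffel (KNdS.metricNull p) k i j y|)) := by
  have hp := KNdS.Subextremal.of_roots p rn rc hΛ ha hrn hrm hrp hrc h_n h_m h_mp h_pc hr0
  exact ⟨fun r hr θ hθ => hp.existsUnique_tau hr hθ, hp.bijOn_starMap,
    fun y hy => ⟨(hp.jacobian_toBL hy).1, hp.differentiableAt_metricNull hy,
      hp.det_metricNull_ne hy⟩,
    fun _ _ _ h => hp.christoffel_not_exceptional h, fun _ _ _ h => hp.christoffel_exceptional h⟩
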